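/- Let $a_1,a_2,a_3\ge 1$ be integers and $w=a_1+a_2+a_3$. For $\tau=\tau_1+i\tau_2$ with $\tau_2>0$ put $$C_{a_1,a_2,a_3}(\tau)=\sum \prod_{r=1}^3\left(\frac{\tau_2}{\pi|m_r+n_r\tau|^2}\right)^{a_r},$$ where the sum runs over all triples of pairs $(m_r,n_r)\in\mathbb Z^2\setminus\{(0,0)\}$, $r=1,2,3$, with $m_1+m_2+m_3=0$ and $n_1+n_2+n_3=0$. Its constant Fourier mode $C^{(0)}(\tau_2)=\int_0^1 C_{a_1,a_2,a_3}(\tau_1+i\tau_2)\,d\tau_1$ can be written in exactly one way as $\sum_j c_j(4\pi\tau_2)^j+\mathcal E(\tau_2)$, where the first sum is a Laurent polynomial (finitely many $j\in\mathbb Z$, $c_j\in\mathbb R$) and $\mathcal E(\tau_2)=O(e^{-\delta\tau_2})$ as $\tau_2\to\infty$ for some $\delta>0$. The coefficient $c_{2-w}$ of $(4\pi\tau_2)^{2-w}$ is a linear combination, with rational coefficients, of products of two odd zeta values whose weights add up to $2w-2$: there are rational numbers $\gamma_k$ such that $$c_{2-w}=\sum_{k=1}^{w-3}\frac{\gamma_k}{2}\,\zeta(2k+1)\,\zeta(2w-2k-3),$$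 with no additional term in $\pi^{2w-2}\mathbb Q$ (for $w=3$ the sum is empty and $c_{-1}=0$). -/

import Mathlib

/-- The modular graph function `C_{a_1, …, a_ℓ}(τ)` for `τ` in the upper half plane: the sum, over all
families `p_r = (m_r, n_r) ∈ ℤ² ∖ {(0, 0)}`, `1 ≤ r ≤ ℓ`, with `∑ m_r = 0` and `∑ n_r = 0`, of
`∏_r (τ₂ / (π |m_r + n_r τ|²)) ^ a_r`, where `τ₂ = Im τ`. -/
noncomputable def modularGraphC {ℓ : ℕ} (a : Fin ℓ → ℕ) (τ : ℂ) : ℝ :=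
  ∑' p : {p : Fin ℓ → ℤ × ℤ // (∀ r, p r ≠ 0) ∧ ∑ r, p r = 0},
    ∏ r, (τ.im / (Real.pi * ‖((p.1 r).1 : ℂ) + ((p.1 r).2 : ℂ) * τ‖ ^ 2)) ^ a r

/-- The constant (zeroth) Fourier mode in `τ₁ = Re τ`, as a function of `τ₂ = Im τ`, of a function
that is invariant under `τ ↦ τ + 1`. -/
noncomputable def constantMode (f : ℂ → ℝ) (τ₂ : ℝ) : ℝ :=
  ∫ τ₁ in (0 : ℝ)..1, f (τ₁ + τ₂ * Complex.I)

/-- `F` is the sum of the Laurent polynomial `∑_j c_j (4 π τ₂) ^ j` (with finitely many nonzero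
coefficients) and of a term that decays exponentially as `τ₂ → ∞`. -/
def IsLaurentPart (F : ℝ → ℝ) (c : ℤ →₀ ℝ) : Prop :=
  ∃ δ : ℝ, 0 < δ ∧
    (fun τ₂ : ℝ => F τ₂ - c.sum fun j x => x * (4 * Real.pi * τ₂) ^ j)
      =O[Filter.atTop] fun τ₂ : ℝ => Real.exp (-δ * τ₂)

/-! Write y = τ₂ and let the exponents be a + 1, b + 1, c + 1, so that w = a + b + c + 3. The
argument has an analytic half, which isolates the coefficient as a lattice sum, and an algebraic
half, which evaluates that sum.

Analysis. For fixed (n₁, n₂, n₃) of sum zero, the sum over the m's is ∫₀¹ D₁ D₂ D₃ dα by Parseval,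
where D_r is the Fourier series in α with coefficients (n_r² y² + (m + n_r τ₁)²)⁻¹ to the given
powers. Poisson summation turns D_r into a periodization of the exponentially decaying
`resolventKernel` with phases exp(-2πi(α + k) n_r τ₁); for n_r = 0 it is a Bernoulli polynomial.
Averaging over τ₁ keeps the k with n₁k₁ + n₂k₂ + n₃k₃ = 0
(`TwistedExpansion.exists_hasSum_constraint`). If no n_r vanishes, the diagonal k₁ = k₂ = k₃ unfolds
to an integral over ℝ of three kernels, a pure power y^(-(2w-2)), and all other k are exponentially
small. If one n_r vanishes, the Bernoulli polynomial gives a polynomial in 1/y, in which only its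
odd power of α matters for y^(-(2w-2)). Hence (`uniformLaurent_modeSum`) the coefficient in question
is 4^(w-2)/π² times `totalCoeff`, the sum of `latticeCoeff` over all n.

Algebra. With x_i = n_i², the numbers `latticeCoeff` for varying a, b, c are Taylor coefficients in
t of F(x - t), where F = π²/(M₁M₂M₃(M₁+M₂+M₃)) and M_i = √x_i (for a vanishing n_r, of the part of F
even in M_r). F is homogeneous of degree -2 and satisfies differential equations linear in a vector
μ, with sources (x_i x_j)^(-3/2). As n₁ + n₂ + n₃ = 0, the point x lies on the null cone of the
quadratic form Q of `quadOp`, and the choice μ = x + t combines these into 2(d+1)f + Q(t)□f = source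
in degree d = a + b + c (`add_quadOp_boxOp_eq_sourceTerm`). The operator on the left does not
involve n, so the equation can be summed over n. The source becomes π² times a rational combination
of ζ(2i+3)ζ(2j+3); the terms that could produce even zeta values are odd in n and cancel. Finally
2(d+1) + Q□ is invertible over ℚ in each degree, because the commutator of □ and Q is 4d + 6
(`boxOp_quadOp`, `mem_of_add_quadOp_boxOp_mem`), so `totalCoeff` lies in the same span
(`totalCoeff_mem`). -/

/-! ### Degreewise inversion of r + Q□ over ℚ. -/

/-- The second order operator `∂₁∂₂ + ∂₁∂₃ + ∂₂∂₃`, acting on coefficient arrays. -/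
def boxOp (F : ℤ → ℤ → ℤ → ℝ) (a b c : ℤ) : ℝ :=
  (a + 1) * (b + 1) * F (a + 1) (b + 1) c + (a + 1) * (c + 1) * F (a + 1) b (c + 1)
    + (b + 1) * (c + 1) * F a (b + 1) (c + 1)

/-- Multiplication by the quadratic form `2 (t₁t₂ + t₁t₃ + t₂t₃) - t₁² - t₂² - t₃²`, acting on
coefficient arrays. -/
def quadOp (F : ℤ → ℤ → ℤ → ℝ) (a b c : ℤ) : ℝ :=
  2 * (F (a - 1) (b - 1) c + F (a - 1) b (c - 1) + F a (b - 1) (c - 1))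
    - F (a - 2) b c - F a (b - 2) c - F a b (c - 2)

/-- A coefficient array of a power series: it vanishes when an index is negative. -/
def NonnegSupport (F : ℤ → ℤ → ℤ → ℝ) : Prop :=
  ∀ a b c, a < 0 ∨ b < 0 ∨ c < 0 → F a b c = 0

theorem NonnegSupport.boxOp {F : ℤ → ℤ → ℤ → ℝ} (hF : NonnegSupport F) :
    NonnegSupport (boxOp F) := by
  intro a b c h
  have z : ∀ p : ℤ, p < 0 → (p + 1 : ℤ) < 0 ∨ ((p : ℝ) + 1) = 0 := by
    intro p hp
    rcases lt_or_eq_of_le (show p + 1 ≤ 0 by omega) with h | h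
    · exact Or.inl h
    · right; exact_mod_cast h
  unfold _root_.boxOp
  rcases h with h | h | h
  · rw [hF a (b + 1) (c + 1) (Or.inl h)]
    rcases z a h with h' | h'
    · rw [hF _ _ _ (Or.inl h'), hF _ _ _ (Or.inl h')]; simp
    · rw [h']; simp
  · rw [hF (a + 1) b (c + 1) (Or.inr (Or.inl h))]
    rcases z b h with h' | h'
    · rw [hF _ _ _ (Or.inr (Or.inl h')), hF _ _ _ (Or.inr (Or.inl h'))]; simp
    · rw [h']; simp
  · rw [hF (a + 1) (b + 1) c (Or.inr (Or.inr h))]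
    rcases z c h with h' | h'
    · rw [hF _ _ _ (Or.inr (Or.inr h')), hF _ _ _ (Or.inr (Or.inr h'))]; simp
    · rw [h']; simp

theorem NonnegSupport.quadOp {F : ℤ → ℤ → ℤ → ℝ} (hF : NonnegSupport F) :
    NonnegSupport (quadOp F) := by
  intro a b c h
  unfold _root_.quadOp
  rw [hF (a - 1) (b - 1) c (by omega), hF (a - 1) b (c - 1) (by omega),
    hF a (b - 1) (c - 1) (by omega), hF (a - 2) b c (by omega), hF a (b - 2) c (by omega),
    hF a b (c - 2) (by omega)]
  simp

/-- The symmetric matrices of the two quadratic forms are inverse to each other, so □ and Q generate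
an sl₂: their commutator is 4 times the Euler operator plus twice the dimension 3. -/
theorem boxOp_quadOp (G : ℤ → ℤ → ℤ → ℝ) (a b c : ℤ) :
    boxOp (quadOp G) a b c = quadOp (boxOp G) a b c + (4 * (a + b + c) + 6) * G a b c := by
  simp only [boxOp, quadOp]
  have e1 : ∀ p : ℤ, p + 1 - 1 = p := fun p => by ring
  have e2 : ∀ p : ℤ, p + 1 - 2 = p - 1 := fun p => by ring
  have e3 : ∀ p : ℤ, p - 1 + 1 = p := fun p => by ring
  have e4 : ∀ p : ℤ, p - 2 + 1 = p - 1 := fun p => by ring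
  simp only [e1, e2, e3, e4]
  push_cast
  ring

/-- The operator `r + λ □` is invertible over `ℚ` in each degree, where `r > 0`. -/
theorem mem_of_add_quadOp_boxOp_mem (X : Submodule ℚ ℝ) (N : ℕ) :
    ∀ (d : ℤ) (r : ℚ) (F : ℤ → ℤ → ℤ → ℝ), d < 2 * N → 0 < r → NonnegSupport F →
      (∀ a b c, a + b + c = d → (r : ℝ) * F a b c + quadOp (boxOp F) a b c ∈ X) →
      ∀ a b c, a + b + c = d → F a b c ∈ X := by
  induction N with
  | zero =>
    intro d r F hd _ hF _ a b c habc
    rw [hF a b c (by simp at hd; omega)]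
    exact X.zero_mem
  | succ N ih =>
    intro d r F hd hr hF h
    -- Applying □ to the hypothesis and commuting it past Q shows that □F satisfies an equation of
    -- the same type in degree d - 2, with r replaced by the still positive r + 4(d - 2) + 6.
    have hG : ∀ a b c, a + b + c = d - 2 → boxOp F a b c ∈ X := by
      rcases lt_or_ge d 2 with hd2 | hd2
      · intro a b c habc
        rw [hF.boxOp a b c (by omega)]
        exact X.zero_mem
      · have hr' : (0 : ℚ) < r + (4 * (d - 2) + 6) := by
          have : (2 : ℚ) ≤ d := by exact_mod_cast hd2
          linarith
        refine ih (d - 2) (r + (4 * (d - 2) + 6)) (boxOp F) (by push_cast at hd; omega) hr'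
          hF.boxOp ?_
        intro a b c habc
        have hsm : ∀ (p q : ℤ) (x : ℝ), x ∈ X → ((p : ℝ) + 1) * (q + 1) * x ∈ X := by
          intro p q x hx
          have := X.smul_mem (((p : ℚ) + 1) * (q + 1)) hx
          rw [Rat.smul_def] at this
          push_cast at this
          exact this
        have h1 := hsm a b _ (h (a + 1) (b + 1) c (by omega))
        have h2 := hsm a c _ (h (a + 1) b (c + 1) (by omega))
        have h3 := hsm b c _ (h a (b + 1) (c + 1) (by omega))
        have h4 := X.add_mem (X.add_mem h1 h2) h3
        have h5 := boxOp_quadOp (boxOp F) a b c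
        have h6 : ((a : ℝ) + b + c) = d - 2 := by exact_mod_cast habc
        rw [h6] at h5
        convert h4 using 1
        have h7 : boxOp (quadOp (boxOp F)) a b c =
          (a + 1) * (b + 1) * quadOp (boxOp F) (a + 1) (b + 1) c
            + (a + 1) * (c + 1) * quadOp (boxOp F) (a + 1) b (c + 1)
            + (b + 1) * (c + 1) * quadOp (boxOp F) a (b + 1) (c + 1) := rfl
        have h8 : boxOp F a b c = (a + 1) * (b + 1) * F (a + 1) (b + 1) c
            + (a + 1) * (c + 1) * F (a + 1) b (c + 1) + (b + 1) * (c + 1) * F a (b + 1) (c + 1) := rfl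
        push_cast
        linear_combination (-1 : ℝ) * h5 + h7 + (r : ℝ) * h8
    intro a b c habc
    have hq : quadOp (boxOp F) a b c ∈ X := by
      have h2 : ∀ x : ℝ, x ∈ X → 2 * x ∈ X := fun x hx => by
        rw [two_mul]; exact X.add_mem hx hx
      unfold quadOp
      refine X.sub_mem (X.sub_mem (X.sub_mem (h2 _ (X.add_mem (X.add_mem ?_ ?_) ?_)) ?_) ?_) ?_ <;>
        exact hG _ _ _ (by omega)
    have h1 := X.sub_mem (h a b c habc) hq
    rw [add_sub_cancel_right] at h1
    have h2 := X.smul_mem (r⁻¹) h1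
    rw [Rat.smul_def] at h2
    have hr0 : (r : ℝ) ≠ 0 := by exact_mod_cast hr.ne'
    push_cast at h2
    rwa [inv_mul_cancel_left₀ hr0] at h2
open MeasureTheory Filter Topology


/-! ### The kernel whose Fourier transform is (x + ξ²)^(-(a+1)). -/

/-- The polynomial factor of the Fourier transform of `ξ ↦ (x + ξ²) ^ (-(a + 1))`. -/
noncomputable def besselPoly : ℕ → Polynomial ℝ
  | 0 => 1
  | a + 1 => Polynomial.C (1 / (2 * ((a : ℝ) + 1))) *
      ((Polynomial.C (2 * (a : ℝ) + 1) + Polynomial.C (2 * Real.pi) * Polynomial.X) * besselPoly a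
        - Polynomial.X * Polynomial.derivative (besselPoly a))

/-- The Fourier transform of `ξ ↦ (x + ξ²) ^ (-(a + 1))`, for `x > 0`. -/
noncomputable def resolventKernel (a : ℕ) (x s : ℝ) : ℝ :=
  Real.pi / √x ^ (2 * a + 1) * (besselPoly a).eval (√x * |s|)
    * Real.exp (-(2 * Real.pi * (√x * |s|)))

theorem continuous_resolventKernel (a : ℕ) (x : ℝ) : Continuous (resolventKernel a x) := by
  unfold resolventKernel
  have := (besselPoly a).continuous
  fun_prop

theorem resolventKernel_scale (a : ℕ) {x y : ℝ} (hy : 0 < y) (s : ℝ) :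
    resolventKernel a (x * y ^ 2) s = (y⁻¹) ^ (2 * a + 1) * resolventKernel a x (y * s) := by
  unfold resolventKernel
  have h1 : √(x * y ^ 2) = √x * y := by
    rw [Real.sqrt_mul' _ (by positivity), Real.sqrt_sq hy.le]
  have h2 : √x * y * |s| = √x * |y * s| := by rw [abs_mul, abs_of_pos hy]; ring
  rw [h1, h2, mul_pow, div_mul_eq_div_div, div_eq_mul_inv _ (y ^ _), inv_pow]
  ring

/-- The recursion for `besselPoly` is made for this: with v = √x |s|, it is what remains after
differentiating the kernel in x and dividing by -(a + 1). -/
theorem hasDerivAt_resolventKernel (a : ℕ) {x : ℝ} (hx : 0 < x) (s : ℝ) :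
    HasDerivAt (fun x => resolventKernel a x s) (-((a : ℝ) + 1) * resolventKernel (a + 1) x s) x := by
  have hM : 0 < √x := Real.sqrt_pos.mpr hx
  have hs := Real.hasDerivAt_sqrt hx.ne'
  have h1 : HasDerivAt (fun x => (√x ^ (2 * a + 1))⁻¹)
      (-(((2 * a + 1 : ℕ) : ℝ) * √x ^ (2 * a) * (1 / (2 * √x))) / (√x ^ (2 * a + 1)) ^ 2) x := by
    exact (hs.pow (2 * a + 1)).inv (pow_ne_zero _ hM.ne')
  have h2 : HasDerivAt (fun x => √x * |s|) (1 / (2 * √x) * |s|) x := hs.mul_const _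
  have h3 : HasDerivAt (fun x => (besselPoly a).eval (√x * |s|))
      ((Polynomial.derivative (besselPoly a)).eval (√x * |s|) * (1 / (2 * √x) * |s|)) x :=
    HasDerivAt.comp (h₂ := fun v => (besselPoly a).eval v) x ((besselPoly a).hasDerivAt _) h2
  have h4 : HasDerivAt (fun x => Real.exp (-(2 * Real.pi * (√x * |s|))))
      (Real.exp (-(2 * Real.pi * (√x * |s|))) * (-(2 * Real.pi * (1 / (2 * √x) * |s|)))) x :=
    ((h2.const_mul (2 * Real.pi)).neg).exp
  have h5 := ((h1.const_mul Real.pi).mul h3).mul h4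
  have hf : (fun x => resolventKernel a x s) =
      (((fun y => Real.pi * (√y ^ (2 * a + 1))⁻¹) * fun x => (besselPoly a).eval (√x * |s|)) *
        fun x => Real.exp (-(2 * Real.pi * (√x * |s|)))) := by
    ext x; simp [resolventKernel, div_eq_mul_inv]
  rw [hf]
  refine h5.congr_deriv ?_
  simp only [resolventKernel, besselPoly, Polynomial.eval_mul, Polynomial.eval_sub,
    Polynomial.eval_add, Polynomial.eval_C, Polynomial.eval_X, Pi.mul_apply]
  set M := √x
  have hM' : M ≠ 0 := hM.ne'
  have ha : (a : ℝ) + 1 ≠ 0 := by positivity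
  have e1 : M ^ (2 * (a + 1) + 1) = M ^ (2 * a) * M ^ 3 := by ring
  have e2 : M ^ (2 * a + 1) = M ^ (2 * a) * M := by ring
  rw [e1, e2]
  have hp : M ^ (2 * a) ≠ 0 := by positivity
  push_cast
  field_simp
  ring

theorem Polynomial.exists_abs_eval_le_exp (p : Polynomial ℝ) :
    ∃ C : ℝ, 0 < C ∧ ∀ v : ℝ, 0 ≤ v → |p.eval v| ≤ C * Real.exp v := by
  induction p using Polynomial.induction_on' with
  | add p q hp hq =>
    obtain ⟨C, hC, h⟩ := hp
    obtain ⟨D, hD, h'⟩ := hq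
    refine ⟨C + D, by positivity, fun v hv => ?_⟩
    rw [Polynomial.eval_add, add_mul]
    exact (abs_add_le _ _).trans (add_le_add (h v hv) (h' v hv))
  | monomial n r =>
    refine ⟨|r| * n.factorial + 1, by positivity, fun v hv => ?_⟩
    have := Real.pow_div_factorial_le_exp v hv n
    rw [div_le_iff₀ (by positivity)] at this
    rw [Polynomial.eval_monomial, abs_mul, abs_of_nonneg (pow_nonneg hv n)]
    have h2 := mul_le_mul_of_nonneg_left this (abs_nonneg r)
    have := Real.exp_pos v
    nlinarith

/-- Half of the decay exp(-2πv) is spent on the polynomial factor; the constant depends on neither x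
nor s, which later makes the estimates uniform in n and y. -/
theorem exists_abs_resolventKernel_le (a : ℕ) :
    ∃ C : ℝ, 0 < C ∧ ∀ x s : ℝ, 0 < x →
      |resolventKernel a x s| ≤ C / √x ^ (2 * a + 1) * Real.exp (-(Real.pi * (√x * |s|))) := by
  obtain ⟨C, hC, h⟩ := Polynomial.exists_abs_eval_le_exp (besselPoly a)
  refine ⟨Real.pi * C, by positivity, fun x s hx => ?_⟩
  have hv : 0 ≤ √x * |s| := by positivity
  have hM : 0 < √x := Real.sqrt_pos.mpr hx
  unfold resolventKernel
  rw [abs_mul, abs_mul, abs_of_pos (Real.exp_pos _), abs_of_pos (by positivity : 0 < Real.pi / √x ^ (2 * a + 1))]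
  set v := √x * |s|
  have h1 : Real.exp v ≤ Real.exp (Real.pi * v) :=
    Real.exp_le_exp.mpr (le_mul_of_one_le_left hv (by linarith [Real.pi_gt_three]))
  have h2 : |(besselPoly a).eval v| ≤ C * Real.exp (Real.pi * v) :=
    (h v hv).trans (mul_le_mul_of_nonneg_left h1 hC.le)
  calc Real.pi / √x ^ (2 * a + 1) * |(besselPoly a).eval v| * Real.exp (-(2 * Real.pi * v))
      ≤ Real.pi / √x ^ (2 * a + 1) * (C * Real.exp (Real.pi * v)) * Real.exp (-(2 * Real.pi * v)) := by
        gcongr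
    _ = Real.pi * C / √x ^ (2 * a + 1) * (Real.exp (Real.pi * v) * Real.exp (-(2 * Real.pi * v))) := by
        ring
    _ = _ := by rw [← Real.exp_add]; ring_nf

theorem integrable_exp_neg_mul_abs {c : ℝ} (hc : 0 < c) :
    Integrable (fun s : ℝ => Real.exp (-(c * |s|))) := by
  rw [← integrableOn_univ, ← Set.Iic_union_Ioi (a := (0 : ℝ)), integrableOn_union]
  constructor
  · refine (integrableOn_exp_mul_Iic hc 0).congr_fun (fun s hs => ?_) measurableSet_Iic
    simp only [abs_of_nonpos (show s ≤ 0 from hs)]; ring_nf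
  · refine (integrableOn_exp_mul_Ioi (neg_lt_zero.mpr hc) 0).congr_fun (fun s hs => ?_)
      measurableSet_Ioi
    simp only [abs_of_pos (show 0 < s from hs)]; ring_nf

section DerivUnderIntegral

variable {E : Type*} [NormedAddCommGroup E] [NormedSpace ℝ E]

theorem integrable_resolventKernel_smul (a : ℕ) {x : ℝ} (hx : 0 < x) {w : ℝ → E}
    (hw : Continuous w) {K : ℝ} (hK : ∀ s, ‖w s‖ ≤ K) :
    Integrable (fun s => resolventKernel a x s • w s) := by
  obtain ⟨C, hC, h⟩ := exists_abs_resolventKernel_le a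
  have hM : 0 < √x := Real.sqrt_pos.mpr hx
  have hi := (integrable_exp_neg_mul_abs (c := Real.pi * √x) (by positivity)).const_mul
    (C / √x ^ (2 * a + 1) * K)
  refine hi.mono' ((continuous_resolventKernel a x).smul hw).aestronglyMeasurable
    (Eventually.of_forall fun s => ?_)
  rw [norm_smul, Real.norm_eq_abs]
  calc |resolventKernel a x s| * ‖w s‖
      ≤ C / √x ^ (2 * a + 1) * Real.exp (-(Real.pi * (√x * |s|))) * K :=
        mul_le_mul (h x s hx) (hK s) (norm_nonneg _) (by positivity)
    _ = _ := by ring_nf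

theorem hasDerivAt_integral_resolventKernel_smul (a : ℕ) {x : ℝ} (hx : 0 < x) {w : ℝ → E}
    (hw : Continuous w) {K : ℝ} (hK : ∀ s, ‖w s‖ ≤ K) :
    HasDerivAt (fun x => ∫ s, resolventKernel a x s • w s)
      (-((a : ℝ) + 1) • ∫ s, resolventKernel (a + 1) x s • w s) x := by
  obtain ⟨C, hC, h⟩ := exists_abs_resolventKernel_le (a + 1)
  have hK0 : 0 ≤ K := (norm_nonneg _).trans (hK 0)
  have hx2 : 0 < √(x / 2) := Real.sqrt_pos.mpr (by positivity)
  have hi := (integrable_exp_neg_mul_abs (c := Real.pi * √(x / 2)) (by positivity)).const_mul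
    (((a : ℝ) + 1) * (C / √(x / 2) ^ (2 * (a + 1) + 1)) * K)
  -- On the neighbourhood z > x/2 the kernel bound decreases in z, so its value at x/2 dominates.
  have key := hasDerivAt_integral_of_dominated_loc_of_deriv_le (μ := volume) (𝕜 := ℝ)
    (F := fun x s => resolventKernel a x s • w s) (x₀ := x) (s := Set.Ioi (x / 2))
    (F' := fun x s => (-((a : ℝ) + 1) * resolventKernel (a + 1) x s) • w s)
    (bound := fun s => ((a : ℝ) + 1) * (C / √(x / 2) ^ (2 * (a + 1) + 1)) * K *
      Real.exp (-(Real.pi * √(x / 2) * |s|)))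
    (Ioi_mem_nhds (by linarith))
    (Eventually.of_forall fun x => ((continuous_resolventKernel a x).smul hw).aestronglyMeasurable)
    (integrable_resolventKernel_smul a hx hw hK)
    (((continuous_resolventKernel (a + 1) x).const_mul _).smul hw).aestronglyMeasurable
    (Eventually.of_forall fun s z hz => ?_) hi
    (Eventually.of_forall fun s z hz =>
      (hasDerivAt_resolventKernel a (lt_trans (by positivity) hz) s).smul_const (w s))
  · refine key.2.congr_deriv ?_
    simp_rw [mul_smul]
    rw [integral_smul]
  · have hz0 : 0 < z := lt_trans (by positivity : 0 < x / 2) hz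
    have hle : √(x / 2) ≤ √z := Real.sqrt_le_sqrt (le_of_lt hz)
    rw [norm_smul, Real.norm_eq_abs, abs_mul, abs_neg, abs_of_pos (by positivity : 0 < (a : ℝ) + 1)]
    have h1 : |resolventKernel (a + 1) z s| ≤ C / √(x / 2) ^ (2 * (a + 1) + 1) *
        Real.exp (-(Real.pi * (√(x / 2) * |s|))) := by
      refine (h z s hz0).trans ?_
      gcongr
    calc ((a : ℝ) + 1) * |resolventKernel (a + 1) z s| * ‖w s‖
        ≤ ((a : ℝ) + 1) * (C / √(x / 2) ^ (2 * (a + 1) + 1) *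
        Real.exp (-(Real.pi * (√(x / 2) * |s|)))) * K := by
          have := hK s
          gcongr
      _ = _ := by ring_nf

end DerivUnderIntegral

/-- A family with `∂ₓ G_a = -(a + 1) G_{a + 1}` that starts with zero vanishes. -/
theorem eq_zero_of_hasDerivAt_succ {E : Type*} [NormedAddCommGroup E] [NormedSpace ℝ E]
    {G : ℕ → ℝ → E}
    (hG : ∀ a x, 0 < x → HasDerivAt (G a) (-((a : ℝ) + 1) • G (a + 1) x) x)
    (h0 : ∀ x, 0 < x → G 0 x = 0) : ∀ a x, 0 < x → G a x = 0 := by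
  intro a
  induction a with
  | zero => exact h0
  | succ a ih =>
    intro x hx
    have h1 := hG a x hx
    have h2 : HasDerivAt (G a) 0 x :=
      (hasDerivAt_const x (0 : E)).congr_of_eventuallyEq
        (Filter.eventuallyEq_of_mem (Ioi_mem_nhds hx) fun z hz => ih z hz)
    have h3 := h1.unique h2
    have : (-((a : ℝ) + 1)) ≠ 0 := by
      have : (0 : ℝ) < (a : ℝ) + 1 := by positivity
      linarith
    exact (smul_eq_zero.mp h3).resolve_left this

theorem integral_exp_neg_mul_abs_mul_cexp {c : ℝ} (hc : 0 < c) (ξ : ℝ) :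
    ∫ s : ℝ, Real.exp (-(c * |s|)) • Complex.exp (-(2 * Real.pi * s * ξ : ℝ) * Complex.I)
      = ((2 * c / (c ^ 2 + (2 * Real.pi * ξ) ^ 2) : ℝ) : ℂ) := by
  have hint : Integrable (fun s : ℝ =>
      Real.exp (-(c * |s|)) • Complex.exp (-(2 * Real.pi * s * ξ : ℝ) * Complex.I)) := by
    refine (integrable_exp_neg_mul_abs hc).mono' (by fun_prop) (Eventually.of_forall fun s => ?_)
    have : ‖Complex.exp (-(2 * Real.pi * s * ξ : ℝ) * Complex.I)‖ = 1 := by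
      rw [← Complex.ofReal_neg, Complex.norm_exp_ofReal_mul_I]
    rw [norm_smul, this, Real.norm_eq_abs, abs_of_pos (Real.exp_pos _), mul_one]
  rw [← intervalIntegral.integral_Iic_add_Ioi (b := (0 : ℝ)) hint.integrableOn hint.integrableOn]
  have e1 : ∫ s in Set.Iic (0 : ℝ), Real.exp (-(c * |s|)) •
      Complex.exp (-(2 * Real.pi * s * ξ : ℝ) * Complex.I)
      = ∫ s in Set.Iic (0 : ℝ), Complex.exp ((c - 2 * Real.pi * ξ * Complex.I : ℂ) * s) := by
    refine setIntegral_congr_fun measurableSet_Iic fun s hs => ?_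
    simp only [abs_of_nonpos (show s ≤ 0 from hs), Complex.real_smul, Complex.ofReal_exp]
    rw [← Complex.exp_add]; push_cast; ring_nf
  have e2 : ∫ s in Set.Ioi (0 : ℝ), Real.exp (-(c * |s|)) •
      Complex.exp (-(2 * Real.pi * s * ξ : ℝ) * Complex.I)
      = ∫ s in Set.Ioi (0 : ℝ), Complex.exp ((-c - 2 * Real.pi * ξ * Complex.I : ℂ) * s) := by
    refine setIntegral_congr_fun measurableSet_Ioi fun s hs => ?_
    simp only [abs_of_pos (show 0 < s from hs), Complex.real_smul, Complex.ofReal_exp]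
    rw [← Complex.exp_add]; push_cast; ring_nf
  rw [e1, e2, integral_exp_mul_complex_Iic (by simpa using hc),
    integral_exp_mul_complex_Ioi (by simpa using hc)]
  simp only [Complex.ofReal_zero, mul_zero, Complex.exp_zero]
  have hd : (c : ℂ) ^ 2 + (2 * Real.pi * ξ) ^ 2 ≠ 0 := by
    norm_cast
    positivity
  have h1 : (c - 2 * Real.pi * ξ * Complex.I : ℂ) ≠ 0 := by
    intro h; have := congrArg Complex.re h; simp at this; exact hc.ne' this
  have h2 : (-c - 2 * Real.pi * ξ * Complex.I : ℂ) ≠ 0 := by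
    intro h; have := congrArg Complex.re h; simp at this; exact hc.ne' this
  push_cast
  generalize (2 * Real.pi * ξ : ℂ) = k at *
  rw [div_add_div _ _ h1 h2, div_eq_div_iff (mul_ne_zero h1 h2) hd]
  linear_combination (-2 * (c : ℂ) * k ^ 2) * Complex.I_sq

/-- The Fourier transform of `resolventKernel a x` is `ξ ↦ (x + ξ²) ^ (-(a + 1))`. -/
theorem integral_resolventKernel_smul_cexp (a : ℕ) {x : ℝ} (hx : 0 < x) (ξ : ℝ) :
    ∫ s : ℝ, resolventKernel a x s • Complex.exp (-(2 * Real.pi * s * ξ : ℝ) * Complex.I)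
      = (((x + ξ ^ 2)⁻¹ ^ (a + 1) : ℝ) : ℂ) := by
  have hw : Continuous fun s : ℝ => Complex.exp (-(2 * Real.pi * s * ξ : ℝ) * Complex.I) := by
    fun_prop
  have hK : ∀ s : ℝ, ‖Complex.exp (-(2 * Real.pi * s * ξ : ℝ) * Complex.I)‖ ≤ 1 := fun s => by
    rw [← Complex.ofReal_neg, Complex.norm_exp_ofReal_mul_I]
  -- Both sides obey ∂ₓ G_a = -(a + 1) G_{a+1}, hence so does their difference; only a = 0, the
  -- transform of exp(-c|s|), needs computing.
  have key := eq_zero_of_hasDerivAt_succ (G := fun a x =>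
    (∫ s : ℝ, resolventKernel a x s • Complex.exp (-(2 * Real.pi * s * ξ : ℝ) * Complex.I))
      - (((x + ξ ^ 2)⁻¹ ^ (a + 1) : ℝ) : ℂ)) ?_ ?_ a x hx
  · exact sub_eq_zero.mp key
  · intro a x hx
    have h1 := hasDerivAt_integral_resolventKernel_smul a hx hw hK
    have hp : x + ξ ^ 2 ≠ 0 := by positivity
    have h2 : HasDerivAt (fun x : ℝ => (x + ξ ^ 2)⁻¹ ^ (a + 1))
        (-((a : ℝ) + 1) * (x + ξ ^ 2)⁻¹ ^ (a + 2)) x := by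
      have h3 := (((hasDerivAt_id x).add_const (ξ ^ 2)).inv hp).pow (a + 1)
      refine h3.congr_deriv ?_
      simp only [Pi.inv_apply, id, Nat.add_sub_cancel]
      push_cast
      rw [pow_add _ a 2, inv_pow (x + ξ ^ 2) 2]
      ring
    refine (h1.sub h2.ofReal_comp).congr_deriv ?_
    simp only [Complex.real_smul]
    push_cast
    ring
  · intro x hx
    have hM : 0 < √x := Real.sqrt_pos.mpr hx
    have h1 : ∀ s : ℝ, resolventKernel 0 x s • Complex.exp (-(2 * Real.pi * s * ξ : ℝ) * Complex.I)
        = (Real.pi / √x) • (Real.exp (-(2 * Real.pi * √x * |s|)) •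
          Complex.exp (-(2 * Real.pi * s * ξ : ℝ) * Complex.I)) := by
      intro s
      rw [smul_smul]
      simp [resolventKernel, besselPoly, mul_assoc]
    simp only [h1]
    rw [integral_smul, integral_exp_neg_mul_abs_mul_cexp (by positivity), sub_eq_zero,
      Complex.real_smul, ← Complex.ofReal_mul]
    congr 1
    have hx' : x = √x ^ 2 := (Real.sq_sqrt hx.le).symm
    have hpi := Real.pi_pos
    rw [zero_add, pow_one]
    have h2 : x + ξ ^ 2 ≠ 0 := by positivity
    have h3 : (2 * Real.pi * √x) ^ 2 + (2 * Real.pi * ξ) ^ 2 = 4 * Real.pi ^ 2 * (x + ξ ^ 2) := by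
      rw [mul_pow, ← hx']; ring
    rw [h3]
    field_simp
    ring


/-! ### Towers: Taylor coefficients of g(x - t) at a moving base point x. -/

/-- Extension by zero to the negative integers. -/
def intExt (G : ℕ → ℝ) (a : ℤ) : ℝ := if 0 ≤ a then G a.toNat else 0

theorem intExt_natCast (G : ℕ → ℝ) (a : ℕ) : intExt G a = G a := by simp [intExt]

theorem intExt_of_neg (G : ℕ → ℝ) {a : ℤ} (ha : a < 0) : intExt G a = 0 := by
  simp [intExt, ha]

theorem intExt_zero (G : ℕ → ℝ) : intExt G 0 = G 0 := by simp [intExt]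

theorem intExt_one (G : ℕ → ℝ) : intExt G 1 = G 1 := by simp [intExt]

/-- Taylor coefficients at a variable base point: `∂ₓ G_a = -(a + 1) G_{a + 1}`. -/
def IsTower (G : ℤ → ℝ → ℝ) : Prop :=
  ∀ a x, 0 < x → HasDerivAt (G a) (-((a : ℝ) + 1) * G (a + 1) x) x

namespace IsTower

variable {G H : ℤ → ℝ → ℝ}

theorem add (hG : IsTower G) (hH : IsTower H) : IsTower fun a x => G a x + H a x :=
  fun a x hx => ((hG a x hx).add (hH a x hx)).congr_deriv (by ring)

theorem sub (hG : IsTower G) (hH : IsTower H) : IsTower fun a x => G a x - H a x :=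
  fun a x hx => ((hG a x hx).sub (hH a x hx)).congr_deriv (by ring)

theorem const_mul (r : ℝ) (hG : IsTower G) : IsTower fun a x => r * G a x :=
  fun a x hx => ((hG a x hx).const_mul r).congr_deriv (by ring)

theorem mul_const (r : ℝ) (hG : IsTower G) : IsTower fun a x => G a x * r :=
  fun a x hx => ((hG a x hx).mul_const r).congr_deriv (by ring)

theorem deriv (hG : IsTower G) : IsTower fun a x => ((a : ℝ) + 1) * G (a + 1) x :=
  fun a x hx => ((hG (a + 1) x hx).const_mul ((a : ℝ) + 1)).congr_deriv (by push_cast; ring)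

/-- If `G a x` is the coefficient of t^a in g(x - t), these are the coefficients of (x - t) g(x -
t), again a function of x - t. -/
theorem mul_var (hG : IsTower G) : IsTower fun a x => x * G a x - G (a - 1) x := by
  intro a x hx
  have h := ((hasDerivAt_id x).mul (hG a x hx)).sub (hG (a - 1) x hx)
  refine h.congr_deriv ?_
  simp only [id, sub_add_cancel, add_sub_cancel_right]
  push_cast
  ring

theorem congr (hG : IsTower G) (h : ∀ a x, H a x = G a x) : IsTower H := by
  have : H = G := funext fun a => funext fun x => h a x
  rwa [this]

/-- Extension by zero is harmless at a = -1 because the factor a + 1 vanishes there. -/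
theorem of_nat {G : ℕ → ℝ → ℝ}
    (hG : ∀ a x, 0 < x → HasDerivAt (G a) (-((a : ℝ) + 1) * G (a + 1) x) x) :
    IsTower fun a x => intExt (fun n => G n x) a := by
  intro a x hx
  rcases lt_or_ge a 0 with ha | ha
  · have h1 : (fun x => intExt (fun n => G n x) a) = fun _ => 0 :=
      funext fun x => intExt_of_neg _ ha
    beta_reduce
    rw [h1]
    refine (hasDerivAt_const x (0 : ℝ)).congr_deriv ?_
    rcases lt_or_eq_of_le (show a + 1 ≤ 0 by omega) with h | h
    · rw [intExt_of_neg _ h, mul_zero]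
    · have : (a : ℝ) + 1 = 0 := by exact_mod_cast h
      rw [this]; simp
  · lift a to ℕ using ha
    have h2 : ((a : ℤ) + 1) = ((a + 1 : ℕ) : ℤ) := by push_cast; ring
    simp only [h2, intExt_natCast]
    exact_mod_cast hG a x hx

theorem eq_zero (hG : IsTower G) (h0 : ∀ x, 0 < x → G 0 x = 0) (a : ℤ) (ha : 0 ≤ a) (x : ℝ)
    (hx : 0 < x) : G a x = 0 := by
  lift a to ℕ using ha
  refine eq_zero_of_hasDerivAt_succ (G := fun n : ℕ => G n) (fun a x hx => ?_) ?_ a x hx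
  · have := hG a x hx
    push_cast at this ⊢
    simpa using this
  · simpa using h0

end IsTower

/-! ### Linear relations between coefficient arrays -/

/-- The left side of `-μ · ∂ f + B(μ, x - t) □ f - source`, where `B` is the polarization of the
quadratic form of `quadOp`. -/
noncomputable def linRel (f p₁₂ p₁₃ p₂₃ : ℤ → ℤ → ℤ → ℝ) (μ₁ μ₂ μ₃ x₁ x₂ x₃ : ℝ)
    (a b c : ℤ) : ℝ :=
  -(μ₁ * ((a + 1) * f (a + 1) b c) + μ₂ * ((b + 1) * f a (b + 1) c)
      + μ₃ * ((c + 1) * f a b (c + 1)))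
    + (μ₂ + μ₃ - μ₁) * (x₁ * boxOp f a b c - boxOp f (a - 1) b c)
    + (μ₁ + μ₃ - μ₂) * (x₂ * boxOp f a b c - boxOp f a (b - 1) c)
    + (μ₁ + μ₂ - μ₃) * (x₃ * boxOp f a b c - boxOp f a b (c - 1))
    - Real.pi ^ 2 / 4 * ((μ₁ + μ₂ - μ₃) * p₁₂ a b c + (μ₁ + μ₃ - μ₂) * p₁₃ a b c
      + (μ₂ + μ₃ - μ₁) * p₂₃ a b c)

/-- Euler's relation for homogeneous functions of degree `-2`, on Taylor coefficients. -/
noncomputable def eulerRel (f : ℤ → ℤ → ℤ → ℝ) (x₁ x₂ x₃ : ℝ) (a b c : ℤ) : ℝ :=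
  x₁ * ((a + 1) * f (a + 1) b c) + x₂ * ((b + 1) * f a (b + 1) c)
    + x₃ * ((c + 1) * f a b (c + 1)) - (a + b + c + 2) * f a b c

theorem IsTower.boxOp {f : ℤ → ℤ → ℤ → ℝ → ℝ}
    (hf : ∀ b c, IsTower fun a x => f a b c x) (b c : ℤ) :
    IsTower fun a x => boxOp (fun a b c => f a b c x) a b c := by
  refine (((hf (b + 1) c).deriv.const_mul ((b : ℝ) + 1)).add
    (((hf b (c + 1)).deriv.const_mul ((c : ℝ) + 1)).add
      ((hf (b + 1) (c + 1)).const_mul (((b : ℝ) + 1) * (c + 1))))).congr fun a x => ?_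
  simp only [_root_.boxOp]
  ring

/-- The relation comes from its terms by differentiation, multiplication by x - t and constants, all
of which preserve towers. So it holds at every index in the first variable once it holds at index 0
for all x > 0. -/
theorem IsTower.linRel {f p₁₂ p₁₃ p₂₃ : ℤ → ℤ → ℤ → ℝ → ℝ}
    (hf : ∀ b c, IsTower fun a x => f a b c x) (h₁₂ : ∀ b c, IsTower fun a x => p₁₂ a b c x)
    (h₁₃ : ∀ b c, IsTower fun a x => p₁₃ a b c x) (h₂₃ : ∀ b c, IsTower fun a x => p₂₃ a b c x)
    (μ₁ μ₂ μ₃ x₂ x₃ : ℝ) (b c : ℤ) :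
    IsTower fun a x => linRel (fun a b c => f a b c x) (fun a b c => p₁₂ a b c x)
      (fun a b c => p₁₃ a b c x) (fun a b c => p₂₃ a b c x) μ₁ μ₂ μ₃ x x₂ x₃ a b c := by
  have hb := IsTower.boxOp hf
  refine ((((hf b c).deriv.const_mul (-μ₁)).add
    (((hf (b + 1) c).const_mul (-μ₂ * (b + 1))).add ((hf b (c + 1)).const_mul (-μ₃ * (c + 1))))).add
    (((hb b c).mul_var.const_mul (μ₂ + μ₃ - μ₁)).add
      ((((hb b c).const_mul x₂).sub (hb (b - 1) c)).const_mul (μ₁ + μ₃ - μ₂) |>.add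
        ((((hb b c).const_mul x₃).sub (hb b (c - 1))).const_mul (μ₁ + μ₂ - μ₃))))).sub
    ((((h₁₂ b c).const_mul (μ₁ + μ₂ - μ₃)).add (((h₁₃ b c).const_mul (μ₁ + μ₃ - μ₂)).add
      ((h₂₃ b c).const_mul (μ₂ + μ₃ - μ₁)))).const_mul (Real.pi ^ 2 / 4)) |>.congr fun a x => ?_
  simp only [_root_.linRel]
  ring

theorem IsTower.eulerRel {f : ℤ → ℤ → ℤ → ℝ → ℝ}
    (hf : ∀ b c, IsTower fun a x => f a b c x) (x₂ x₃ : ℝ) (b c : ℤ) :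
    IsTower fun a x => eulerRel (fun a b c => f a b c x) x x₂ x₃ a b c := by
  refine (((hf b c).deriv.mul_var).add (((hf (b + 1) c).const_mul (x₂ * (b + 1))).add
    ((hf b (c + 1)).const_mul (x₃ * (c + 1))))).sub ((hf b c).const_mul ((b : ℝ) + c + 2))
    |>.congr fun a x => ?_
  simp only [_root_.eulerRel, sub_add_cancel]
  push_cast
  ring

/-- Towers are set up in the first variable only; the swaps carry the tower argument to the other
two. -/
theorem linRel_swap₁₂ (f p₁₂ p₁₃ p₂₃ : ℤ → ℤ → ℤ → ℝ) (μ₁ μ₂ μ₃ x₁ x₂ x₃ : ℝ) (a b c : ℤ) :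
    linRel (fun a b c => f b a c) (fun a b c => p₁₂ b a c) (fun a b c => p₂₃ b a c)
      (fun a b c => p₁₃ b a c) μ₂ μ₁ μ₃ x₂ x₁ x₃ b a c
      = linRel f p₁₂ p₁₃ p₂₃ μ₁ μ₂ μ₃ x₁ x₂ x₃ a b c := by
  simp only [linRel, boxOp]; ring

theorem linRel_swap₁₃ (f p₁₂ p₁₃ p₂₃ : ℤ → ℤ → ℤ → ℝ) (μ₁ μ₂ μ₃ x₁ x₂ x₃ : ℝ) (a b c : ℤ) :
    linRel (fun a b c => f c b a) (fun a b c => p₂₃ c b a) (fun a b c => p₁₃ c b a)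
      (fun a b c => p₁₂ c b a) μ₃ μ₂ μ₁ x₃ x₂ x₁ c b a
      = linRel f p₁₂ p₁₃ p₂₃ μ₁ μ₂ μ₃ x₁ x₂ x₃ a b c := by
  simp only [linRel, boxOp]; ring

theorem eulerRel_swap₁₂ (f : ℤ → ℤ → ℤ → ℝ) (x₁ x₂ x₃ : ℝ) (a b c : ℤ) :
    eulerRel (fun a b c => f b a c) x₂ x₁ x₃ b a c = eulerRel f x₁ x₂ x₃ a b c := by
  simp only [eulerRel]; ring

theorem eulerRel_swap₁₃ (f : ℤ → ℤ → ℤ → ℝ) (x₁ x₂ x₃ : ℝ) (a b c : ℤ) :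
    eulerRel (fun a b c => f c b a) x₃ x₂ x₁ c b a = eulerRel f x₁ x₂ x₃ a b c := by
  simp only [eulerRel]; ring

/-- The source term of the relation satisfied by the array `f`. -/
noncomputable def sourceTerm (p₁₂ p₁₃ p₂₃ : ℤ → ℤ → ℤ → ℝ) (x₁ x₂ x₃ : ℝ) (a b c : ℤ) : ℝ :=
  -(Real.pi ^ 2 / 4) *
    ((p₁₂ (a - 1) b c + p₁₂ a (b - 1) c - p₁₂ a b (c - 1) + (x₁ + x₂ - x₃) * p₁₂ a b c)
    + (p₁₃ (a - 1) b c + p₁₃ a b (c - 1) - p₁₃ a (b - 1) c + (x₁ + x₃ - x₂) * p₁₃ a b c)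
    + (p₂₃ a (b - 1) c + p₂₃ a b (c - 1) - p₂₃ (a - 1) b c + (x₂ + x₃ - x₁) * p₂₃ a b c))

theorem linRel_eq_zero_of_neg {f p₁₂ p₁₃ p₂₃ : ℤ → ℤ → ℤ → ℝ} (hf : NonnegSupport f)
    (h₁₂ : NonnegSupport p₁₂) (h₁₃ : NonnegSupport p₁₃) (h₂₃ : NonnegSupport p₂₃)
    (μ₁ μ₂ μ₃ x₁ x₂ x₃ : ℝ) {a b c : ℤ} (h : a < 0 ∨ b < 0 ∨ c < 0) :
    linRel f p₁₂ p₁₃ p₂₃ μ₁ μ₂ μ₃ x₁ x₂ x₃ a b c = 0 := by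
  have z : ∀ (p : ℤ) (r : ℝ), (p + 1 < 0 → r = 0) → p < 0 → ((p : ℝ) + 1) * r = 0 := by
    intro p r hr hp
    rcases lt_or_eq_of_le (show p + 1 ≤ 0 by omega) with h | h
    · rw [hr h, mul_zero]
    · have : (p : ℝ) + 1 = 0 := by exact_mod_cast h
      rw [this, zero_mul]
  have e1 : ((a : ℝ) + 1) * f (a + 1) b c = 0 := by
    by_cases ha : a < 0
    · exact z a _ (fun h => hf _ _ _ (Or.inl h)) ha
    · rw [hf _ _ _ (by omega), mul_zero]
  have e2 : ((b : ℝ) + 1) * f a (b + 1) c = 0 := by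
    by_cases ha : b < 0
    · exact z b _ (fun h => hf _ _ _ (Or.inr (Or.inl h))) ha
    · rw [hf _ _ _ (by omega), mul_zero]
  have e3 : ((c : ℝ) + 1) * f a b (c + 1) = 0 := by
    by_cases ha : c < 0
    · exact z c _ (fun h => hf _ _ _ (Or.inr (Or.inr h))) ha
    · rw [hf _ _ _ (by omega), mul_zero]
  unfold linRel
  rw [e1, e2, e3, hf.boxOp a b c h, hf.boxOp (a - 1) b c (by omega),
    hf.boxOp a (b - 1) c (by omega), hf.boxOp a b (c - 1) (by omega), h₁₂ a b c h, h₁₃ a b c h,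
    h₂₃ a b c h]
  simp

/-- On the null cone of the quadratic form, the linear relations and Euler's relation combine to a
relation without denominators. -/
theorem add_quadOp_boxOp_eq_sourceTerm {f p₁₂ p₁₃ p₂₃ : ℤ → ℤ → ℤ → ℝ} {x₁ x₂ x₃ : ℝ}
    (hlin : ∀ μ₁ μ₂ μ₃ a b c, linRel f p₁₂ p₁₃ p₂₃ μ₁ μ₂ μ₃ x₁ x₂ x₃ a b c = 0)
    {a b c : ℤ} (heul : eulerRel f x₁ x₂ x₃ a b c = 0)
    (hx : 2 * (x₁ * x₂ + x₁ * x₃ + x₂ * x₃) - x₁ ^ 2 - x₂ ^ 2 - x₃ ^ 2 = 0) :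
    2 * ((a : ℝ) + b + c + 1) * f a b c + quadOp (boxOp f) a b c
      = sourceTerm p₁₂ p₁₃ p₂₃ x₁ x₂ x₃ a b c := by
  -- The shifted relations for the unit vectors add up to μ = t, and the fourth is μ = x. For μ = x
  -- + t the polarization gives B(x + t, x - t) = Q(x) - Q(t) = -Q(t), while μ·∂f equals (d + 2)f +
  -- d f by Euler's relation and by degree.
  have h1 := hlin 1 0 0 (a - 1) b c
  have h2 := hlin 0 1 0 a (b - 1) c
  have h3 := hlin 0 0 1 a b (c - 1)
  have h0 := hlin x₁ x₂ x₃ a b c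
  have e1 : ∀ p : ℤ, p - 1 - 1 = p - 2 := fun p => by ring
  simp only [linRel, eulerRel, sub_add_cancel, e1] at h1 h2 h3 h0 heul
  push_cast at h1 h2 h3
  simp only [quadOp, sourceTerm]
  linear_combination (-1 : ℝ) * h1 - h2 - h3 - h0 - heul + boxOp f a b c * hx


/-! ### Moments -/

theorem integrable_abs_pow_mul_exp (k : ℕ) {S : ℝ} (hS : 0 < S) :
    Integrable fun s : ℝ => |s| ^ k * Real.exp (-(S * |s|)) := by
  refine ((integrable_exp_neg_mul_abs (c := S / 2) (by positivity)).const_mul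
    (k.factorial * (2 / S) ^ k)).mono' (by fun_prop) (Eventually.of_forall fun s => ?_)
  have h := Real.pow_div_factorial_le_exp (S / 2 * |s|) (by positivity) k
  rw [div_le_iff₀ (by positivity), mul_pow] at h
  rw [Real.norm_eq_abs, abs_of_nonneg (by positivity)]
  have h1 : |s| ^ k ≤ k.factorial * (2 / S) ^ k * Real.exp (S / 2 * |s|) := by
    have h2 : |s| ^ k = (2 / S) ^ k * ((S / 2) ^ k * |s| ^ k) := by
      rw [← mul_assoc, ← mul_pow]; field_simp; simp
    rw [h2]
    calc (2 / S) ^ k * ((S / 2) ^ k * |s| ^ k)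
        ≤ (2 / S) ^ k * (Real.exp (S / 2 * |s|) * k.factorial) := by gcongr
      _ = _ := by ring
  calc |s| ^ k * Real.exp (-(S * |s|))
      ≤ k.factorial * (2 / S) ^ k * Real.exp (S / 2 * |s|) * Real.exp (-(S * |s|)) := by gcongr
    _ = k.factorial * (2 / S) ^ k * (Real.exp (S / 2 * |s|) * Real.exp (-(S * |s|))) := by ring
    _ = _ := by rw [← Real.exp_add]; ring_nf

theorem integral_abs_pow_mul_exp (k : ℕ) {S : ℝ} (hS : 0 < S) :
    ∫ s : ℝ, |s| ^ k * Real.exp (-(S * |s|)) = 2 * k.factorial / S ^ (k + 1) := by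
  rw [integral_comp_abs (f := fun t => t ^ k * Real.exp (-(S * t)))]
  have h := Real.integral_rpow_mul_exp_neg_mul_Ioi (a := (k : ℝ) + 1) (by positivity) hS
  simp only [add_sub_cancel_right, Real.rpow_natCast] at h
  rw [h, Real.Gamma_nat_eq_factorial]
  have : ((k : ℝ) + 1) = ((k + 1 : ℕ) : ℝ) := by push_cast; ring
  rw [this, Real.rpow_natCast, one_div, inv_pow]
  field_simp

theorem integral_quadratic_mul_abs_pow_mul_exp (k : ℕ) {S : ℝ} (hS : 0 < S) (A B C : ℝ) :
    ∫ s : ℝ, (A + B * |s| + C * |s| ^ 2) * (|s| ^ k * Real.exp (-(S * |s|)))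
      = 2 * k.factorial / S ^ (k + 1) * (A + B * (k + 1) / S + C * ((k + 1) * (k + 2)) / S ^ 2) := by
  have h : ∀ s : ℝ, (A + B * |s| + C * |s| ^ 2) * (|s| ^ k * Real.exp (-(S * |s|)))
      = A * (|s| ^ k * Real.exp (-(S * |s|))) + B * (|s| ^ (k + 1) * Real.exp (-(S * |s|)))
        + C * (|s| ^ (k + 2) * Real.exp (-(S * |s|))) := fun s => by ring
  simp only [h]
  have i0 := (integrable_abs_pow_mul_exp k hS).const_mul A
  have i1 := (integrable_abs_pow_mul_exp (k + 1) hS).const_mul B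
  have i2 := (integrable_abs_pow_mul_exp (k + 2) hS).const_mul C
  have e1 := integral_add (i0.add i1) i2
  simp only [Pi.add_apply] at e1
  rw [e1, integral_add i0 i1]
  simp only [integral_const_mul, integral_abs_pow_mul_exp _ hS]
  rw [Nat.factorial_succ (k + 1), Nat.factorial_succ k]
  push_cast
  field_simp
  ring

/-! ### Integrals of products of kernels -/

/-- `resolventKernel`, extended by zero to negative indices. -/
noncomputable def kernelZ (a : ℤ) (x s : ℝ) : ℝ := intExt (fun n => resolventKernel n x s) a

theorem kernelZ_of_neg {a : ℤ} (ha : a < 0) (x s : ℝ) : kernelZ a x s = 0 := intExt_of_neg _ ha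

theorem kernelZ_natCast (a : ℕ) (x s : ℝ) : kernelZ a x s = resolventKernel a x s :=
  intExt_natCast _ _

theorem continuous_kernelZ (a : ℤ) (x : ℝ) : Continuous (kernelZ a x) := by
  rcases lt_or_ge a 0 with ha | ha
  · have : kernelZ a x = fun _ => 0 := funext fun s => kernelZ_of_neg ha x s
    rw [this]; exact continuous_const
  · lift a to ℕ using ha
    have : kernelZ a x = resolventKernel a x := funext fun s => kernelZ_natCast a x s
    rw [this]; exact continuous_resolventKernel a x

theorem isTower_integral_kernelZ_mul {w : ℝ → ℝ} (hw : Continuous w) {K : ℝ}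
    (hK : ∀ s, |w s| ≤ K) : IsTower fun a x => ∫ s, kernelZ a x s * w s := by
  refine (IsTower.of_nat (G := fun a x => ∫ s, resolventKernel a x s * w s) fun a x hx => ?_).congr
    fun a x => ?_
  · simpa using hasDerivAt_integral_resolventKernel_smul a hx hw hK
  · rcases lt_or_ge a 0 with ha | ha
    · simp [kernelZ_of_neg ha, intExt_of_neg _ ha]
    · lift a to ℕ using ha
      simp [kernelZ_natCast, intExt_natCast]

/-- Weights `w` for which `kernelZ a x * w c` is always bounded. -/
def IsWeight (w : ℤ → ℝ → ℝ) : Prop :=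
  ∀ c, Continuous (w c) ∧ ∀ a x, 0 < x → ∃ K, ∀ s, |kernelZ a x s * w c s| ≤ K

theorem exists_abs_kernelZ_mul_pow_le (a : ℤ) {x : ℝ} (hx : 0 < x) (k : ℕ) :
    ∃ K, ∀ s, |kernelZ a x s * |s| ^ k| ≤ K := by
  rcases lt_or_ge a 0 with ha | ha
  · exact ⟨0, fun s => by simp [kernelZ_of_neg ha]⟩
  · lift a to ℕ using ha
    obtain ⟨C, hC, h⟩ := exists_abs_resolventKernel_le a
    have hM : 0 < √x := Real.sqrt_pos.mpr hx
    refine ⟨C / √x ^ (2 * a + 1) * (k.factorial * (1 / (Real.pi * √x)) ^ k), fun s => ?_⟩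
    rw [kernelZ_natCast, abs_mul, abs_of_nonneg (by positivity : 0 ≤ |s| ^ k)]
    have h1 := Real.pow_div_factorial_le_exp (Real.pi * √x * |s|) (by positivity) k
    rw [div_le_iff₀ (by positivity), mul_pow] at h1
    have hpi := Real.pi_pos
    have h2 : |s| ^ k = (1 / (Real.pi * √x)) ^ k * ((Real.pi * √x) ^ k * |s| ^ k) := by
      rw [← mul_assoc, ← mul_pow, one_div, inv_mul_cancel₀ (by positivity), one_pow, one_mul]
    calc |resolventKernel a x s| * |s| ^ k
        ≤ C / √x ^ (2 * a + 1) * Real.exp (-(Real.pi * (√x * |s|))) * |s| ^ k := by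
          gcongr; exact h x s hx
      _ ≤ C / √x ^ (2 * a + 1) * Real.exp (-(Real.pi * (√x * |s|))) *
          ((1 / (Real.pi * √x)) ^ k * (Real.exp (Real.pi * √x * |s|) * k.factorial)) := by
          rw [h2]; gcongr
      _ = C / √x ^ (2 * a + 1) * (k.factorial * (1 / (Real.pi * √x)) ^ k) *
          (Real.exp (-(Real.pi * (√x * |s|))) * Real.exp (Real.pi * √x * |s|)) := by ring
      _ = _ := by
          rw [← Real.exp_add]
          have : -(Real.pi * (√x * |s|)) + Real.pi * √x * |s| = 0 := by ring
          rw [this, Real.exp_zero, mul_one]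

theorem exists_abs_kernelZ_le (a : ℤ) {x : ℝ} (hx : 0 < x) : ∃ K, ∀ s, |kernelZ a x s| ≤ K := by
  simpa using exists_abs_kernelZ_mul_pow_le a hx 0

theorem isWeight_kernelZ {z : ℝ} (hz : 0 < z) : IsWeight fun c => kernelZ c z := by
  refine fun c => ⟨continuous_kernelZ c z, fun a x hx => ?_⟩
  obtain ⟨K, hK⟩ := exists_abs_kernelZ_le a hx
  obtain ⟨K', hK'⟩ := exists_abs_kernelZ_le c hz
  refine ⟨K * K', fun s => ?_⟩
  rw [abs_mul]
  exact mul_le_mul (hK s) (hK' s) (abs_nonneg _) ((abs_nonneg _).trans (hK s))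

/-- The finite part at `x = 0` of `resolventKernel`: the Fourier transform of the finite part of
`ξ ↦ ξ ^ (-2 (c + 1))`. -/
noncomputable def powerKernel (c : ℕ) (s : ℝ) : ℝ :=
  (-1) ^ (c + 1) * (2 * Real.pi) ^ (2 * c + 2) / (2 * (2 * c + 1).factorial) * |s| ^ (2 * c + 1)

/-- `powerKernel`, extended by zero to negative indices. -/
noncomputable def powerKernelZ (c : ℤ) (s : ℝ) : ℝ := intExt (fun n => powerKernel n s) c

theorem isWeight_powerKernelZ : IsWeight powerKernelZ := by
  intro c
  rcases lt_or_ge c 0 with hc | hc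
  · have : powerKernelZ c = fun _ => 0 := funext fun s => intExt_of_neg _ hc
    rw [this]
    exact ⟨continuous_const, fun a x _ => ⟨0, fun s => by simp⟩⟩
  · lift c to ℕ using hc
    have : powerKernelZ c = powerKernel c := funext fun s => intExt_natCast _ _
    rw [this]
    refine ⟨by unfold powerKernel; fun_prop, fun a x hx => ?_⟩
    obtain ⟨K, hK⟩ := exists_abs_kernelZ_mul_pow_le a hx (2 * c + 1)
    refine ⟨|(-1) ^ (c + 1) * (2 * Real.pi) ^ (2 * c + 2) / (2 * (2 * c + 1).factorial)| * K,
      fun s => ?_⟩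
    rw [powerKernel, mul_left_comm, abs_mul]
    exact mul_le_mul_of_nonneg_left (hK s) (abs_nonneg _)

/-- The integral of a product of two kernels against a weight. -/
noncomputable def kernelIntegral (w : ℤ → ℝ → ℝ) (a b c : ℤ) (x₁ x₂ : ℝ) : ℝ :=
  ∫ s, kernelZ a x₁ s * (kernelZ b x₂ s * w c s)

theorem kernelIntegral_swap (w : ℤ → ℝ → ℝ) (a b c : ℤ) (x₁ x₂ : ℝ) :
    kernelIntegral w b a c x₂ x₁ = kernelIntegral w a b c x₁ x₂ := by
  unfold kernelIntegral; congr 1; ext s; ring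

theorem isTower_kernelIntegral {w : ℤ → ℝ → ℝ} (hw : IsWeight w) {x₂ : ℝ} (hx₂ : 0 < x₂)
    (b c : ℤ) : IsTower fun a x => kernelIntegral w a b c x x₂ := by
  obtain ⟨hc, hb⟩ := hw c
  obtain ⟨K, hK⟩ := hb b x₂ hx₂
  exact isTower_integral_kernelZ_mul ((continuous_kernelZ b x₂).mul hc) hK

theorem nonnegSupport_kernelIntegral {w : ℤ → ℝ → ℝ} (hw : ∀ c s, c < 0 → w c s = 0)
    (x₁ x₂ : ℝ) : NonnegSupport fun a b c => kernelIntegral w a b c x₁ x₂ := by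
  intro a b c h
  unfold kernelIntegral
  rcases h with h | h | h
  · simp [kernelZ_of_neg h]
  · simp [kernelZ_of_neg h]
  · simp [hw c _ h]

/-! ### The coefficients of `(x - t) ^ (-3/2)` -/

/-- The Taylor coefficients of `(1 - t) ^ (-3/2)`. -/
def cubeCoeff : ℕ → ℚ
  | 0 => 1
  | a + 1 => cubeCoeff a * (2 * a + 3) / (2 * (a + 1))

/-- The Taylor coefficients of `(x - t) ^ (-3/2)`. -/
noncomputable def cubeZ (a : ℤ) (x : ℝ) : ℝ :=
  intExt (fun n => (cubeCoeff n : ℝ) / √x ^ (2 * n + 3)) a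

theorem cubeZ_of_neg {a : ℤ} (ha : a < 0) (x : ℝ) : cubeZ a x = 0 := intExt_of_neg _ ha

theorem isTower_cubeZ : IsTower cubeZ := by
  refine IsTower.of_nat (G := fun n x => (cubeCoeff n : ℝ) / √x ^ (2 * n + 3)) fun a x hx => ?_
  have hM : 0 < √x := Real.sqrt_pos.mpr hx
  have h := ((Real.hasDerivAt_sqrt hx.ne').pow (2 * a + 3)).inv (pow_ne_zero _ hM.ne')
  have h2 := h.const_mul (cubeCoeff a : ℝ)
  simp only [div_eq_mul_inv]
  refine h2.congr_deriv ?_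
  have e1 : √x ^ (2 * (a + 1) + 3) = √x ^ (2 * a) * √x ^ 5 := by ring
  have e2 : √x ^ (2 * a + 3) = √x ^ (2 * a) * √x ^ 3 := by ring
  have e3 : 2 * a + 3 - 1 = 2 * a + 2 := by omega
  have e4 : √x ^ (2 * a + 2) = √x ^ (2 * a) * √x ^ 2 := by ring
  simp only [Pi.pow_apply]
  rw [e1, e2, e3, e4, cubeCoeff]
  have hp : √x ^ (2 * a) ≠ 0 := by positivity
  have ha : (a : ℝ) + 1 ≠ 0 := by positivity
  push_cast
  field_simp

/-- The constant power series `1`. -/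
def deltaZ (a : ℤ) : ℝ := if a = 0 then 1 else 0

/-- Taylor coefficients of `((x - t₁) (y - t₂)) ^ (-3/2)`, as a power series in three variables. -/
noncomputable def pairZ (x y : ℝ) (a b c : ℤ) : ℝ := cubeZ a x * cubeZ b y * deltaZ c

theorem isTower_delta : IsTower fun a _ => deltaZ a := by
  intro a x _
  refine (hasDerivAt_const x (deltaZ a)).congr_deriv ?_
  by_cases h : a + 1 = 0
  · have : (a : ℝ) + 1 = 0 := by exact_mod_cast h
    rw [this]; simp
  · simp [deltaZ, h]


/-! ### Integrals of three kernels: closed forms and the relations they satisfy. -/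

theorem kernelZ_zero {M : ℝ} (hM : 0 < M) (s : ℝ) :
    kernelZ 0 (M ^ 2) s = Real.pi / M * Real.exp (-(2 * Real.pi * (M * |s|))) := by
  rw [kernelZ, intExt_zero]
  simp [resolventKernel, besselPoly, Real.sqrt_sq hM.le]

theorem kernelZ_one {M : ℝ} (hM : 0 < M) (s : ℝ) :
    kernelZ 1 (M ^ 2) s = Real.pi / (2 * M ^ 3) * (1 + 2 * Real.pi * M * |s|)
      * Real.exp (-(2 * Real.pi * (M * |s|))) := by
  rw [kernelZ, intExt_one]
  simp [resolventKernel, besselPoly, Real.sqrt_sq hM.le]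
  field_simp

theorem cubeZ_zero {M : ℝ} (hM : 0 < M) : cubeZ 0 (M ^ 2) = 1 / M ^ 3 := by
  rw [cubeZ, intExt_zero]
  simp [cubeCoeff, Real.sqrt_sq hM.le]

/-- The integral of a product of three kernels. -/
noncomputable def tripleIntegral (x₁ x₂ x₃ : ℝ) (a b c : ℤ) : ℝ :=
  kernelIntegral (fun c => kernelZ c x₃) a b c x₁ x₂

theorem tripleIntegral_swap₁₂ (x₁ x₂ x₃ : ℝ) (a b c : ℤ) :
    tripleIntegral x₂ x₁ x₃ b a c = tripleIntegral x₁ x₂ x₃ a b c :=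
  kernelIntegral_swap _ _ _ _ _ _

theorem tripleIntegral_swap₁₃ (x₁ x₂ x₃ : ℝ) (a b c : ℤ) :
    tripleIntegral x₃ x₂ x₁ c b a = tripleIntegral x₁ x₂ x₃ a b c := by
  unfold tripleIntegral kernelIntegral; congr 1; ext s; ring

/-- The base relations involve only indices 0 and 1, where a kernel is a linear polynomial in |s|
times an exponential; moments of order at most 2 therefore suffice. -/
theorem tripleIntegral_base {M₁ M₂ M₃ : ℝ} (h₁ : 0 < M₁) (h₂ : 0 < M₂) (h₃ : 0 < M₃)
    (a b : ℤ) (A₁ B₁ A₂ B₂ : ℝ)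
    (ha : ∀ s, kernelZ a (M₁ ^ 2) s = (A₁ + B₁ * |s|) * Real.exp (-(2 * Real.pi * (M₁ * |s|))))
    (hb : ∀ s, kernelZ b (M₂ ^ 2) s = (A₂ + B₂ * |s|) * Real.exp (-(2 * Real.pi * (M₂ * |s|)))) :
    tripleIntegral (M₁ ^ 2) (M₂ ^ 2) (M₃ ^ 2) a b 0 =
      (A₁ * A₂ + (A₁ * B₂ + A₂ * B₁) / (2 * Real.pi * (M₁ + M₂ + M₃))
        + 2 * (B₁ * B₂) / (2 * Real.pi * (M₁ + M₂ + M₃)) ^ 2) / (M₃ * (M₁ + M₂ + M₃)) := by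
  have hpi := Real.pi_pos
  have h := integral_quadratic_mul_abs_pow_mul_exp 0
    (S := 2 * Real.pi * (M₁ + M₂ + M₃)) (by positivity) (Real.pi / M₃ * (A₁ * A₂))
      (Real.pi / M₃ * (A₁ * B₂ + A₂ * B₁)) (Real.pi / M₃ * (B₁ * B₂))
  have e : tripleIntegral (M₁ ^ 2) (M₂ ^ 2) (M₃ ^ 2) a b 0 =
      ∫ s : ℝ, (Real.pi / M₃ * (A₁ * A₂) + Real.pi / M₃ * (A₁ * B₂ + A₂ * B₁) * |s|
        + Real.pi / M₃ * (B₁ * B₂) * |s| ^ 2) *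
        (|s| ^ 0 * Real.exp (-(2 * Real.pi * (M₁ + M₂ + M₃) * |s|))) := by
    unfold tripleIntegral kernelIntegral
    congr 1; ext s
    beta_reduce
    rw [ha, hb, kernelZ_zero h₃]
    have e1 : Real.exp (-(2 * Real.pi * (M₁ + M₂ + M₃) * |s|)) =
      Real.exp (-(2 * Real.pi * (M₁ * |s|))) * (Real.exp (-(2 * Real.pi * (M₂ * |s|))) *
        Real.exp (-(2 * Real.pi * (M₃ * |s|)))) := by
      rw [← Real.exp_add, ← Real.exp_add]; ring_nf
    rw [e1]; ring
  rw [e, h]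
  simp only [Nat.factorial_zero, Nat.cast_one, Nat.cast_zero]
  field_simp
  ring

/-- This is the function F of x_i = M_i² whose Taylor coefficients are all the other triple
integrals. -/
theorem tripleIntegral_zero_zero_zero {M₁ M₂ M₃ : ℝ} (h₁ : 0 < M₁) (h₂ : 0 < M₂) (h₃ : 0 < M₃) :
    tripleIntegral (M₁ ^ 2) (M₂ ^ 2) (M₃ ^ 2) 0 0 0 =
      Real.pi ^ 2 / (M₁ * M₂ * M₃ * (M₁ + M₂ + M₃)) := by
  rw [tripleIntegral_base h₁ h₂ h₃ 0 0 (Real.pi / M₁) 0 (Real.pi / M₂) 0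
    (fun s => by rw [kernelZ_zero h₁]; ring) (fun s => by rw [kernelZ_zero h₂]; ring)]
  field_simp
  ring

theorem tripleIntegral_one_zero_zero {M₁ M₂ M₃ : ℝ} (h₁ : 0 < M₁) (h₂ : 0 < M₂) (h₃ : 0 < M₃) :
    tripleIntegral (M₁ ^ 2) (M₂ ^ 2) (M₃ ^ 2) 1 0 0 =
      Real.pi ^ 2 / (2 * M₁ ^ 2 * (M₁ * M₂ * M₃ * (M₁ + M₂ + M₃))) *
        (1 + M₁ / (M₁ + M₂ + M₃)) := by
  have hpi := Real.pi_pos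
  rw [tripleIntegral_base h₁ h₂ h₃ 1 0 (Real.pi / (2 * M₁ ^ 3))
    (Real.pi / (2 * M₁ ^ 3) * (2 * Real.pi * M₁)) (Real.pi / M₂) 0
    (fun s => by rw [kernelZ_one h₁]; ring) (fun s => by rw [kernelZ_zero h₂]; ring)]
  field_simp
  ring

theorem tripleIntegral_one_one_zero {M₁ M₂ M₃ : ℝ} (h₁ : 0 < M₁) (h₂ : 0 < M₂) (h₃ : 0 < M₃) :
    tripleIntegral (M₁ ^ 2) (M₂ ^ 2) (M₃ ^ 2) 1 1 0 =
      Real.pi ^ 2 / (4 * M₁ ^ 2 * M₂ ^ 2 * (M₁ * M₂ * M₃ * (M₁ + M₂ + M₃))) *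
        (1 + (M₁ + M₂) / (M₁ + M₂ + M₃) + 2 * M₁ * M₂ / (M₁ + M₂ + M₃) ^ 2) := by
  have hpi := Real.pi_pos
  rw [tripleIntegral_base h₁ h₂ h₃ 1 1 (Real.pi / (2 * M₁ ^ 3))
    (Real.pi / (2 * M₁ ^ 3) * (2 * Real.pi * M₁)) (Real.pi / (2 * M₂ ^ 3))
    (Real.pi / (2 * M₂ ^ 3) * (2 * Real.pi * M₂))
    (fun s => by rw [kernelZ_one h₁]; ring) (fun s => by rw [kernelZ_one h₂]; ring)]
  field_simp
  ring

theorem nonnegSupport_tripleIntegral (x₁ x₂ x₃ : ℝ) :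
    NonnegSupport (tripleIntegral x₁ x₂ x₃) :=
  nonnegSupport_kernelIntegral (w := fun c => kernelZ c x₃) (fun _ _ hc => kernelZ_of_neg hc _ _)
    x₁ x₂

theorem nonnegSupport_pairZ (x y : ℝ) : NonnegSupport (pairZ x y) := by
  intro a b c h
  unfold pairZ
  rcases h with h | h | h
  · rw [cubeZ_of_neg h]; simp
  · rw [cubeZ_of_neg h]; simp
  · have : c ≠ 0 := by omega
    simp [deltaZ, this]

theorem boxOp_tripleIntegral_base {M₁ M₂ M₃ : ℝ} (h₁ : 0 < M₁) (h₂ : 0 < M₂) (h₃ : 0 < M₃) :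
    boxOp (tripleIntegral (M₁ ^ 2) (M₂ ^ 2) (M₃ ^ 2)) 0 0 0 =
      Real.pi ^ 2 * ((M₁ + M₂ + M₃) ^ 3 - (M₁ + M₂ + M₃) * (M₁ * M₂ + M₁ * M₃ + M₂ * M₃)
        - M₁ * M₂ * M₃) / (4 * (M₁ * M₂ * M₃) ^ 3 * (M₁ + M₂ + M₃) ^ 2) := by
  have f101 : tripleIntegral (M₁ ^ 2) (M₂ ^ 2) (M₃ ^ 2) 1 0 1 =
      tripleIntegral (M₁ ^ 2) (M₃ ^ 2) (M₂ ^ 2) 1 1 0 := by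
    rw [← tripleIntegral_swap₁₂, ← tripleIntegral_swap₁₃, ← tripleIntegral_swap₁₂]
  have f011 : tripleIntegral (M₁ ^ 2) (M₂ ^ 2) (M₃ ^ 2) 0 1 1 =
      tripleIntegral (M₃ ^ 2) (M₂ ^ 2) (M₁ ^ 2) 1 1 0 := by
    rw [← tripleIntegral_swap₁₃]
  simp only [boxOp, zero_add, f101, f011, tripleIntegral_one_one_zero h₁ h₂ h₃,
    tripleIntegral_one_one_zero h₁ h₃ h₂, tripleIntegral_one_one_zero h₃ h₂ h₁]
  push_cast
  field_simp
  ring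

/-- The differential equation of F itself, a rational identity in M₁, M₂, M₃; every other index
follows by differentiation. -/
theorem linRel_tripleIntegral_base {M₁ M₂ M₃ : ℝ} (h₁ : 0 < M₁) (h₂ : 0 < M₂) (h₃ : 0 < M₃)
    (μ₁ μ₂ μ₃ : ℝ) :
    linRel (tripleIntegral (M₁ ^ 2) (M₂ ^ 2) (M₃ ^ 2)) (pairZ (M₁ ^ 2) (M₂ ^ 2))
      (fun a b c => pairZ (M₁ ^ 2) (M₃ ^ 2) a c b) (fun a b c => pairZ (M₂ ^ 2) (M₃ ^ 2) b c a)
      μ₁ μ₂ μ₃ (M₁ ^ 2) (M₂ ^ 2) (M₃ ^ 2) 0 0 0 = 0 := by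
  have f010 : tripleIntegral (M₁ ^ 2) (M₂ ^ 2) (M₃ ^ 2) 0 1 0 =
      tripleIntegral (M₂ ^ 2) (M₁ ^ 2) (M₃ ^ 2) 1 0 0 := by
    rw [← tripleIntegral_swap₁₂]
  have f001 : tripleIntegral (M₁ ^ 2) (M₂ ^ 2) (M₃ ^ 2) 0 0 1 =
      tripleIntegral (M₃ ^ 2) (M₂ ^ 2) (M₁ ^ 2) 1 0 0 := by
    rw [← tripleIntegral_swap₁₃]
  have hb := (nonnegSupport_tripleIntegral (M₁ ^ 2) (M₂ ^ 2) (M₃ ^ 2)).boxOp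
  have hd : deltaZ 0 = 1 := by simp [deltaZ]
  simp only [linRel, zero_add, f010, f001, tripleIntegral_one_zero_zero h₁ h₂ h₃,
    tripleIntegral_one_zero_zero h₂ h₁ h₃, tripleIntegral_one_zero_zero h₃ h₂ h₁,
    boxOp_tripleIntegral_base h₁ h₂ h₃, zero_sub, hb (-1) 0 0 (by simp), hb 0 (-1) 0 (by simp),
    hb 0 0 (-1) (by simp), pairZ, cubeZ_zero h₁, cubeZ_zero h₂, cubeZ_zero h₃, hd]
  push_cast
  have hS : M₁ + M₂ + M₃ ≠ 0 := by positivity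
  have e2 : M₂ + M₁ + M₃ = M₁ + M₂ + M₃ := by ring
  have e3 : M₃ + M₂ + M₁ = M₁ + M₂ + M₃ := by ring
  rw [e2, e3]
  field_simp
  ring

theorem eulerRel_tripleIntegral_base {M₁ M₂ M₃ : ℝ} (h₁ : 0 < M₁) (h₂ : 0 < M₂) (h₃ : 0 < M₃) :
    eulerRel (tripleIntegral (M₁ ^ 2) (M₂ ^ 2) (M₃ ^ 2)) (M₁ ^ 2) (M₂ ^ 2) (M₃ ^ 2) 0 0 0 = 0 := by
  have f010 : tripleIntegral (M₁ ^ 2) (M₂ ^ 2) (M₃ ^ 2) 0 1 0 =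
      tripleIntegral (M₂ ^ 2) (M₁ ^ 2) (M₃ ^ 2) 1 0 0 := by
    rw [← tripleIntegral_swap₁₂]
  have f001 : tripleIntegral (M₁ ^ 2) (M₂ ^ 2) (M₃ ^ 2) 0 0 1 =
      tripleIntegral (M₃ ^ 2) (M₂ ^ 2) (M₁ ^ 2) 1 0 0 := by
    rw [← tripleIntegral_swap₁₃]
  simp only [eulerRel, zero_add, f010, f001, tripleIntegral_one_zero_zero h₁ h₂ h₃,
    tripleIntegral_one_zero_zero h₂ h₁ h₃, tripleIntegral_one_zero_zero h₃ h₂ h₁,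
    tripleIntegral_zero_zero_zero h₁ h₂ h₃]
  push_cast
  have hS : M₁ + M₂ + M₃ ≠ 0 := by positivity
  have e2 : M₂ + M₁ + M₃ = M₁ + M₂ + M₃ := by ring
  have e3 : M₃ + M₂ + M₁ = M₁ + M₂ + M₃ := by ring
  rw [e2, e3]
  field_simp
  ring

/-- `linRel` for the array of triple integrals. -/
noncomputable def tripleRel (μ₁ μ₂ μ₃ x₁ x₂ x₃ : ℝ) (a b c : ℤ) : ℝ :=
  linRel (tripleIntegral x₁ x₂ x₃) (pairZ x₁ x₂) (fun a b c => pairZ x₁ x₃ a c b)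
    (fun a b c => pairZ x₂ x₃ b c a) μ₁ μ₂ μ₃ x₁ x₂ x₃ a b c

theorem pairZ_swap (x y : ℝ) (a b c : ℤ) : pairZ y x b a c = pairZ x y a b c := by
  unfold pairZ; ring

theorem tripleRel_swap₁₂ (μ₁ μ₂ μ₃ x₁ x₂ x₃ : ℝ) (a b c : ℤ) :
    tripleRel μ₂ μ₁ μ₃ x₂ x₁ x₃ b a c = tripleRel μ₁ μ₂ μ₃ x₁ x₂ x₃ a b c := by
  unfold tripleRel
  rw [← linRel_swap₁₂]
  congr 1 <;> funext a b c
  · exact (tripleIntegral_swap₁₂ _ _ _ _ _ _).symm ▸ rfl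
  · exact pairZ_swap _ _ _ _ _

theorem tripleRel_swap₁₃ (μ₁ μ₂ μ₃ x₁ x₂ x₃ : ℝ) (a b c : ℤ) :
    tripleRel μ₃ μ₂ μ₁ x₃ x₂ x₁ c b a = tripleRel μ₁ μ₂ μ₃ x₁ x₂ x₃ a b c := by
  unfold tripleRel
  rw [← linRel_swap₁₃]
  congr 1 <;> funext a b c
  · exact tripleIntegral_swap₁₃ _ _ _ _ _ _
  · exact pairZ_swap _ _ _ _ _
  · exact pairZ_swap _ _ _ _ _
  · exact pairZ_swap _ _ _ _ _

theorem isTower_tripleIntegral {x₂ x₃ : ℝ} (h₂ : 0 < x₂) (h₃ : 0 < x₃) (b c : ℤ) :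
    IsTower fun a x => tripleIntegral x x₂ x₃ a b c :=
  isTower_kernelIntegral (isWeight_kernelZ h₃) h₂ b c

theorem isTower_tripleRel (μ₁ μ₂ μ₃ : ℝ) {x₂ x₃ : ℝ} (h₂ : 0 < x₂) (h₃ : 0 < x₃) (b c : ℤ) :
    IsTower fun a x => tripleRel μ₁ μ₂ μ₃ x x₂ x₃ a b c := by
  refine IsTower.linRel (f := fun a b c x => tripleIntegral x x₂ x₃ a b c)
    (p₁₂ := fun a b c x => pairZ x x₂ a b c) (p₁₃ := fun a b c x => pairZ x x₃ a c b)
    (p₂₃ := fun a b c x => pairZ x₂ x₃ b c a)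
    (isTower_tripleIntegral h₂ h₃) ?_ ?_ ?_ μ₁ μ₂ μ₃ x₂ x₃ b c
  · exact fun b c => (isTower_cubeZ.mul_const _).mul_const _
  · exact fun b c => (isTower_cubeZ.mul_const _).mul_const _
  · exact fun b c => isTower_delta.const_mul _

/-- Starting from index (0, 0, 0) at all positive base points, the tower argument raises one index
at a time: (a, 0, 0), then (a, b, 0), then (a, b, c). -/
theorem tripleRel_eq_zero (μ₁ μ₂ μ₃ : ℝ) {x₁ x₂ x₃ : ℝ} (h₁ : 0 < x₁) (h₂ : 0 < x₂)
    (h₃ : 0 < x₃) (a b c : ℤ) : tripleRel μ₁ μ₂ μ₃ x₁ x₂ x₃ a b c = 0 := by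
  by_cases hneg : a < 0 ∨ b < 0 ∨ c < 0
  · refine linRel_eq_zero_of_neg (nonnegSupport_tripleIntegral _ _ _) (nonnegSupport_pairZ _ _)
      (fun a b c h => nonnegSupport_pairZ _ _ _ _ _ (by tauto))
      (fun a b c h => nonnegSupport_pairZ _ _ _ _ _ (by tauto)) _ _ _ _ _ _ hneg
  push Not at hneg
  obtain ⟨ha, hb, hc⟩ := hneg
  have s0 : ∀ μ₁ μ₂ μ₃ x₁ x₂ x₃ : ℝ, 0 < x₁ → 0 < x₂ → 0 < x₃ →
      tripleRel μ₁ μ₂ μ₃ x₁ x₂ x₃ 0 0 0 = 0 := by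
    intro μ₁ μ₂ μ₃ x₁ x₂ x₃ h₁ h₂ h₃
    have h := linRel_tripleIntegral_base (Real.sqrt_pos.mpr h₁) (Real.sqrt_pos.mpr h₂)
      (Real.sqrt_pos.mpr h₃) μ₁ μ₂ μ₃
    rwa [Real.sq_sqrt h₁.le, Real.sq_sqrt h₂.le, Real.sq_sqrt h₃.le] at h
  have s1 : ∀ μ₁ μ₂ μ₃ x₁ x₂ x₃ : ℝ, 0 < x₁ → 0 < x₂ → 0 < x₃ →
      tripleRel μ₁ μ₂ μ₃ x₁ x₂ x₃ a 0 0 = 0 := by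
    intro μ₁ μ₂ μ₃ x₁ x₂ x₃ h₁ h₂ h₃
    exact (isTower_tripleRel μ₁ μ₂ μ₃ h₂ h₃ 0 0).eq_zero
      (fun x hx => s0 μ₁ μ₂ μ₃ x x₂ x₃ hx h₂ h₃) a ha x₁ h₁
  have s2 : ∀ μ₁ μ₂ μ₃ x₁ x₂ x₃ : ℝ, 0 < x₁ → 0 < x₂ → 0 < x₃ →
      tripleRel μ₁ μ₂ μ₃ x₁ x₂ x₃ a b 0 = 0 := by
    intro μ₁ μ₂ μ₃ x₁ x₂ x₃ h₁ h₂ h₃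
    rw [← tripleRel_swap₁₂]
    refine (isTower_tripleRel μ₂ μ₁ μ₃ h₁ h₃ a 0).eq_zero (fun x hx => ?_) b hb x₂ h₂
    rw [tripleRel_swap₁₂]
    exact s1 _ _ _ _ _ _ h₁ hx h₃
  rw [← tripleRel_swap₁₃]
  refine (isTower_tripleRel μ₃ μ₂ μ₁ h₂ h₁ b a).eq_zero (fun x hx => ?_) c hc x₃ h₃
  rw [tripleRel_swap₁₃]
  exact s2 _ _ _ _ _ _ h₁ h₂ hx

theorem eulerRel_tripleIntegral {x₁ x₂ x₃ : ℝ} (h₁ : 0 < x₁) (h₂ : 0 < x₂) (h₃ : 0 < x₃)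
    {a b c : ℤ} (ha : 0 ≤ a) (hb : 0 ≤ b) (hc : 0 ≤ c) :
    eulerRel (tripleIntegral x₁ x₂ x₃) x₁ x₂ x₃ a b c = 0 := by
  have w12 : ∀ (x₁ x₂ x₃ : ℝ) (a b c : ℤ), eulerRel (tripleIntegral x₂ x₁ x₃) x₂ x₁ x₃ b a c =
      eulerRel (tripleIntegral x₁ x₂ x₃) x₁ x₂ x₃ a b c := by
    intro x₁ x₂ x₃ a b c
    rw [← eulerRel_swap₁₂]
    congr 1; funext a b c; exact (tripleIntegral_swap₁₂ _ _ _ _ _ _)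
  have w13 : ∀ (x₁ x₂ x₃ : ℝ) (a b c : ℤ), eulerRel (tripleIntegral x₃ x₂ x₁) x₃ x₂ x₁ c b a =
      eulerRel (tripleIntegral x₁ x₂ x₃) x₁ x₂ x₃ a b c := by
    intro x₁ x₂ x₃ a b c
    rw [← eulerRel_swap₁₃]
    congr 1; funext a b c; exact (tripleIntegral_swap₁₃ _ _ _ _ _ _)
  have tow : ∀ {x₂ x₃ : ℝ}, 0 < x₂ → 0 < x₃ → ∀ b c : ℤ,
      IsTower fun a x => eulerRel (tripleIntegral x x₂ x₃) x x₂ x₃ a b c := by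
    intro x₂ x₃ h₂ h₃ b c
    exact IsTower.eulerRel (f := fun a b c x => tripleIntegral x x₂ x₃ a b c)
      (isTower_tripleIntegral h₂ h₃) x₂ x₃ b c
  have s0 : ∀ x₁ x₂ x₃ : ℝ, 0 < x₁ → 0 < x₂ → 0 < x₃ →
      eulerRel (tripleIntegral x₁ x₂ x₃) x₁ x₂ x₃ 0 0 0 = 0 := by
    intro x₁ x₂ x₃ h₁ h₂ h₃
    have h := eulerRel_tripleIntegral_base (Real.sqrt_pos.mpr h₁) (Real.sqrt_pos.mpr h₂)
      (Real.sqrt_pos.mpr h₃)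
    rwa [Real.sq_sqrt h₁.le, Real.sq_sqrt h₂.le, Real.sq_sqrt h₃.le] at h
  have s1 : ∀ x₁ x₂ x₃ : ℝ, 0 < x₁ → 0 < x₂ → 0 < x₃ →
      eulerRel (tripleIntegral x₁ x₂ x₃) x₁ x₂ x₃ a 0 0 = 0 := by
    intro x₁ x₂ x₃ h₁ h₂ h₃
    exact (tow h₂ h₃ 0 0).eq_zero (fun x hx => s0 x x₂ x₃ hx h₂ h₃) a ha x₁ h₁
  have s2 : ∀ x₁ x₂ x₃ : ℝ, 0 < x₁ → 0 < x₂ → 0 < x₃ →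
      eulerRel (tripleIntegral x₁ x₂ x₃) x₁ x₂ x₃ a b 0 = 0 := by
    intro x₁ x₂ x₃ h₁ h₂ h₃
    rw [← w12]
    refine (tow h₁ h₃ a 0).eq_zero (fun x hx => ?_) b hb x₂ h₂
    rw [w12]
    exact s1 _ _ _ h₁ hx h₃
  rw [← w13]
  refine (tow h₂ h₁ b a).eq_zero (fun x hx => ?_) c hc x₃ h₃
  rw [w13]
  exact s2 _ _ _ h₁ h₂ hx


/-! ### Degenerate integrals, with the third base point at 0. -/

/-- The integral of a product of two kernels and of a finite part kernel. -/
noncomputable def degenerateIntegral (x₁ x₂ : ℝ) (a b c : ℤ) : ℝ :=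
  kernelIntegral powerKernelZ a b c x₁ x₂

theorem degenerateIntegral_swap (x₁ x₂ : ℝ) (a b c : ℤ) :
    degenerateIntegral x₂ x₁ b a c = degenerateIntegral x₁ x₂ a b c :=
  kernelIntegral_swap _ _ _ _ _ _

theorem nonnegSupport_degenerateIntegral (x₁ x₂ : ℝ) :
    NonnegSupport (degenerateIntegral x₁ x₂) :=
  nonnegSupport_kernelIntegral (w := powerKernelZ) (fun _ _ hc => intExt_of_neg _ hc) x₁ x₂

theorem isTower_degenerateIntegral {x₂ : ℝ} (h₂ : 0 < x₂) (b c : ℤ) :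
    IsTower fun a x => degenerateIntegral x x₂ a b c :=
  isTower_kernelIntegral isWeight_powerKernelZ h₂ b c

theorem degenerateIntegral_base {M₁ M₂ : ℝ} (h₁ : 0 < M₁) (h₂ : 0 < M₂)
    (a b : ℤ) (c : ℕ) (A₁ B₁ A₂ B₂ : ℝ)
    (ha : ∀ s, kernelZ a (M₁ ^ 2) s = (A₁ + B₁ * |s|) * Real.exp (-(2 * Real.pi * (M₁ * |s|))))
    (hb : ∀ s, kernelZ b (M₂ ^ 2) s = (A₂ + B₂ * |s|) * Real.exp (-(2 * Real.pi * (M₂ * |s|)))) :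
    degenerateIntegral (M₁ ^ 2) (M₂ ^ 2) a b c =
      (-1) ^ (c + 1) / (M₁ + M₂) ^ (2 * c + 2) *
        (A₁ * A₂ + (A₁ * B₂ + A₂ * B₁) * (2 * c + 2) / (2 * Real.pi * (M₁ + M₂))
        + B₁ * B₂ * ((2 * c + 2) * (2 * c + 3)) / (2 * Real.pi * (M₁ + M₂)) ^ 2) := by
  have hpi := Real.pi_pos
  have h := integral_quadratic_mul_abs_pow_mul_exp (2 * c + 1)
    (S := 2 * Real.pi * (M₁ + M₂)) (by positivity) (A₁ * A₂) (A₁ * B₂ + A₂ * B₁) (B₁ * B₂)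
  set κ : ℝ := (-1) ^ (c + 1) * (2 * Real.pi) ^ (2 * c + 2) / (2 * (2 * c + 1).factorial) with hκ
  have e : degenerateIntegral (M₁ ^ 2) (M₂ ^ 2) a b c =
      κ * ∫ s : ℝ, (A₁ * A₂ + (A₁ * B₂ + A₂ * B₁) * |s| + B₁ * B₂ * |s| ^ 2) *
        (|s| ^ (2 * c + 1) * Real.exp (-(2 * Real.pi * (M₁ + M₂) * |s|))) := by
    unfold degenerateIntegral kernelIntegral
    rw [← integral_const_mul]
    congr 1; ext s
    rw [ha, hb, powerKernelZ, intExt_natCast, powerKernel, ← hκ]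
    have e1 : Real.exp (-(2 * Real.pi * (M₁ + M₂) * |s|)) =
      Real.exp (-(2 * Real.pi * (M₁ * |s|))) * Real.exp (-(2 * Real.pi * (M₂ * |s|))) := by
      rw [← Real.exp_add]; ring_nf
    rw [e1]; ring
  rw [e, h, ← mul_assoc]
  -- The normalization of `powerKernel` cancels the factorial and the powers of 2π of the moment.
  have e2 : κ * (2 * ((2 * c + 1).factorial : ℝ) / (2 * Real.pi * (M₁ + M₂)) ^ (2 * c + 1 + 1)) =
      (-1) ^ (c + 1) / (M₁ + M₂) ^ (2 * c + 2) := by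
    rw [hκ, mul_pow (2 * Real.pi) (M₁ + M₂), show 2 * c + 1 + 1 = 2 * c + 2 from rfl]
    field_simp
  rw [e2]
  push_cast
  ring

/-- Summed against t^c these give -π²/(M₁M₂((M₁+M₂)² + t)), which is the part of F even in M₃, taken
at M₃² = -t. -/
theorem degenerateIntegral_zero_zero {M₁ M₂ : ℝ} (h₁ : 0 < M₁) (h₂ : 0 < M₂) (c : ℕ) :
    degenerateIntegral (M₁ ^ 2) (M₂ ^ 2) 0 0 c =
      (-1) ^ (c + 1) / (M₁ + M₂) ^ (2 * c + 2) * (Real.pi ^ 2 / (M₁ * M₂)) := by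
  rw [degenerateIntegral_base h₁ h₂ 0 0 c (Real.pi / M₁) 0 (Real.pi / M₂) 0
    (fun s => by rw [kernelZ_zero h₁]; ring) (fun s => by rw [kernelZ_zero h₂]; ring)]
  ring

theorem degenerateIntegral_one_zero {M₁ M₂ : ℝ} (h₁ : 0 < M₁) (h₂ : 0 < M₂) (c : ℕ) :
    degenerateIntegral (M₁ ^ 2) (M₂ ^ 2) 1 0 c =
      (-1) ^ (c + 1) / (M₁ + M₂) ^ (2 * c + 2) * (Real.pi ^ 2 / (2 * M₁ ^ 3 * M₂) *
        (1 + M₁ * (2 * c + 2) / (M₁ + M₂))) := by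
  have hpi := Real.pi_pos
  rw [degenerateIntegral_base h₁ h₂ 1 0 c (Real.pi / (2 * M₁ ^ 3))
    (Real.pi / (2 * M₁ ^ 3) * (2 * Real.pi * M₁)) (Real.pi / M₂) 0
    (fun s => by rw [kernelZ_one h₁]; ring) (fun s => by rw [kernelZ_zero h₂]; ring)]
  congr 1
  field_simp
  ring

theorem degenerateIntegral_one_one {M₁ M₂ : ℝ} (h₁ : 0 < M₁) (h₂ : 0 < M₂) (c : ℕ) :
    degenerateIntegral (M₁ ^ 2) (M₂ ^ 2) 1 1 c =
      (-1) ^ (c + 1) / (M₁ + M₂) ^ (2 * c + 2) * (Real.pi ^ 2 / (4 * M₁ ^ 3 * M₂ ^ 3) *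
        (2 * c + 3 + M₁ * M₂ * ((2 * c + 2) * (2 * c + 3)) / (M₁ + M₂) ^ 2)) := by
  have hpi := Real.pi_pos
  rw [degenerateIntegral_base h₁ h₂ 1 1 c (Real.pi / (2 * M₁ ^ 3))
    (Real.pi / (2 * M₁ ^ 3) * (2 * Real.pi * M₁)) (Real.pi / (2 * M₂ ^ 3))
    (Real.pi / (2 * M₂ ^ 3) * (2 * Real.pi * M₂))
    (fun s => by rw [kernelZ_one h₁]; ring) (fun s => by rw [kernelZ_one h₂]; ring)]
  congr 1
  field_simp
  ring

theorem boxOp_degenerateIntegral_base {M₁ M₂ : ℝ} (h₁ : 0 < M₁) (h₂ : 0 < M₂) (c : ℕ) :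
    boxOp (degenerateIntegral (M₁ ^ 2) (M₂ ^ 2)) 0 0 c =
      (-1) ^ (c + 1) / (M₁ + M₂) ^ (2 * c + 2) * (Real.pi ^ 2 / (4 * M₁ ^ 3 * M₂ ^ 3) *
        (2 * c + 3 + M₁ * M₂ * ((2 * c + 2) * (2 * c + 3)) / (M₁ + M₂) ^ 2
          - 2 * (c + 1) / (M₁ + M₂) ^ 2 * (M₁ ^ 2 + M₂ ^ 2
            + M₁ * M₂ * (2 * c + 4)))) := by
  have f01 : degenerateIntegral (M₁ ^ 2) (M₂ ^ 2) 0 1 ((c + 1 : ℕ) : ℤ) =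
      degenerateIntegral (M₂ ^ 2) (M₁ ^ 2) 1 0 ((c + 1 : ℕ) : ℤ) := by
    rw [← degenerateIntegral_swap]
  have ec : ((c : ℤ) + 1) = ((c + 1 : ℕ) : ℤ) := by push_cast; rfl
  simp only [boxOp, zero_add, ec, f01, degenerateIntegral_one_one h₁ h₂,
    degenerateIntegral_one_zero h₁ h₂, degenerateIntegral_one_zero h₂ h₁]
  have e2 : M₂ + M₁ = M₁ + M₂ := by ring
  have e3 : (M₁ + M₂) ^ (2 * (c + 1) + 2) = (M₁ + M₂) ^ (2 * c + 2) * (M₁ + M₂) ^ 2 := by ring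
  have e4 : (-1 : ℝ) ^ (c + 1 + 1) = -(-1) ^ (c + 1) := by ring
  rw [e2, e3, e4]
  have hS : M₁ + M₂ ≠ 0 := by positivity
  push_cast
  field_simp
  ring

/-- The relation for F involves M₃ only through x₃ = M₃² and ∂ on x₃, except in the sources with the
factor M₃⁻³. Taking parts even in M₃ removes exactly those two sources. The third base point is
fixed at 0 and cannot be varied, so every c is checked here rather than reached by a tower. -/
theorem linRel_degenerateIntegral_base {M₁ M₂ : ℝ} (h₁ : 0 < M₁) (h₂ : 0 < M₂)
    (μ₁ μ₂ μ₃ : ℝ) (c : ℕ) :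
    linRel (degenerateIntegral (M₁ ^ 2) (M₂ ^ 2)) (pairZ (M₁ ^ 2) (M₂ ^ 2))
      (fun _ _ _ => 0) (fun _ _ _ => 0) μ₁ μ₂ μ₃ (M₁ ^ 2) (M₂ ^ 2) 0 0 0 c = 0 := by
  have f01 : degenerateIntegral (M₁ ^ 2) (M₂ ^ 2) 0 1 c =
      degenerateIntegral (M₂ ^ 2) (M₁ ^ 2) 1 0 c := by
    rw [← degenerateIntegral_swap]
  have ec : ((c : ℤ) + 1) = ((c + 1 : ℕ) : ℤ) := by push_cast; rfl
  have hb := (nonnegSupport_degenerateIntegral (M₁ ^ 2) (M₂ ^ 2)).boxOp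
  have hS : M₁ + M₂ ≠ 0 := by positivity
  have e2 : M₂ + M₁ = M₁ + M₂ := by ring
  have e3 : (M₁ + M₂) ^ (2 * (c + 1) + 2) = (M₁ + M₂) ^ (2 * c + 2) * (M₁ + M₂) ^ 2 := by ring
  have e4 : (-1 : ℝ) ^ (c + 1 + 1) = -(-1) ^ (c + 1) := by ring
  simp only [linRel, zero_add, f01, ec, degenerateIntegral_one_zero h₁ h₂,
    degenerateIntegral_one_zero h₂ h₁, degenerateIntegral_zero_zero h₁ h₂,
    boxOp_degenerateIntegral_base h₁ h₂, zero_sub, hb (-1) 0 c (by simp), hb 0 (-1) c (by simp),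
    pairZ, cubeZ_zero h₁, cubeZ_zero h₂, e2, e3, e4]
  -- At c = 0 the source is present and the shifted term c - 1 is absent; for c > 0 it is the other
  -- way round.
  rcases c with _ | c
  · rw [hb 0 0 ((0 : ℕ) - 1) (by simp)]
    have e8 : deltaZ ((0 : ℕ) : ℤ) = 1 := by simp [deltaZ]
    rw [e8]
    push_cast
    field_simp
    ring
  · have e5 : (((c + 1 : ℕ) : ℤ) - 1) = (c : ℤ) := by push_cast; ring
    have e6 : (M₁ + M₂) ^ (2 * (c + 1) + 2) = (M₁ + M₂) ^ (2 * c + 2) * (M₁ + M₂) ^ 2 := by ring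
    have e7 : (-1 : ℝ) ^ (c + 1 + 1) = -(-1) ^ (c + 1) := by ring
    have e8 : deltaZ ((c + 1 : ℕ) : ℤ) = 0 := by
      have : ((c + 1 : ℕ) : ℤ) ≠ 0 := by omega
      rw [deltaZ, if_neg this]
    rw [e5, boxOp_degenerateIntegral_base h₁ h₂ c, e6, e7, e8]
    push_cast
    field_simp
    ring

theorem eulerRel_degenerateIntegral_base {M₁ M₂ : ℝ} (h₁ : 0 < M₁) (h₂ : 0 < M₂) (c : ℕ) :
    eulerRel (degenerateIntegral (M₁ ^ 2) (M₂ ^ 2)) (M₁ ^ 2) (M₂ ^ 2) 0 0 0 c = 0 := by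
  have f01 : degenerateIntegral (M₁ ^ 2) (M₂ ^ 2) 0 1 c =
      degenerateIntegral (M₂ ^ 2) (M₁ ^ 2) 1 0 c := by
    rw [← degenerateIntegral_swap]
  have e2 : M₂ + M₁ = M₁ + M₂ := by ring
  have hS : M₁ + M₂ ≠ 0 := by positivity
  simp only [eulerRel, zero_add, f01, degenerateIntegral_one_zero h₁ h₂,
    degenerateIntegral_one_zero h₂ h₁, degenerateIntegral_zero_zero h₁ h₂, e2]
  push_cast
  field_simp
  ring

/-- `linRel` for the array of degenerate integrals. -/
noncomputable def degenerateRel (μ₁ μ₂ μ₃ x₁ x₂ : ℝ) (a b c : ℤ) : ℝ :=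
  linRel (degenerateIntegral x₁ x₂) (pairZ x₁ x₂) (fun _ _ _ => 0) (fun _ _ _ => 0)
    μ₁ μ₂ μ₃ x₁ x₂ 0 a b c

theorem degenerateRel_swap (μ₁ μ₂ μ₃ x₁ x₂ : ℝ) (a b c : ℤ) :
    degenerateRel μ₂ μ₁ μ₃ x₂ x₁ b a c = degenerateRel μ₁ μ₂ μ₃ x₁ x₂ a b c := by
  unfold degenerateRel
  rw [← linRel_swap₁₂]
  congr 1 <;> funext a b c
  · exact degenerateIntegral_swap _ _ _ _ _
  · exact pairZ_swap _ _ _ _ _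

theorem isTower_degenerateRel (μ₁ μ₂ μ₃ : ℝ) {x₂ : ℝ} (h₂ : 0 < x₂) (b c : ℤ) :
    IsTower fun a x => degenerateRel μ₁ μ₂ μ₃ x x₂ a b c := by
  refine IsTower.linRel (f := fun a b c x => degenerateIntegral x x₂ a b c)
    (p₁₂ := fun a b c x => pairZ x x₂ a b c) (p₁₃ := fun _ _ _ _ => 0)
    (p₂₃ := fun _ _ _ _ => 0)
    (isTower_degenerateIntegral h₂) (fun b c => (isTower_cubeZ.mul_const _).mul_const _)
    ?_ ?_ μ₁ μ₂ μ₃ x₂ 0 b c <;>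
  exact fun b c a x _ => (hasDerivAt_const x (0 : ℝ)).congr_deriv (by simp)

theorem degenerateRel_eq_zero (μ₁ μ₂ μ₃ : ℝ) {x₁ x₂ : ℝ} (h₁ : 0 < x₁) (h₂ : 0 < x₂)
    (a b c : ℤ) : degenerateRel μ₁ μ₂ μ₃ x₁ x₂ a b c = 0 := by
  by_cases hneg : a < 0 ∨ b < 0 ∨ c < 0
  · exact linRel_eq_zero_of_neg (nonnegSupport_degenerateIntegral _ _) (nonnegSupport_pairZ _ _)
      (fun a b c h => rfl) (fun a b c h => rfl) _ _ _ _ _ _ hneg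
  push Not at hneg
  obtain ⟨ha, hb, hc⟩ := hneg
  lift c to ℕ using hc
  have s0 : ∀ μ₁ μ₂ μ₃ x₁ x₂ : ℝ, 0 < x₁ → 0 < x₂ →
      degenerateRel μ₁ μ₂ μ₃ x₁ x₂ 0 0 c = 0 := by
    intro μ₁ μ₂ μ₃ x₁ x₂ h₁ h₂
    have h := linRel_degenerateIntegral_base (Real.sqrt_pos.mpr h₁) (Real.sqrt_pos.mpr h₂)
      μ₁ μ₂ μ₃ c
    rwa [Real.sq_sqrt h₁.le, Real.sq_sqrt h₂.le] at h
  have s1 : ∀ μ₁ μ₂ μ₃ x₁ x₂ : ℝ, 0 < x₁ → 0 < x₂ →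
      degenerateRel μ₁ μ₂ μ₃ x₁ x₂ a 0 c = 0 := by
    intro μ₁ μ₂ μ₃ x₁ x₂ h₁ h₂
    exact (isTower_degenerateRel μ₁ μ₂ μ₃ h₂ 0 c).eq_zero
      (fun x hx => s0 μ₁ μ₂ μ₃ x x₂ hx h₂) a ha x₁ h₁
  rw [← degenerateRel_swap]
  refine (isTower_degenerateRel μ₂ μ₁ μ₃ h₁ a c).eq_zero (fun x hx => ?_) b hb x₂ h₂
  rw [degenerateRel_swap]
  exact s1 _ _ _ _ _ h₁ hx

theorem eulerRel_degenerateIntegral {x₁ x₂ : ℝ} (h₁ : 0 < x₁) (h₂ : 0 < x₂)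
    {a b c : ℤ} (ha : 0 ≤ a) (hb : 0 ≤ b) (hc : 0 ≤ c) :
    eulerRel (degenerateIntegral x₁ x₂) x₁ x₂ 0 a b c = 0 := by
  lift c to ℕ using hc
  have w12 : ∀ (x₁ x₂ : ℝ) (a b c : ℤ), eulerRel (degenerateIntegral x₂ x₁) x₂ x₁ 0 b a c =
      eulerRel (degenerateIntegral x₁ x₂) x₁ x₂ 0 a b c := by
    intro x₁ x₂ a b c
    rw [← eulerRel_swap₁₂]
    congr 1; funext a b c; exact (degenerateIntegral_swap _ _ _ _ _)
  have tow : ∀ {x₂ : ℝ}, 0 < x₂ → ∀ b c : ℤ,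
      IsTower fun a x => eulerRel (degenerateIntegral x x₂) x x₂ 0 a b c := by
    intro x₂ h₂ b c
    exact IsTower.eulerRel (f := fun a b c x => degenerateIntegral x x₂ a b c)
      (isTower_degenerateIntegral h₂) x₂ 0 b c
  have s0 : ∀ x₁ x₂ : ℝ, 0 < x₁ → 0 < x₂ →
      eulerRel (degenerateIntegral x₁ x₂) x₁ x₂ 0 0 0 c = 0 := by
    intro x₁ x₂ h₁ h₂
    have h := eulerRel_degenerateIntegral_base (Real.sqrt_pos.mpr h₁) (Real.sqrt_pos.mpr h₂) c
    rwa [Real.sq_sqrt h₁.le, Real.sq_sqrt h₂.le] at h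
  rw [← w12]
  refine (tow h₁ a c).eq_zero (fun x hx => ?_) b hb x₂ h₂
  rw [w12]
  exact (tow hx 0 c).eq_zero (fun x' hx' => s0 x' x hx' hx) a ha x₁ h₁


/-! ### The relation for each lattice triple. -/

/-- The Laurent coefficient of interest of the contribution of the triple `(n₁, n₂, n₃)`. -/
noncomputable def latticeCoeff (n₁ n₂ n₃ : ℤ) (a b c : ℤ) : ℝ :=
  if n₃ = 0 then
    if n₁ = 0 then 0 else degenerateIntegral ((n₁ : ℝ) ^ 2) ((n₂ : ℝ) ^ 2) a b c
  else if n₂ = 0 then degenerateIntegral ((n₁ : ℝ) ^ 2) ((n₃ : ℝ) ^ 2) a c b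
  else if n₁ = 0 then degenerateIntegral ((n₃ : ℝ) ^ 2) ((n₂ : ℝ) ^ 2) c b a
  else tripleIntegral ((n₁ : ℝ) ^ 2) ((n₂ : ℝ) ^ 2) ((n₃ : ℝ) ^ 2) a b c

theorem nonnegSupport_latticeCoeff (n₁ n₂ n₃ : ℤ) : NonnegSupport (latticeCoeff n₁ n₂ n₃) := by
  intro a b c h
  unfold latticeCoeff
  split_ifs
  · rfl
  · exact nonnegSupport_degenerateIntegral _ _ _ _ _ h
  · exact nonnegSupport_degenerateIntegral _ _ _ _ _ (by tauto)
  · exact nonnegSupport_degenerateIntegral _ _ _ _ _ (by tauto)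
  · exact nonnegSupport_tripleIntegral _ _ _ _ _ _ h

/-- Division by zero gives 0. This lets degenerate triples share the source formula of the others,
since the sources that involve a vanishing n_r drop out by themselves. -/
theorem cubeZ_base_zero (a : ℤ) : cubeZ a 0 = 0 := by
  rcases lt_or_ge a 0 with ha | ha
  · exact cubeZ_of_neg ha 0
  · lift a to ℕ using ha
    rw [cubeZ, intExt_natCast]; simp

/-- For x₃ = 0 the form Q is -(x₁ - x₂)², so equality of the base points is the null cone condition.
-/
theorem degenerateIntegral_relation {x₁ x₂ : ℝ} (h₁ : 0 < x₁) (h₂ : 0 < x₂) (h : x₁ = x₂)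
    {a b c : ℤ} (ha : 0 ≤ a) (hb : 0 ≤ b) (hc : 0 ≤ c) :
    2 * ((a : ℝ) + b + c + 1) * degenerateIntegral x₁ x₂ a b c
      + quadOp (boxOp (degenerateIntegral x₁ x₂)) a b c
      = sourceTerm (pairZ x₁ x₂) (fun _ _ _ => 0) (fun _ _ _ => 0) x₁ x₂ 0 a b c :=
  add_quadOp_boxOp_eq_sourceTerm
    (fun μ₁ μ₂ μ₃ a b c => degenerateRel_eq_zero μ₁ μ₂ μ₃ h₁ h₂ a b c)
    (eulerRel_degenerateIntegral h₁ h₂ ha hb hc) (by rw [h]; ring)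

/-- The source term attached to the triple `(n₁, n₂, n₃)`. -/
noncomputable def latticeSource (n₁ n₂ n₃ : ℤ) (a b c : ℤ) : ℝ :=
  sourceTerm (pairZ ((n₁ : ℝ) ^ 2) ((n₂ : ℝ) ^ 2))
    (fun a b c => pairZ ((n₁ : ℝ) ^ 2) ((n₃ : ℝ) ^ 2) a c b)
    (fun a b c => pairZ ((n₂ : ℝ) ^ 2) ((n₃ : ℝ) ^ 2) b c a)
    ((n₁ : ℝ) ^ 2) ((n₂ : ℝ) ^ 2) ((n₃ : ℝ) ^ 2) a b c

/-- At x_i = n_i² Heron's factorization gives Q(x) the factor n₁ + n₂ + n₃, so every triple lies on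
the null cone. The operator on the left is the same for all triples, which permits summation over n.
-/
theorem latticeCoeff_relation {n₁ n₂ n₃ : ℤ} (hn : n₁ + n₂ + n₃ = 0) {a b c : ℤ}
    (ha : 0 ≤ a) (hb : 0 ≤ b) (hc : 0 ≤ c) :
    2 * ((a : ℝ) + b + c + 1) * latticeCoeff n₁ n₂ n₃ a b c
      + quadOp (boxOp (latticeCoeff n₁ n₂ n₃)) a b c = latticeSource n₁ n₂ n₃ a b c := by
  have pos : ∀ n : ℤ, n ≠ 0 → (0 : ℝ) < (n : ℝ) ^ 2 := fun n hn => by positivity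
  have sq : ∀ n m : ℤ, n + m = 0 → (n : ℝ) ^ 2 = (m : ℝ) ^ 2 := fun n m h => by
    have : n = -m := by omega
    rw [this]; push_cast; ring
  by_cases h3 : n₃ = 0
  · subst h3
    by_cases h1 : n₁ = 0
    · subst h1
      have h2 : n₂ = 0 := by omega
      subst h2
      have : latticeCoeff 0 0 0 = fun _ _ _ => 0 := by funext a b c; simp [latticeCoeff]
      rw [this]
      simp [quadOp, boxOp, latticeSource, sourceTerm, pairZ, cubeZ_base_zero]
    · have h2 : n₂ ≠ 0 := by omega
      have e : latticeCoeff n₁ n₂ 0 = degenerateIntegral ((n₁ : ℝ) ^ 2) ((n₂ : ℝ) ^ 2) := by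
        funext a b c; simp [latticeCoeff, h1]
      rw [e, degenerateIntegral_relation (pos _ h1) (pos _ h2) (sq _ _ (by omega)) ha hb hc]
      simp [latticeSource, sourceTerm, pairZ, cubeZ_base_zero]
  by_cases h2 : n₂ = 0
  · subst h2
    have h1 : n₁ ≠ 0 := by omega
    have e : latticeCoeff n₁ 0 n₃ =
        fun a b c => degenerateIntegral ((n₁ : ℝ) ^ 2) ((n₃ : ℝ) ^ 2) a c b := by
      funext a b c; simp [latticeCoeff, h3]
    have h := degenerateIntegral_relation (pos _ h1) (pos _ h3) (sq n₁ n₃ (by omega)) ha hc hb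
    rw [e]
    simp only [sourceTerm, latticeSource, quadOp, boxOp, pairZ, Int.cast_zero,
      zero_pow two_ne_zero, cubeZ_base_zero] at h ⊢
    linear_combination h
  by_cases h1 : n₁ = 0
  · subst h1
    have e : latticeCoeff 0 n₂ n₃ =
        fun a b c => degenerateIntegral ((n₃ : ℝ) ^ 2) ((n₂ : ℝ) ^ 2) c b a := by
      funext a b c; simp [latticeCoeff, h3, h2]
    have h := degenerateIntegral_relation (pos _ h3) (pos _ h2) (sq n₃ n₂ (by omega)) hc hb ha
    rw [e]
    simp only [sourceTerm, latticeSource, quadOp, boxOp, pairZ, Int.cast_zero,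
      zero_pow two_ne_zero, cubeZ_base_zero] at h ⊢
    linear_combination h
  · have e : latticeCoeff n₁ n₂ n₃ =
        tripleIntegral ((n₁ : ℝ) ^ 2) ((n₂ : ℝ) ^ 2) ((n₃ : ℝ) ^ 2) := by
      funext a b c; simp [latticeCoeff, h1, h2, h3]
    rw [e]
    refine add_quadOp_boxOp_eq_sourceTerm
      (fun μ₁ μ₂ μ₃ a b c => tripleRel_eq_zero μ₁ μ₂ μ₃ (pos _ h1) (pos _ h2) (pos _ h3) a b c)
      (eulerRel_tripleIntegral (pos _ h1) (pos _ h2) (pos _ h3) ha hb hc) ?_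
    have : n₃ = -n₁ - n₂ := by omega
    rw [this]; push_cast; ring


/-! ### Summing the source: odd zeta values. -/

/-- The values `∑ 1 / n ^ k` of the zeta function, as real numbers. -/
noncomputable def zetaReal (k : ℕ) : ℝ := ∑' n : ℕ, 1 / (n : ℝ) ^ k

/-- The rational span of the products `ζ(2k+1) ζ(2w-2k-3)`, for `1 ≤ k ≤ w - 3`. -/
noncomputable def oddZetaSpan (w : ℕ) : Submodule ℚ ℝ :=
  Submodule.span ℚ ((fun k : ℕ => zetaReal (2 * k + 1) * zetaReal (2 * w - 2 * k - 3)) ''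
    (Finset.Icc 1 (w - 3) : Finset ℕ))

theorem zetaReal_mul_zetaReal_mem (i j : ℕ) {w : ℕ} (h : i + j + 4 = w) (q : ℚ) :
    (q : ℝ) * (zetaReal (2 * i + 3) * zetaReal (2 * j + 3)) ∈ oddZetaSpan w := by
  have h1 : zetaReal (2 * i + 3) * zetaReal (2 * j + 3) ∈ oddZetaSpan w := by
    refine Submodule.subset_span ⟨i + 1, ?_, ?_⟩
    · simp; omega
    · have e1 : 2 * (i + 1) + 1 = 2 * i + 3 := by ring
      have e2 : 2 * w - 2 * (i + 1) - 3 = 2 * j + 3 := by omega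
      simp only [e1, e2]
  have := (oddZetaSpan w).smul_mem q h1
  rwa [Rat.smul_def] at this

theorem sqrt_int_sq (n : ℤ) : √((n : ℝ) ^ 2) = |(n : ℝ)| := Real.sqrt_sq_eq_abs _

/-- The terms for n and -n agree and n = 0 contributes nothing, whence the factor 2. -/
theorem hasSum_cubeZ (a : ℕ) :
    HasSum (fun n : ℤ => cubeZ a ((n : ℝ) ^ 2)) (2 * cubeCoeff a * zetaReal (2 * a + 3)) := by
  have hs : Summable fun n : ℕ => 1 / (n : ℝ) ^ (2 * a + 3) :=
    Real.summable_one_div_nat_pow.mpr (by omega)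
  have h1 := hs.hasSum.mul_left (cubeCoeff a : ℝ)
  have e : ∀ n : ℤ, cubeZ a ((n : ℝ) ^ 2) = cubeCoeff a * (1 / |(n : ℝ)| ^ (2 * a + 3)) := by
    intro n
    rw [cubeZ, intExt_natCast, sqrt_int_sq]; ring
  have h2 : HasSum (fun n : ℕ => cubeZ a (((n : ℤ) : ℝ) ^ 2)) (cubeCoeff a * zetaReal (2 * a + 3)) := by
    refine h1.congr_fun ?_
    intro n; rw [e]; simp
  have h3 : HasSum (fun n : ℕ => cubeZ a (((-(n : ℤ) : ℤ) : ℝ) ^ 2))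
      (cubeCoeff a * zetaReal (2 * a + 3)) := by
    refine h2.congr_fun ?_
    intro n; push_cast; rw [neg_sq]
  have h4 := HasSum.of_nat_of_neg (f := fun n : ℤ => cubeZ a ((n : ℝ) ^ 2)) h2 h3
  have e0 : cubeZ a (((0 : ℤ) : ℝ) ^ 2) = 0 := by simp [cubeZ_base_zero]
  rw [e0] at h4
  have e1 : 2 * (cubeCoeff a : ℝ) * zetaReal (2 * a + 3) =
      cubeCoeff a * zetaReal (2 * a + 3) + cubeCoeff a * zetaReal (2 * a + 3) - 0 := by ring
  rwa [e1]

theorem summable_cubeZ (a : ℤ) : Summable fun n : ℤ => cubeZ a ((n : ℝ) ^ 2) := by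
  rcases lt_or_ge a 0 with ha | ha
  · simp only [cubeZ_of_neg ha]; exact summable_zero
  · lift a to ℕ using ha; exact (hasSum_cubeZ a).summable

theorem cubeCoeff_nonneg (a : ℕ) : (0 : ℝ) ≤ cubeCoeff a := by
  have : (0 : ℚ) ≤ cubeCoeff a := by
    induction a with
    | zero => simp [cubeCoeff]
    | succ a ih => rw [cubeCoeff]; positivity
  exact_mod_cast this

theorem summable_int_mul_cubeZ (a : ℤ) : Summable fun n : ℤ => (n : ℝ) * cubeZ a ((n : ℝ) ^ 2) := by
  rcases lt_or_ge a 0 with ha | ha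
  · simp only [cubeZ_of_neg ha, mul_zero]; exact summable_zero
  · lift a to ℕ using ha
    have hs : Summable fun n : ℤ => (cubeCoeff a : ℝ) * (1 / (n : ℝ) ^ 2) :=
      (Real.summable_one_div_int_pow.mpr one_lt_two).mul_left _
    refine Summable.of_norm_bounded hs fun n => ?_
    rw [cubeZ, intExt_natCast, sqrt_int_sq, norm_mul, Real.norm_eq_abs, Real.norm_eq_abs, abs_div,
      abs_of_nonneg (cubeCoeff_nonneg a), abs_pow, abs_abs]
    rcases eq_or_ne n 0 with rfl | hn
    · simp
    · have h1 : (1 : ℝ) ≤ |(n : ℝ)| := by exact_mod_cast Int.one_le_abs hn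
      have hc := cubeCoeff_nonneg a
      rw [← sq_abs (n : ℝ), mul_div_assoc', mul_one_div, div_le_div_iff₀ (by positivity) (by positivity)]
      have h2 : |(n : ℝ)| ^ 3 ≤ |(n : ℝ)| ^ (2 * a + 3) := pow_le_pow_right₀ h1 (by omega)
      calc |(n : ℝ)| * (cubeCoeff a : ℝ) * |(n : ℝ)| ^ 2 = cubeCoeff a * |(n : ℝ)| ^ 3 := by ring
        _ ≤ _ := by gcongr

/-- The summand is odd in n. In absolute value its terms would add up to a multiple of the even zeta
value ζ(2a + 2); this cancellation is why no power of π survives. -/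
theorem hasSum_int_mul_cubeZ (a : ℤ) : HasSum (fun n : ℤ => (n : ℝ) * cubeZ a ((n : ℝ) ^ 2)) 0 := by
  have h := (summable_int_mul_cubeZ a).hasSum
  have h2 := (Equiv.neg ℤ).hasSum_iff.mpr h
  have h3 : HasSum (fun n : ℤ => (n : ℝ) * cubeZ a ((n : ℝ) ^ 2))
      (-∑' n : ℤ, (n : ℝ) * cubeZ a ((n : ℝ) ^ 2)) := by
    refine h2.neg.congr_fun ?_
    intro n
    simp
  have := h.unique h3
  have h0 : ∑' n : ℤ, (n : ℝ) * cubeZ a ((n : ℝ) ^ 2) = 0 := by linarith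
  rwa [h0] at h

theorem hasSum_mul_of_summable {f g : ℤ → ℝ} (hf : Summable f) (hg : Summable g) :
    HasSum (fun n : ℤ × ℤ => f n.1 * g n.2) ((∑' n, f n) * ∑' n, g n) :=
  hf.hasSum.mul hg.hasSum (summable_mul_of_summable_norm hf.norm hg.norm)

theorem deltaZ_mul_tsum_cubeZ_mem (r : ℚ) {a b c : ℤ} {w : ℕ} (h : a + b + c + 4 = w) :
    deltaZ c * (r * ((∑' n : ℤ, cubeZ a ((n : ℝ) ^ 2)) * ∑' n : ℤ, cubeZ b ((n : ℝ) ^ 2)))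
      ∈ oddZetaSpan w := by
  by_cases hc : c = 0
  · subst hc
    simp only [deltaZ, if_true, one_mul]
    rcases lt_or_ge a 0 with ha | ha
    · simp [cubeZ_of_neg ha]
    rcases lt_or_ge b 0 with hb | hb
    · simp [cubeZ_of_neg hb]
    lift a to ℕ using ha
    lift b to ℕ using hb
    rw [(hasSum_cubeZ a).tsum_eq, (hasSum_cubeZ b).tsum_eq]
    have := zetaReal_mul_zetaReal_mem a b (w := w) (by omega) (4 * r * cubeCoeff a * cubeCoeff b)
    convert this using 1
    push_cast; ring
  · simp [deltaZ, hc]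

/-- The part of the source that comes from one pair of indices. -/
noncomputable def pairSource (n m : ℤ) (a b c : ℤ) : ℝ :=
  deltaZ c * (cubeZ (a - 1) ((n : ℝ) ^ 2) * cubeZ b ((m : ℝ) ^ 2))
    + deltaZ c * (cubeZ a ((n : ℝ) ^ 2) * cubeZ (b - 1) ((m : ℝ) ^ 2))
    - deltaZ (c - 1) * (cubeZ a ((n : ℝ) ^ 2) * cubeZ b ((m : ℝ) ^ 2))
    - 2 * deltaZ c * ((n * cubeZ a ((n : ℝ) ^ 2)) * (m * cubeZ b ((m : ℝ) ^ 2)))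

/-- The two indices are independent, so each term sums to a product of one-variable sums. The last
is a product of odd sums and vanishes; the others are rational multiples of ζ(2i+3)ζ(2j+3). -/
theorem exists_hasSum_pairSource {a b c : ℤ} {w : ℕ} (h : a + b + c + 3 = w) :
    ∃ x ∈ oddZetaSpan w, HasSum (fun n : ℤ × ℤ => pairSource n.1 n.2 a b c) x := by
  have h1 := (hasSum_mul_of_summable (summable_cubeZ (a - 1)) (summable_cubeZ b)).mul_left (deltaZ c)
  have h2 := (hasSum_mul_of_summable (summable_cubeZ a) (summable_cubeZ (b - 1))).mul_left (deltaZ c)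
  have h3 := (hasSum_mul_of_summable (summable_cubeZ a) (summable_cubeZ b)).mul_left (deltaZ (c - 1))
  have h4 := (hasSum_mul_of_summable (summable_int_mul_cubeZ a)
    (summable_int_mul_cubeZ b)).mul_left (2 * deltaZ c)
  rw [(hasSum_int_mul_cubeZ a).tsum_eq, zero_mul, mul_zero] at h4
  refine ⟨_, ?_, ((h1.add h2).sub h3).sub h4⟩
  rw [sub_zero]
  have m1 := deltaZ_mul_tsum_cubeZ_mem 1 (a := a - 1) (b := b) (c := c) (w := w) (by omega)
  have m2 := deltaZ_mul_tsum_cubeZ_mem 1 (a := a) (b := b - 1) (c := c) (w := w) (by omega)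
  have m3 := deltaZ_mul_tsum_cubeZ_mem 1 (a := a) (b := b) (c := c - 1) (w := w) (by omega)
  simp only [Rat.cast_one, one_mul] at m1 m2 m3
  exact Submodule.sub_mem _ (Submodule.add_mem _ m1 m2) m3

/-- On the plane of sum zero n₁² + n₂² - n₃² = -2 n₁ n₂, so each source depends on two of the
indices only, and its terms factor. -/
theorem latticeSource_eq_pairSource {n₁ n₂ n₃ : ℤ} (hn : n₁ + n₂ + n₃ = 0) (a b c : ℤ) :
    latticeSource n₁ n₂ n₃ a b c = -(Real.pi ^ 2 / 4) *
      (pairSource n₁ n₂ a b c + pairSource n₁ n₃ a c b + pairSource n₂ n₃ b c a) := by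
  have h3 : (n₃ : ℝ) = -n₁ - n₂ := by
    have : n₃ = -n₁ - n₂ := by omega
    rw [this]; push_cast; ring
  have e1 : (n₁ : ℝ) ^ 2 + (n₂ : ℝ) ^ 2 - (n₃ : ℝ) ^ 2 = -2 * n₁ * n₂ := by rw [h3]; ring
  have e2 : (n₁ : ℝ) ^ 2 + (n₃ : ℝ) ^ 2 - (n₂ : ℝ) ^ 2 = -2 * n₁ * n₃ := by rw [h3]; ring
  have e3 : (n₂ : ℝ) ^ 2 + (n₃ : ℝ) ^ 2 - (n₁ : ℝ) ^ 2 = -2 * n₂ * n₃ := by rw [h3]; ring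
  simp only [latticeSource, sourceTerm, pairSource, pairZ, e1, e2, e3]
  ring

theorem exists_hasSum_latticeSource {a b c : ℤ} {w : ℕ} (h : a + b + c + 3 = w) :
    ∃ x ∈ oddZetaSpan w, HasSum (fun n : ℤ × ℤ => latticeSource n.1 n.2 (-n.1 - n.2) a b c)
      (Real.pi ^ 2 * x) := by
  obtain ⟨x, hx, h12⟩ := exists_hasSum_pairSource h
  obtain ⟨y, hy, h13⟩ := exists_hasSum_pairSource (a := a) (b := c) (c := b) (w := w) (by omega)
  obtain ⟨z, hz, h23⟩ := exists_hasSum_pairSource (a := b) (b := c) (c := a) (w := w) (by omega)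
  -- Any two of n₁, n₂, n₃ are free coordinates on the plane; σ and ρ pass to the pairs (n₁, n₃) and
  -- (n₂, n₃).
  let σ : ℤ × ℤ ≃ ℤ × ℤ :=
    { toFun := fun n => (n.1, -n.1 - n.2)
      invFun := fun n => (n.1, -n.1 - n.2)
      left_inv := fun n => by ext <;> simp
      right_inv := fun n => by ext <;> simp }
  let ρ : ℤ × ℤ ≃ ℤ × ℤ :=
    { toFun := fun n => (n.2, -n.1 - n.2)
      invFun := fun n => (-n.1 - n.2, n.1)
      left_inv := fun n => by ext <;> dsimp <;> ring
      right_inv := fun n => by ext <;> dsimp <;> ring }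
  have h13' := σ.hasSum_iff.mpr h13
  have h23' := ρ.hasSum_iff.mpr h23
  refine ⟨-(1 / 4) * (x + y + z), ?_, ?_⟩
  · have := (oddZetaSpan w).smul_mem (-(1 / 4) : ℚ)
      (Submodule.add_mem _ (Submodule.add_mem _ hx hy) hz)
    rw [Rat.smul_def] at this
    push_cast at this
    exact this
  · have hsum := ((h12.add h13').add h23').mul_left (-(Real.pi ^ 2 / 4))
    have e : Real.pi ^ 2 * (-(1 / 4) * (x + y + z)) = -(Real.pi ^ 2 / 4) * (x + y + z) := by ring
    rw [e]
    refine hsum.congr_fun fun n => ?_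
    rw [latticeSource_eq_pairSource (by ring)]
    rfl

/-- The sum of the coefficients `latticeCoeff` over all triples with sum zero. -/
noncomputable def totalCoeff (a b c : ℤ) : ℝ :=
  ∑' n : ℤ × ℤ, latticeCoeff n.1 n.2 (-n.1 - n.2) a b c

/-- The relation of `latticeCoeff_relation`, summed over the lattice and divided by π², has its
right side in the span. The target span depends only on the total degree, and
`mem_of_add_quadOp_boxOp_mem` with r = 2(d + 1) solves for the sum. -/
theorem totalCoeff_mem
    (hs : ∀ a b c : ℕ, Summable fun n : ℤ × ℤ => latticeCoeff n.1 n.2 (-n.1 - n.2) a b c)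
    (a b c : ℕ) : (Real.pi ^ 2)⁻¹ * totalCoeff a b c ∈ oddZetaSpan (a + b + c + 3) := by
  have supp : NonnegSupport totalCoeff := by
    intro a b c h
    simp only [totalCoeff, nonnegSupport_latticeCoeff _ _ _ a b c h, tsum_zero]
  have hS : ∀ a b c : ℤ, HasSum (fun n : ℤ × ℤ => latticeCoeff n.1 n.2 (-n.1 - n.2) a b c)
      (totalCoeff a b c) := by
    intro a b c
    by_cases h : a < 0 ∨ b < 0 ∨ c < 0
    · rw [supp a b c h]
      simp only [nonnegSupport_latticeCoeff _ _ _ a b c h]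
      exact hasSum_zero
    · push Not at h
      obtain ⟨ha, hb, hc⟩ := h
      lift a to ℕ using ha
      lift b to ℕ using hb
      lift c to ℕ using hc
      exact (hs a b c).hasSum
  have hbox : ∀ a b c : ℤ, HasSum
      (fun n : ℤ × ℤ => boxOp (latticeCoeff n.1 n.2 (-n.1 - n.2)) a b c)
      (boxOp totalCoeff a b c) := fun a b c =>
    (((hS _ _ _).mul_left _).add ((hS _ _ _).mul_left _)).add ((hS _ _ _).mul_left _)
  have hquad : ∀ a b c : ℤ, HasSum
      (fun n : ℤ × ℤ => quadOp (boxOp (latticeCoeff n.1 n.2 (-n.1 - n.2))) a b c)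
      (quadOp (boxOp totalCoeff) a b c) := fun a b c =>
    ((((((hbox _ _ _).add (hbox _ _ _)).add (hbox _ _ _)).mul_left 2).sub (hbox _ _ _)).sub
      (hbox _ _ _)).sub (hbox _ _ _)
  have hpi : Real.pi ^ 2 ≠ 0 := by positivity
  have hlin : ∀ a b c : ℤ, boxOp (fun a b c => (Real.pi ^ 2)⁻¹ * totalCoeff a b c) a b c
      = (Real.pi ^ 2)⁻¹ * boxOp totalCoeff a b c := fun a b c => by simp only [boxOp]; ring
  refine mem_of_add_quadOp_boxOp_mem (oddZetaSpan (a + b + c + 3)) (a + b + c + 1)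
    (a + b + c : ℤ) (2 * ((a : ℚ) + b + c + 1))
    (fun a b c => (Real.pi ^ 2)⁻¹ * totalCoeff a b c) (by push_cast; omega) (by positivity)
    (fun a b c h => by simp only [supp a b c h, mul_zero]) ?_ a b c rfl
  intro a' b' c' hd
  have e : ∀ a' b' c' : ℤ, quadOp (boxOp (fun a b c => (Real.pi ^ 2)⁻¹ * totalCoeff a b c)) a' b' c'
      = (Real.pi ^ 2)⁻¹ * quadOp (boxOp totalCoeff) a' b' c' := fun a' b' c' => by
    simp only [quadOp, hlin]; ring
  rw [e]
  by_cases h : a' < 0 ∨ b' < 0 ∨ c' < 0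
  · rw [supp _ _ _ h, supp.boxOp.quadOp _ _ _ h]
    simp
  · push Not at h
    obtain ⟨ha, hb, hc⟩ := h
    obtain ⟨x, hx, hxs⟩ := exists_hasSum_latticeSource (a := a') (b := b') (c := c')
      (w := a + b + c + 3) (by push_cast; omega)
    have h1 := ((hS a' b' c').mul_left (2 * ((a' : ℝ) + b' + c' + 1))).add (hquad a' b' c')
    have h2 := h1.congr_fun (g := fun n : ℤ × ℤ => latticeSource n.1 n.2 (-n.1 - n.2) a' b' c')
      (fun n => (latticeCoeff_relation (by ring) ha hb hc).symm)
    have h3 := hxs.unique h2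
    have hd' : (a' : ℝ) + b' + c' = a + b + c := by exact_mod_cast hd
    rw [hd'] at h3
    convert hx using 1
    push_cast
    field_simp
    linear_combination -h3


/-! ### Parseval and averaging over τ₁: passage to the dual sum. -/

/-- The additive character `x ↦ exp (2 π i x)`. -/
noncomputable def unitExp (x : ℝ) : ℂ := Complex.exp ((2 * Real.pi * x : ℝ) * Complex.I)

theorem norm_unitExp (x : ℝ) : ‖unitExp x‖ = 1 := Complex.norm_exp_ofReal_mul_I _

theorem unitExp_add (x y : ℝ) : unitExp (x + y) = unitExp x * unitExp y := by
  unfold unitExp; rw [← Complex.exp_add]; push_cast; ring_nf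

theorem unitExp_zero : unitExp 0 = 1 := by simp [unitExp]

theorem unitExp_intCast (n : ℤ) : unitExp n = 1 := by
  unfold unitExp
  rw [← Complex.exp_int_mul_two_pi_mul_I n]; push_cast; ring_nf

@[fun_prop]
theorem continuous_unitExp : Continuous unitExp := by unfold unitExp; fun_prop

theorem integral_unitExp_int_mul (n : ℤ) :
    ∫ t in (0 : ℝ)..1, unitExp (n * t) = if n = 0 then 1 else 0 := by
  by_cases h : n = 0
  · simp [h, unitExp_zero]
  · rw [if_neg h]
    have hc : (2 * Real.pi * n * Complex.I : ℂ) ≠ 0 := by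
      have : (Real.pi : ℂ) ≠ 0 := by exact_mod_cast Real.pi_ne_zero
      have : (n : ℂ) ≠ 0 := by exact_mod_cast h
      simp_all
    have e : ∀ t : ℝ, unitExp (n * t) = Complex.exp ((2 * Real.pi * n * Complex.I : ℂ) * t) := by
      intro t; unfold unitExp; push_cast; ring_nf
    simp only [e]
    rw [integral_exp_mul_complex hc]
    have e1 : Complex.exp (2 * Real.pi * n * Complex.I * (1 : ℝ)) = 1 := by
      rw [← e 1, mul_one, unitExp_intCast]
    rw [e1]; simp

theorem hasSum_intervalIntegral {ι : Type*} [Countable ι] {F : ι → ℝ → ℂ} {f : ℝ → ℂ}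
    {b : ι → ℝ} (hF : ∀ i, Continuous (F i)) (hb : Summable b)
    (hbound : ∀ i, ∀ t ∈ Set.Icc (0 : ℝ) 1, ‖F i t‖ ≤ b i)
    (hsum : ∀ t ∈ Set.Icc (0 : ℝ) 1, HasSum (fun i => F i t) (f t)) :
    HasSum (fun i => ∫ t in (0 : ℝ)..1, F i t) (∫ t in (0 : ℝ)..1, f t) := by
  have hI : Set.uIoc (0 : ℝ) 1 ⊆ Set.Icc 0 1 := by
    rw [Set.uIoc_of_le zero_le_one]; exact Set.Ioc_subset_Icc_self
  exact intervalIntegral.hasSum_integral_of_dominated_convergence (fun i _ => b i)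
    (fun i => (hF i).aestronglyMeasurable)
    (fun i => Eventually.of_forall fun t ht => hbound i t (hI ht))
    (Eventually.of_forall fun t _ => hb) intervalIntegrable_const
    (Eventually.of_forall fun t ht => hsum t (hI ht))

/-- `c m τ` are the Fourier coefficients in `α` of a function which is given by a twisted
periodization `∑ k, A k α exp (-2 π i (α + k) n τ)`. -/
structure TwistedExpansion (n : ℤ) (c A : ℤ → ℝ → ℝ) : Prop where
  continuous_coeff : ∀ m, Continuous (c m)
  coeff_nonneg : ∀ m τ, 0 ≤ c m τ
  summable_coeff : ∀ τ, Summable fun m => c m τ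
  continuous_term : ∀ k, Continuous (A k)
  exists_bound : ∃ b : ℤ → ℝ, Summable b ∧ ∀ k, ∀ α ∈ Set.Icc (0 : ℝ) 1, |A k α| ≤ b k
  exists_hasSum : ∀ τ, ∀ α ∈ Set.Icc (0 : ℝ) 1, ∃ D : ℂ,
    HasSum (fun m : ℤ => (c m τ : ℂ) * unitExp (m * α)) D ∧
    HasSum (fun k : ℤ => (A k α : ℂ) * unitExp (-((α + k) * (n * τ)))) D

theorem summable_triple {b₁ b₂ b₃ : ℤ → ℝ} (h₁ : Summable b₁) (h₂ : Summable b₂)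
    (h₃ : Summable b₃) : Summable fun k : ℤ × ℤ × ℤ => |b₁ k.1| * (|b₂ k.2.1| * |b₃ k.2.2|) := by
  have h := summable_mul_of_summable_norm h₂.norm.norm h₃.norm.norm
  exact summable_mul_of_summable_norm h₁.norm.norm h.norm

theorem hasSum_triple {f₁ f₂ f₃ : ℤ → ℂ} {D₁ D₂ D₃ : ℂ} (h₁ : HasSum f₁ D₁) (h₂ : HasSum f₂ D₂)
    (h₃ : HasSum f₃ D₃) (s₁ : Summable fun k => ‖f₁ k‖) (s₂ : Summable fun k => ‖f₂ k‖)
    (s₃ : Summable fun k => ‖f₃ k‖) :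
    HasSum (fun k : ℤ × ℤ × ℤ => f₁ k.1 * (f₂ k.2.1 * f₃ k.2.2)) (D₁ * (D₂ * D₃)) := by
  have s₂₃ : Summable (fun k : ℤ × ℤ => f₂ k.1 * f₃ k.2) := summable_mul_of_summable_norm s₂ s₃
  have s₁₂₃ : Summable (fun k : ℤ × ℤ × ℤ => f₁ k.1 * (f₂ k.2.1 * f₃ k.2.2)) :=
    summable_mul_of_summable_norm (g := fun k : ℤ × ℤ => f₂ k.1 * f₃ k.2) s₁ s₂₃.norm
  have h₂₃ : HasSum (fun k : ℤ × ℤ => f₂ k.1 * f₃ k.2) (D₂ * D₃) := h₂.mul h₃ s₂₃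
  exact HasSum.mul (g := fun k : ℤ × ℤ => f₂ k.1 * f₃ k.2) h₁ h₂₃ s₁₂₃

/-- Parseval's identity for a product of three absolutely convergent Fourier series. -/
theorem hasSum_constraint_of_fourier {c₁ c₂ c₃ : ℤ → ℝ} (hc₁ : Summable c₁) (hc₂ : Summable c₂)
    (hc₃ : Summable c₃) {D₁ D₂ D₃ : ℝ → ℂ}
    (h₁ : ∀ α ∈ Set.Icc (0 : ℝ) 1, HasSum (fun m : ℤ => (c₁ m : ℂ) * unitExp (m * α)) (D₁ α))
    (h₂ : ∀ α ∈ Set.Icc (0 : ℝ) 1, HasSum (fun m : ℤ => (c₂ m : ℂ) * unitExp (m * α)) (D₂ α))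
    (h₃ : ∀ α ∈ Set.Icc (0 : ℝ) 1, HasSum (fun m : ℤ => (c₃ m : ℂ) * unitExp (m * α)) (D₃ α)) :
    HasSum (fun m : ℤ × ℤ => ((c₁ m.1 * c₂ m.2 * c₃ (-m.1 - m.2) : ℝ) : ℂ))
      (∫ α in (0 : ℝ)..1, D₁ α * (D₂ α * D₃ α)) := by
  have hs : ∀ c : ℤ → ℝ, Summable c → ∀ α : ℝ,
      Summable fun m : ℤ => ‖(c m : ℂ) * unitExp (m * α)‖ := by
    intro c hc α
    refine hc.norm.congr fun m => ?_
    rw [norm_mul, norm_unitExp, mul_one, Complex.norm_real]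
  have e : ∀ (m : ℤ × ℤ × ℤ) (α : ℝ), ((c₁ m.1 : ℂ) * unitExp (m.1 * α)) *
      (((c₂ m.2.1 : ℂ) * unitExp (m.2.1 * α)) * ((c₃ m.2.2 : ℂ) * unitExp (m.2.2 * α)))
      = ((c₁ m.1 * c₂ m.2.1 * c₃ m.2.2 : ℝ) : ℂ) *
        unitExp (((m.1 + m.2.1 + m.2.2 : ℤ) : ℝ) * α) := by
    intro m α
    have : (((m.1 + m.2.1 + m.2.2 : ℤ) : ℝ) * α) = m.1 * α + (m.2.1 * α + m.2.2 * α) := by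
      push_cast; ring
    rw [this, unitExp_add, unitExp_add]; push_cast; ring
  have hbig : HasSum (fun m : ℤ × ℤ × ℤ => ∫ α in (0 : ℝ)..1,
      ((c₁ m.1 * c₂ m.2.1 * c₃ m.2.2 : ℝ) : ℂ) * unitExp (((m.1 + m.2.1 + m.2.2 : ℤ) : ℝ) * α))
      (∫ α in (0 : ℝ)..1, D₁ α * (D₂ α * D₃ α)) := by
    refine hasSum_intervalIntegral (b := fun m => |c₁ m.1| * (|c₂ m.2.1| * |c₃ m.2.2|))
      (fun m => by fun_prop) (summable_triple hc₁ hc₂ hc₃) (fun m α _ => ?_) fun α hα => ?_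
    · rw [norm_mul, norm_unitExp, mul_one, Complex.norm_real, Real.norm_eq_abs, abs_mul, abs_mul,
        mul_assoc]
    · exact (hasSum_triple (h₁ α hα) (h₂ α hα) (h₃ α hα) (hs c₁ hc₁ α) (hs c₂ hc₂ α)
        (hs c₃ hc₃ α)).congr_fun fun m => (e m α).symm
  simp only [intervalIntegral.integral_const_mul, integral_unitExp_int_mul] at hbig
  -- Integration over α kills every triple off the plane m₁ + m₂ + m₃ = 0, which g parametrizes.
  let g : ℤ × ℤ → ℤ × ℤ × ℤ := fun m => (m.1, m.2, -m.1 - m.2)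
  have hg : Function.Injective g := by
    intro x y hxy
    simp only [g, Prod.mk.injEq] at hxy
    exact Prod.ext hxy.1 hxy.2.1
  refine ((hg.hasSum_iff (fun m hm => ?_)).mpr hbig).congr_fun fun m => ?_
  · rw [if_neg, mul_zero]
    intro h0
    exact hm ⟨(m.1, m.2.1), Prod.ext rfl (Prod.ext rfl (by dsimp [g]; omega))⟩
  · simp [g]

theorem abs_integral_triple_le {A₁ A₂ A₃ : ℤ → ℝ → ℝ} {b₁ b₂ b₃ : ℤ → ℝ}
    (bd₁ : ∀ k, ∀ α ∈ Set.Icc (0 : ℝ) 1, |A₁ k α| ≤ b₁ k)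
    (bd₂ : ∀ k, ∀ α ∈ Set.Icc (0 : ℝ) 1, |A₂ k α| ≤ b₂ k)
    (bd₃ : ∀ k, ∀ α ∈ Set.Icc (0 : ℝ) 1, |A₃ k α| ≤ b₃ k) (k : ℤ × ℤ × ℤ) :
    (∀ α ∈ Set.Icc (0 : ℝ) 1, |A₁ k.1 α * (A₂ k.2.1 α * A₃ k.2.2 α)| ≤
      |b₁ k.1| * (|b₂ k.2.1| * |b₃ k.2.2|)) ∧
    |∫ α in (0 : ℝ)..1, A₁ k.1 α * (A₂ k.2.1 α * A₃ k.2.2 α)| ≤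
      |b₁ k.1| * (|b₂ k.2.1| * |b₃ k.2.2|) := by
  have h : ∀ α ∈ Set.Icc (0 : ℝ) 1, |A₁ k.1 α * (A₂ k.2.1 α * A₃ k.2.2 α)| ≤
      |b₁ k.1| * (|b₂ k.2.1| * |b₃ k.2.2|) := by
    intro α hα
    rw [abs_mul, abs_mul]
    have h1 := (bd₁ k.1 α hα).trans (le_abs_self _)
    have h2 := (bd₂ k.2.1 α hα).trans (le_abs_self _)
    have h3 := (bd₃ k.2.2 α hα).trans (le_abs_self _)
    gcongr
  refine ⟨h, ?_⟩
  have := intervalIntegral.norm_integral_le_of_norm_le_const (a := (0 : ℝ)) (b := 1)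
    (C := |b₁ k.1| * (|b₂ k.2.1| * |b₃ k.2.2|))
    (f := fun α => A₁ k.1 α * (A₂ k.2.1 α * A₃ k.2.2 α)) (fun α hα => by
      rw [Set.uIoc_of_le zero_le_one] at hα
      exact h α (Set.Ioc_subset_Icc_self hα))
  simpa using this

/-- Because n₁ + n₂ + n₃ = 0, α disappears from the product of the three phases, leaving a character
of τ with frequency -(n₁k₁ + n₂k₂ + n₃k₃). -/
theorem hasSum_integral_of_periodization {n₁ n₂ n₃ : ℤ} (hn : n₁ + n₂ + n₃ = 0)
    {A₁ A₂ A₃ : ℤ → ℝ → ℝ} {b₁ b₂ b₃ : ℤ → ℝ}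
    (hA₁ : ∀ k, Continuous (A₁ k)) (hA₂ : ∀ k, Continuous (A₂ k)) (hA₃ : ∀ k, Continuous (A₃ k))
    (hb₁ : Summable b₁) (hb₂ : Summable b₂) (hb₃ : Summable b₃)
    (bd₁ : ∀ k, ∀ α ∈ Set.Icc (0 : ℝ) 1, |A₁ k α| ≤ b₁ k)
    (bd₂ : ∀ k, ∀ α ∈ Set.Icc (0 : ℝ) 1, |A₂ k α| ≤ b₂ k)
    (bd₃ : ∀ k, ∀ α ∈ Set.Icc (0 : ℝ) 1, |A₃ k α| ≤ b₃ k) (τ : ℝ) {D₁ D₂ D₃ : ℝ → ℂ}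
    (h₁ : ∀ α ∈ Set.Icc (0 : ℝ) 1,
      HasSum (fun k : ℤ => (A₁ k α : ℂ) * unitExp (-((α + k) * (n₁ * τ)))) (D₁ α))
    (h₂ : ∀ α ∈ Set.Icc (0 : ℝ) 1,
      HasSum (fun k : ℤ => (A₂ k α : ℂ) * unitExp (-((α + k) * (n₂ * τ)))) (D₂ α))
    (h₃ : ∀ α ∈ Set.Icc (0 : ℝ) 1,
      HasSum (fun k : ℤ => (A₃ k α : ℂ) * unitExp (-((α + k) * (n₃ * τ)))) (D₃ α)) :
    HasSum (fun k : ℤ × ℤ × ℤ =>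
      unitExp (((-(n₁ * k.1 + n₂ * k.2.1 + n₃ * k.2.2) : ℤ) : ℝ) * τ) *
        ((∫ α in (0 : ℝ)..1, A₁ k.1 α * (A₂ k.2.1 α * A₃ k.2.2 α) : ℝ) : ℂ))
      (∫ α in (0 : ℝ)..1, D₁ α * (D₂ α * D₃ α)) := by
  have hs : ∀ (n : ℤ) (A : ℤ → ℝ → ℝ) (b : ℤ → ℝ), Summable b →
      (∀ k, ∀ α ∈ Set.Icc (0 : ℝ) 1, |A k α| ≤ b k) → ∀ α ∈ Set.Icc (0 : ℝ) 1,
      Summable fun k : ℤ => ‖(A k α : ℂ) * unitExp (-((α + k) * (n * τ)))‖ := by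
    intro n A b hb hbd α hα
    refine Summable.of_nonneg_of_le (fun k => norm_nonneg _) (fun k => ?_) hb
    rw [norm_mul, norm_unitExp, mul_one, Complex.norm_real]
    exact hbd k α hα
  have hexp : ∀ (k : ℤ × ℤ × ℤ) (α : ℝ),
      ((A₁ k.1 α : ℂ) * unitExp (-((α + k.1) * (n₁ * τ)))) *
      (((A₂ k.2.1 α : ℂ) * unitExp (-((α + k.2.1) * (n₂ * τ)))) *
        ((A₃ k.2.2 α : ℂ) * unitExp (-((α + k.2.2) * (n₃ * τ)))))
      = unitExp (((-(n₁ * k.1 + n₂ * k.2.1 + n₃ * k.2.2) : ℤ) : ℝ) * τ) *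
        ((A₁ k.1 α * (A₂ k.2.1 α * A₃ k.2.2 α) : ℝ) : ℂ) := by
    intro k α
    have hn' : (n₃ : ℝ) = -n₁ - n₂ := by
      have : n₃ = -n₁ - n₂ := by omega
      rw [this]; push_cast; ring
    have : (((-(n₁ * k.1 + n₂ * k.2.1 + n₃ * k.2.2) : ℤ) : ℝ) * τ) =
        -((α + k.1) * (n₁ * τ)) + (-((α + k.2.1) * (n₂ * τ)) + -((α + k.2.2) * (n₃ * τ))) := by
      push_cast; rw [hn']; ring
    rw [this, unitExp_add, unitExp_add]; push_cast; ring
  have hcA : ∀ k : ℤ × ℤ × ℤ, Continuous fun α => A₁ k.1 α * (A₂ k.2.1 α * A₃ k.2.2 α) :=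
    fun k => (hA₁ _).mul ((hA₂ _).mul (hA₃ _))
  have hbig : HasSum (fun k : ℤ × ℤ × ℤ => ∫ α in (0 : ℝ)..1,
      unitExp (((-(n₁ * k.1 + n₂ * k.2.1 + n₃ * k.2.2) : ℤ) : ℝ) * τ) *
        ((A₁ k.1 α * (A₂ k.2.1 α * A₃ k.2.2 α) : ℝ) : ℂ))
      (∫ α in (0 : ℝ)..1, D₁ α * (D₂ α * D₃ α)) := by
    refine hasSum_intervalIntegral
      (fun k => continuous_const.mul (Complex.continuous_ofReal.comp (hcA k)))
      (summable_triple hb₁ hb₂ hb₃) (fun k α hα => ?_) fun α hα => ?_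
    · rw [norm_mul, norm_unitExp, one_mul, Complex.norm_real]
      exact (abs_integral_triple_le bd₁ bd₂ bd₃ k).1 α hα
    · exact (hasSum_triple (h₁ α hα) (h₂ α hα) (h₃ α hα) (hs n₁ A₁ b₁ hb₁ bd₁ α hα)
        (hs n₂ A₂ b₂ hb₂ bd₂ α hα) (hs n₃ A₃ b₃ hb₃ bd₃ α hα)).congr_fun
          fun k => (hexp k α).symm
  refine hbig.congr_fun fun k => ?_
  rw [intervalIntegral.integral_const_mul, intervalIntegral.integral_ofReal]

/-- If the sums of a family of nonnegative functions have a bounded expansion `J`, then they can be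
integrated termwise. -/
theorem hasSum_intervalIntegral_of_nonneg {ι : Type*} [Countable ι] {F : ι → ℝ → ℝ} {J : ℝ → ℝ}
    {B : ℝ} (hcont : ∀ i, Continuous (F i)) (hnn : ∀ i t, 0 ≤ F i t)
    (hJ : ∀ t, HasSum (fun i => F i t) (J t)) (hB : ∀ t, J t ≤ B) :
    HasSum (fun i => ∫ t in (0 : ℝ)..1, F i t) (∫ t in (0 : ℝ)..1, J t) := by
  have hsum : Summable fun i => ∫ t in (0 : ℝ)..1, F i t := by
    refine summable_of_sum_le (c := B)
      (fun i => intervalIntegral.integral_nonneg zero_le_one fun t _ => hnn i t) fun s => ?_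
    rw [← intervalIntegral.integral_finsetSum fun i _ => (hcont i).intervalIntegrable _ _]
    have h1 : ∫ t in (0 : ℝ)..1, ∑ i ∈ s, F i t ≤ ∫ _ in (0 : ℝ)..1, B := by
      refine intervalIntegral.integral_mono_on zero_le_one
        ((continuous_finsetSum _ fun i _ => hcont i).intervalIntegrable _ _)
        intervalIntegrable_const fun t _ => ?_
      exact (sum_le_hasSum s (fun i _ => hnn i t) (hJ t)).trans (hB t)
    simpa using h1
  have h2 := hasSum_integral_of_summable_integral_norm
    (μ := volume.restrict (Set.Ioc (0 : ℝ) 1)) (F := F)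
    (fun i => (intervalIntegrable_iff_integrableOn_Ioc_of_le zero_le_one).mp
      ((hcont i).intervalIntegrable _ _))
    (by
      refine hsum.congr fun i => ?_
      rw [intervalIntegral.integral_of_le zero_le_one]
      simp only [Real.norm_of_nonneg (hnn i _)])
  simp only [intervalIntegral.integral_of_le zero_le_one (μ := volume)]
  have e : (fun t => ∑' i, F i t) = J := funext fun t => (hJ t).tsum_eq
  rwa [e] at h2

/-- For each τ the number ∫ D₁D₂D₃ dα has two expansions. The dual one is dominated uniformly in τ;
this bound, with nonnegativity, justifies integrating the other one termwise too. Integration over τ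
retains the dual terms of frequency zero. -/
theorem TwistedExpansion.exists_hasSum_constraint {n₁ n₂ n₃ : ℤ} (hn : n₁ + n₂ + n₃ = 0)
    {c₁ c₂ c₃ A₁ A₂ A₃ : ℤ → ℝ → ℝ} (h₁ : TwistedExpansion n₁ c₁ A₁)
    (h₂ : TwistedExpansion n₂ c₂ A₂) (h₃ : TwistedExpansion n₃ c₃ A₃) :
    ∃ S : ℝ,
      HasSum (fun m : ℤ × ℤ => ∫ τ in (0 : ℝ)..1, c₁ m.1 τ * c₂ m.2 τ * c₃ (-m.1 - m.2) τ) S ∧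
      HasSum (fun k : ℤ × ℤ × ℤ => if n₁ * k.1 + n₂ * k.2.1 + n₃ * k.2.2 = 0 then
        ∫ α in (0 : ℝ)..1, A₁ k.1 α * (A₂ k.2.1 α * A₃ k.2.2 α) else 0) S := by
  obtain ⟨b₁, hb₁, bd₁⟩ := h₁.exists_bound
  obtain ⟨b₂, hb₂, bd₂⟩ := h₂.exists_bound
  obtain ⟨b₃, hb₃, bd₃⟩ := h₃.exists_bound
  have hBs := summable_triple hb₁ hb₂ hb₃
  set B : ℤ × ℤ × ℤ → ℝ := fun k => |b₁ k.1| * (|b₂ k.2.1| * |b₃ k.2.2|) with hB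
  have hIB := fun k => (abs_integral_triple_le bd₁ bd₂ bd₃ k).2
  set I : ℤ × ℤ × ℤ → ℝ := fun k => ∫ α in (0 : ℝ)..1, A₁ k.1 α * (A₂ k.2.1 α * A₃ k.2.2 α) with hI
  have key : ∀ τ : ℝ, ∃ J : ℂ,
      HasSum (fun m : ℤ × ℤ => ((c₁ m.1 τ * c₂ m.2 τ * c₃ (-m.1 - m.2) τ : ℝ) : ℂ)) J ∧
      HasSum (fun k : ℤ × ℤ × ℤ =>
        unitExp (((-(n₁ * k.1 + n₂ * k.2.1 + n₃ * k.2.2) : ℤ) : ℝ) * τ) * (I k : ℂ)) J := by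
    intro τ
    have hD : ∀ (n : ℤ) (c A : ℤ → ℝ → ℝ), TwistedExpansion n c A → ∃ D : ℝ → ℂ,
        (∀ α ∈ Set.Icc (0 : ℝ) 1, HasSum (fun m : ℤ => (c m τ : ℂ) * unitExp (m * α)) (D α)) ∧
        ∀ α ∈ Set.Icc (0 : ℝ) 1,
          HasSum (fun k : ℤ => (A k α : ℂ) * unitExp (-((α + k) * (n * τ)))) (D α) := by
      intro n c A h
      refine ⟨fun α => ∑' m : ℤ, (c m τ : ℂ) * unitExp (m * α), fun α hα => ?_, fun α hα => ?_⟩ <;>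
        obtain ⟨D, hD1, hD2⟩ := h.exists_hasSum τ α hα
      · exact hD1.summable.hasSum
      · beta_reduce
        rwa [hD1.tsum_eq]
    obtain ⟨D₁, hc₁, hA₁⟩ := hD _ _ _ h₁
    obtain ⟨D₂, hc₂, hA₂⟩ := hD _ _ _ h₂
    obtain ⟨D₃, hc₃, hA₃⟩ := hD _ _ _ h₃
    exact ⟨_, hasSum_constraint_of_fourier (h₁.summable_coeff τ) (h₂.summable_coeff τ)
        (h₃.summable_coeff τ) hc₁ hc₂ hc₃,
      hasSum_integral_of_periodization hn h₁.continuous_term h₂.continuous_term h₃.continuous_term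
        hb₁ hb₂ hb₃ bd₁ bd₂ bd₃ τ hA₁ hA₂ hA₃⟩
  choose J hJm hJk using key
  have hJre : ∀ τ, HasSum (fun m : ℤ × ℤ => c₁ m.1 τ * c₂ m.2 τ * c₃ (-m.1 - m.2) τ) (J τ).re :=
    fun τ => by simpa using Complex.hasSum_re (hJm τ)
  have hJof : ∀ τ, J τ = ((J τ).re : ℂ) := fun τ =>
    (hJm τ).unique (Complex.hasSum_ofReal.mpr (hJre τ))
  have hJB : ∀ τ, (J τ).re ≤ ∑' k, B k := by
    intro τ
    refine (Complex.re_le_norm _).trans ?_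
    rw [← (hJk τ).tsum_eq]
    refine tsum_of_norm_bounded hBs.hasSum fun k => ?_
    rw [norm_mul, norm_unitExp, one_mul, Complex.norm_real]
    exact hIB k
  have hk := hasSum_intervalIntegral
    (F := fun (k : ℤ × ℤ × ℤ) τ =>
      unitExp (((-(n₁ * k.1 + n₂ * k.2.1 + n₃ * k.2.2) : ℤ) : ℝ) * τ) * (I k : ℂ))
    (f := J) (b := B) (fun k => by fun_prop) hBs
    (fun k τ _ => by
      rw [norm_mul, norm_unitExp, one_mul, Complex.norm_real]; exact hIB k)
    (fun τ _ => hJk τ)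
  have hJint : ∫ τ in (0 : ℝ)..1, J τ = ((∫ τ in (0 : ℝ)..1, (J τ).re : ℝ) : ℂ) := by
    rw [← intervalIntegral.integral_ofReal]
    exact intervalIntegral.integral_congr fun τ _ => hJof τ
  refine ⟨∫ τ in (0 : ℝ)..1, (J τ).re, ?_, ?_⟩
  · exact hasSum_intervalIntegral_of_nonneg
      (F := fun (m : ℤ × ℤ) τ => c₁ m.1 τ * c₂ m.2 τ * c₃ (-m.1 - m.2) τ)
      (fun m => ((h₁.continuous_coeff _).mul (h₂.continuous_coeff _)).mul (h₃.continuous_coeff _))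
      (fun m τ => mul_nonneg (mul_nonneg (h₁.coeff_nonneg _ _) (h₂.coeff_nonneg _ _))
        (h₃.coeff_nonneg _ _)) hJre hJB
  · rw [hJint] at hk
    refine Complex.hasSum_ofReal.mp (hk.congr_fun fun k => ?_)
    rw [intervalIntegral.integral_mul_const, integral_unitExp_int_mul]
    simp only [neg_eq_zero]
    split_ifs <;> simp [hI]


/-! ### Poisson summation for the kernel, and the Bernoulli case n = 0. -/

theorem summable_exp_neg_mul_abs_intCast {c : ℝ} (hc : 0 < c) :
    Summable fun k : ℤ => Real.exp (-(c * |(k : ℝ)|)) := by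
  have h : Summable fun n : ℕ => Real.exp (n * (-c)) :=
    Real.summable_exp_nat_mul_iff.mpr (by linarith)
  refine Summable.of_nat_of_neg (h.congr fun n => ?_) (h.congr fun n => ?_)
  · rw [Int.cast_natCast, abs_of_nonneg (Nat.cast_nonneg n)]; ring_nf
  · rw [Int.cast_neg, abs_neg, Int.cast_natCast, abs_of_nonneg (Nat.cast_nonneg n)]; ring_nf

theorem abs_intCast_sub_one_le {α : ℝ} (hα : α ∈ Set.Icc (0 : ℝ) 1) (k : ℤ) :
    |(k : ℝ)| - 1 ≤ |α + k| := by
  have h1 : |(k : ℝ)| ≤ |α + k| + |α| := by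
    have := abs_sub (α + k) α
    rwa [add_sub_cancel_left] at this
  rw [abs_of_nonneg hα.1] at h1
  linarith [hα.2]

theorem summable_inv_add_sq_add (x : ℝ) {Y : ℝ} (hY : 0 < Y) (a : ℕ) :
    Summable fun m : ℤ => ((Y + (m + x) ^ 2)⁻¹) ^ (a + 1) := by
  have h0 : Summable fun m : ℤ => 1 / |(m : ℝ) + 1 / 2| ^ (2 : ℝ) :=
    (Real.summable_one_div_int_add_rpow (1 / 2) 2).mpr (by norm_num)
  -- The comparison is with m + 1/2, which never vanishes, and (m + 1/2)² ≤ 2(m + x)² + 2(1/2 - x)²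
  -- ≤ K(Y + (m + x)²).
  set K : ℝ := 2 + 2 * (1 / 2 - x) ^ 2 / Y with hK
  have h1 := (h0.mul_left K).mul_left ((Y⁻¹) ^ a)
  refine Summable.of_nonneg_of_le (fun m => by positivity) (fun m => ?_) h1
  have hm : (m : ℝ) + 1 / 2 ≠ 0 := by
    intro h
    have : (2 * m + 1 : ℤ) = 0 := by exact_mod_cast (by linarith : (2 * (m : ℝ) + 1) = 0)
    omega
  rw [pow_succ]
  gcongr
  · nlinarith [sq_nonneg ((m : ℝ) + x)]
  · rw [Real.rpow_two, sq_abs, mul_one_div, inv_le_comm₀ (by positivity) (by positivity), inv_div,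
      div_le_iff₀ (by positivity)]
    have h2 : 2 * (1 / 2 - x) ^ 2 / Y * Y = 2 * (1 / 2 - x) ^ 2 := by field_simp
    have h3 : 0 ≤ 2 * (1 / 2 - x) ^ 2 / Y * ((m : ℝ) + x) ^ 2 := by positivity
    rw [hK]
    nlinarith [sq_nonneg ((m : ℝ) + x - (1 / 2 - x)), hY]

/-- Poisson summation for the resolvent kernel with a phase. -/
theorem hasSum_poisson_resolventKernel (a : ℕ) {x : ℝ} (hx : 0 < x) (t α : ℝ) :
    HasSum (fun m : ℤ => ((((x + (m + t) ^ 2)⁻¹) ^ (a + 1) : ℝ) : ℂ) * unitExp (m * α))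
      (∑' k : ℤ, (resolventKernel a x (α + k) : ℂ) * unitExp (-((α + k) * t))) := by
  set f : ℝ → ℂ := fun s => (resolventKernel a x s : ℂ) * unitExp (-(s * t)) with hf
  have hfc : Continuous f := by
    have := continuous_resolventKernel a x
    fun_prop
  obtain ⟨C, hC, hbd⟩ := exists_abs_resolventKernel_le a
  have hdecay : f =O[cocompact ℝ] fun s => |s| ^ (-2 : ℝ) := by
    have h1 : f =O[cocompact ℝ] fun s => Real.exp (-(Real.pi * √x) * |s|) := by
      refine Asymptotics.IsBigO.of_bound (C / √x ^ (2 * a + 1)) (Eventually.of_forall fun s => ?_)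
      rw [hf, norm_mul, norm_unitExp, mul_one, Complex.norm_real, Real.norm_eq_abs, Real.norm_eq_abs,
        Real.abs_exp]
      refine (hbd x s hx).trans_eq ?_
      ring_nf
    have hpos : 0 < Real.pi * √x := by positivity
    exact h1.trans ((isLittleO_exp_neg_mul_rpow_atTop hpos (-2)).isBigO.comp_tendsto
      tendsto_norm_cocompact_atTop)
  have hF : ∀ ξ : ℝ, FourierTransform.fourier f ξ =
      ((((x + (ξ + t) ^ 2)⁻¹) ^ (a + 1) : ℝ) : ℂ) := by
    intro ξ
    rw [Real.fourier_real_eq_integral_exp_smul, ← integral_resolventKernel_smul_cexp a hx]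
    refine integral_congr_ae (Eventually.of_forall fun s => ?_)
    simp only [hf, unitExp, smul_eq_mul, Complex.real_smul]
    rw [mul_left_comm, ← Complex.exp_add]
    congr 2
    push_cast
    ring
  have hS := summable_inv_add_sq_add t hx a
  have hFs : Summable fun m : ℤ => FourierTransform.fourier f (m : ℝ) := by
    refine (Complex.ofRealCLM.summable hS).congr fun m => ?_
    rw [hF]; rfl
  have hP := Real.tsum_eq_tsum_fourier_of_rpow_decay_of_summable hfc one_lt_two hdecay hFs α
  have e : ∀ m : ℤ, FourierTransform.fourier f (m : ℝ) * (fourier m (α : UnitAddCircle)) =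
      ((((x + (m + t) ^ 2)⁻¹) ^ (a + 1) : ℝ) : ℂ) * unitExp (m * α) := by
    intro m
    rw [hF, fourier_coe_apply, unitExp]
    congr 2
    push_cast
    ring
  simp only [e] at hP
  rw [hP]
  refine Summable.hasSum (Summable.of_norm ?_)
  refine hS.norm.congr fun m => ?_
  rw [norm_mul, norm_unitExp, mul_one, Complex.norm_real]

theorem twistedExpansion_resolventKernel (a : ℕ) {n : ℤ} (hn : n ≠ 0) {y : ℝ} (hy : 0 < y) :
    TwistedExpansion n (fun m τ => (((n : ℝ) ^ 2 * y ^ 2 + (m + n * τ) ^ 2)⁻¹) ^ (a + 1))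
      (fun k α => resolventKernel a ((n : ℝ) ^ 2 * y ^ 2) (α + k)) := by
  have hx : 0 < (n : ℝ) ^ 2 * y ^ 2 := by
    have : (n : ℝ) ≠ 0 := by exact_mod_cast hn
    positivity
  have hbound : ∃ b : ℤ → ℝ, Summable b ∧ ∀ k : ℤ, ∀ α ∈ Set.Icc (0 : ℝ) 1,
      |resolventKernel a ((n : ℝ) ^ 2 * y ^ 2) (α + k)| ≤ b k := by
    obtain ⟨C, hC, hbd⟩ := exists_abs_resolventKernel_le a
    set x := (n : ℝ) ^ 2 * y ^ 2
    have hpos : 0 < Real.pi * √x := by positivity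
    -- The factor exp(π√x) compensates for |α + k| ≥ |k| - 1.
    refine ⟨fun k => C / √x ^ (2 * a + 1) *
      (Real.exp (Real.pi * √x) * Real.exp (-(Real.pi * √x * |(k : ℝ)|))),
      ((summable_exp_neg_mul_abs_intCast hpos).mul_left _).mul_left _, fun k α hα => ?_⟩
    refine (hbd x _ hx).trans ?_
    beta_reduce
    rw [← Real.exp_add]
    gcongr
    nlinarith [abs_intCast_sub_one_le hα k]
  refine ⟨fun m => ?_, fun m τ => by positivity, fun τ => summable_inv_add_sq_add _ hx a,
    fun k => (continuous_resolventKernel a _).comp (by fun_prop), hbound, fun τ α hα => ?_⟩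
  · refine Continuous.pow (Continuous.inv₀ (by fun_prop) fun τ => ?_) _
    positivity
  · refine ⟨_, hasSum_poisson_resolventKernel a hx (n * τ) α, Summable.hasSum (Summable.of_norm ?_)⟩
    obtain ⟨b, hb, hbd⟩ := hbound
    refine Summable.of_nonneg_of_le (fun k => norm_nonneg _) (fun k => ?_) hb
    rw [norm_mul, norm_unitExp, mul_one, Complex.norm_real]
    exact hbd k α hα

/-- The polynomial which on `[0, 1]` has the Fourier coefficients `m⁻¹ ^ (2 * a + 2)`, `m ≠ 0`. -/
noncomputable def powerSumPoly (a : ℕ) : Polynomial ℝ :=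
  Polynomial.C ((-1) ^ a * (2 * Real.pi) ^ (2 * a + 2) / (2 * a + 2).factorial) *
    (Polynomial.bernoulli (2 * a + 2)).map (algebraMap ℚ ℝ)

theorem eval_powerSumPoly (a : ℕ) (α : ℝ) : (powerSumPoly a).eval α =
    (-1) ^ a * (2 * Real.pi) ^ (2 * a + 2) / (2 * a + 2).factorial * bernoulliFun (2 * a + 2) α := by
  simp [powerSumPoly, bernoulliFun]

theorem eval_powerSumPoly_one_sub (a : ℕ) (α : ℝ) :
    (powerSumPoly a).eval (1 - α) = (powerSumPoly a).eval α := by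
  rw [eval_powerSumPoly, eval_powerSumPoly, bernoulliFun_eval_one_sub,
    Even.neg_one_pow (n := 2 * a + 2) ⟨a + 1, by ring⟩, one_mul]

theorem natDegree_powerSumPoly_le (a : ℕ) : (powerSumPoly a).natDegree ≤ 2 * a + 2 := by
  refine (Polynomial.natDegree_C_mul_le _ _).trans (Polynomial.natDegree_map_le.trans ?_)
  refine Polynomial.natDegree_le_iff_coeff_eq_zero.mpr fun i hi => ?_
  rw [Polynomial.coeff_bernoulli, if_neg (by omega)]

/-- The only odd power of α in an even Bernoulli polynomial is the one carrying B₁ = -1/2, and it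
produces the finite part kernel. -/
theorem coeff_powerSumPoly (a : ℕ) (s : ℝ) :
    (powerSumPoly a).coeff (2 * a + 1) * |s| ^ (2 * a + 1) = powerKernel a s := by
  rw [powerSumPoly, Polynomial.coeff_C_mul, Polynomial.coeff_map, Polynomial.coeff_bernoulli,
    if_pos (by omega), show 2 * a + 2 - (2 * a + 1) = 1 by omega, bernoulli_one, powerKernel,
    Nat.choose_succ_self_right, eq_ratCast, Nat.factorial_succ (2 * a + 1)]
  have : ((2 * a + 1).factorial : ℝ) ≠ 0 := by positivity
  have : ((2 * a + 1 : ℕ) : ℝ) + 1 ≠ 0 := by positivity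
  push_cast
  push_cast at this
  field_simp
  ring

/-- For n = 0 nothing depends on τ and the periodization has the single term k = 0. The coefficient
at m = 0 is 0 by the convention for inverses, as it should be since the pair (0, 0) is excluded. -/
theorem twistedExpansion_powerSumPoly (a : ℕ) :
    TwistedExpansion 0 (fun m _ => (((m : ℝ) ^ 2)⁻¹) ^ (a + 1))
      (fun k α => if k = 0 then (powerSumPoly a).eval α else 0) := by
  have hsum : Summable fun m : ℤ => (((m : ℝ) ^ 2)⁻¹) ^ (a + 1) := by
    refine (Real.summable_one_div_int_pow (p := 2 * (a + 1)).mpr (by omega)).congr fun m => ?_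
    rw [pow_mul, one_div, inv_pow]
  refine ⟨fun m => continuous_const, fun m τ => by positivity, fun _ => hsum, fun k => ?_, ?_,
    fun τ α hα => ?_⟩
  · split_ifs
    · exact Polynomial.continuous _
    · exact continuous_const
  · obtain ⟨C, hC⟩ := isCompact_Icc.exists_bound_of_continuousOn (s := Set.Icc (0 : ℝ) 1)
      (f := fun α => (powerSumPoly a).eval α) (Polynomial.continuous _).continuousOn
    refine ⟨fun k => if k = 0 then C else 0, ?_, fun k α hα => ?_⟩
    · exact (hasSum_ite_eq 0 C).summable
    · by_cases hk : k = 0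
      · simpa [hk] using hC α hα
      · simp [hk]
  · refine ⟨((powerSumPoly a).eval α : ℝ), ?_, ?_⟩
    · have h := hasSum_one_div_pow_mul_fourier_mul_bernoulliFun (k := 2 * a + 2) (by omega) hα
      have e : (-(2 * Real.pi * Complex.I) ^ (2 * a + 2) / (2 * a + 2).factorial *
          (bernoulliFun (2 * a + 2) α : ℂ) : ℂ) = ((powerSumPoly a).eval α : ℝ) := by
        rw [eval_powerSumPoly, mul_pow, show (2 * a + 2) = 2 * (a + 1) by ring,
          pow_mul Complex.I, Complex.I_sq, pow_succ (-1 : ℂ)]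
        push_cast
        ring
      rw [e] at h
      refine h.congr_fun fun m => ?_
      rw [fourier_coe_apply, unitExp]
      congr 1
      · push_cast
        rw [show 2 * a + 2 = 2 * (a + 1) by ring, pow_mul, one_div, inv_pow]
      · congr 1
        push_cast
        ring
    · refine (hasSum_ite_eq (0 : ℤ) (((powerSumPoly a).eval α : ℝ) : ℂ)).congr_fun fun k => ?_
      by_cases hk : k = 0 <;> simp [hk, unitExp_zero]


/-! ### Laurent expansions uniform over a family, and the mode sums. -/

/-- A family of functions of `y ≥ 1` which are polynomials in `y⁻¹` of degree at most `N + 1` up to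
exponentially small errors, everything being summable over the family. The coefficient of
`y⁻¹ ^ N` is `L`. -/
def UniformLaurent {ι : Type*} (N : ℕ) (S : ι → ℝ → ℝ) (L : ι → ℝ) : Prop :=
  ∃ (B : ℕ → ι → ℝ) (E : ι → ℝ) (δ : ℝ), 0 < δ ∧ (∀ j, Summable (B j)) ∧ Summable E ∧ B N = L ∧
    ∀ y, 1 ≤ y → ∀ i,
      |S i y - ∑ j ∈ Finset.range (N + 2), B j i * y⁻¹ ^ j| ≤ E i * Real.exp (-(δ * y))

namespace UniformLaurent

variable {ι κ : Type*} {N : ℕ} {S T : ι → ℝ → ℝ} {L M : ι → ℝ}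

theorem summable_coeff (h : UniformLaurent N S L) : Summable L := by
  obtain ⟨B, E, δ, -, hB, -, rfl, -⟩ := h
  exact hB N

theorem add (h : UniformLaurent N S L) (h' : UniformLaurent N T M) :
    UniformLaurent N (fun i y => S i y + T i y) (fun i => L i + M i) := by
  obtain ⟨B, E, δ, hδ, hB, hE, rfl, hb⟩ := h
  obtain ⟨B', E', δ', hδ', hB', hE', rfl, hb'⟩ := h'
  refine ⟨fun j i => B j i + B' j i, fun i => |E i| + |E' i|, min δ δ', lt_min hδ hδ',
    fun j => (hB j).add (hB' j), hE.abs.add hE'.abs, rfl, fun y hy i => ?_⟩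
  have e : S i y + T i y - ∑ j ∈ Finset.range (N + 2), (B j i + B' j i) * y⁻¹ ^ j
      = (S i y - ∑ j ∈ Finset.range (N + 2), B j i * y⁻¹ ^ j)
        + (T i y - ∑ j ∈ Finset.range (N + 2), B' j i * y⁻¹ ^ j) := by
    simp only [add_mul, Finset.sum_add_distrib]; ring
  rw [e, add_mul]
  have hle : ∀ d, min δ δ' ≤ d → Real.exp (-(d * y)) ≤ Real.exp (-(min δ δ' * y)) := by
    intro d hd
    gcongr
  refine (abs_add_le _ _).trans (add_le_add ((hb y hy i).trans ?_) ((hb' y hy i).trans ?_))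
  · exact mul_le_mul (le_abs_self _) (hle _ (min_le_left _ _)) (Real.exp_nonneg _) (abs_nonneg _)
  · exact mul_le_mul (le_abs_self _) (hle _ (min_le_right _ _)) (Real.exp_nonneg _) (abs_nonneg _)

/-- Extension by zero carries the families of degenerate triples, indexed by a point or by ℤ, to the
common index set ℤ × ℤ. -/
theorem of_injective (h : UniformLaurent N S L) {g : ι → κ} (hg : Function.Injective g)
    {S' : κ → ℝ → ℝ} {L' : κ → ℝ} (hS : ∀ i y, 1 ≤ y → S' (g i) y = S i y)
    (hS0 : ∀ k ∉ Set.range g, ∀ y, 1 ≤ y → S' k y = 0) (hL : ∀ i, L' (g i) = L i)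
    (hL0 : ∀ k ∉ Set.range g, L' k = 0) : UniformLaurent N S' L' := by
  obtain ⟨B, E, δ, hδ, hB, hE, rfl, hb⟩ := h
  have key : ∀ f : ι → ℝ, Summable f → Summable (Function.extend g f 0) := by
    intro f hf
    refine (hg.summable_iff fun k hk => ?_).mp ?_
    · exact Function.extend_apply' _ _ _ hk
    · rwa [Function.extend_comp hg]
  refine ⟨fun j => Function.extend g (B j) 0, Function.extend g E 0, δ, hδ, fun j => key _ (hB j),
    key _ hE, funext fun k => ?_, fun y hy k => ?_⟩
  · by_cases hk : k ∈ Set.range g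
    · obtain ⟨i, rfl⟩ := hk
      rw [hL]
      exact hg.extend_apply _ _ _
    · beta_reduce
      rw [Function.extend_apply' _ _ _ hk, hL0 k hk]; rfl
  · by_cases hk : k ∈ Set.range g
    · obtain ⟨i, rfl⟩ := hk
      simp only [hg.extend_apply]
      rw [hS i y hy]
      exact hb y hy i
    · simp only [Function.extend_apply' _ _ _ hk, hS0 k hk y hy]
      simp

theorem exists_tsum (h : UniformLaurent N S L) : ∃ (β : ℕ → ℝ) (K δ : ℝ), 0 < δ ∧
    β N = ∑' i, L i ∧ ∀ y, 1 ≤ y → Summable (fun i => S i y) ∧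
      |∑' i, S i y - ∑ j ∈ Finset.range (N + 2), β j * y⁻¹ ^ j| ≤ K * Real.exp (-(δ * y)) := by
  obtain ⟨B, E, δ, hδ, hB, hE, rfl, hb⟩ := h
  refine ⟨fun j => ∑' i, B j i, ∑' i, E i, δ, hδ, rfl, fun y hy => ?_⟩
  have hmain : HasSum (fun i => ∑ j ∈ Finset.range (N + 2), B j i * y⁻¹ ^ j)
      (∑ j ∈ Finset.range (N + 2), (∑' i, B j i) * y⁻¹ ^ j) :=
    hasSum_sum fun j _ => (hB j).hasSum.mul_right _
  have herr := hE.hasSum.mul_right (Real.exp (-(δ * y)))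
  have hd : Summable fun i => S i y - ∑ j ∈ Finset.range (N + 2), B j i * y⁻¹ ^ j :=
    Summable.of_norm_bounded herr.summable (hb y hy)
  have hS : Summable fun i => S i y := by
    refine (hd.add hmain.summable).congr fun i => ?_
    ring
  refine ⟨hS, ?_⟩
  rw [← (hS.hasSum.sub hmain).tsum_eq]
  exact tsum_of_norm_bounded herr fun i => (Real.norm_eq_abs _).trans_le (hb y hy i)

end UniformLaurent

/-- The Fourier coefficients in `α` on the side of the lattice sum. -/
noncomputable def latticeTerm (a : ℕ) (n : ℤ) (y : ℝ) (m : ℤ) (τ : ℝ) : ℝ :=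
  (((n : ℝ) ^ 2 * y ^ 2 + (m + n * τ) ^ 2)⁻¹) ^ (a + 1)

/-- The terms of the dual sum. -/
noncomputable def dualTerm (a : ℕ) (n : ℤ) (y : ℝ) (k : ℤ) (α : ℝ) : ℝ :=
  if n = 0 then (if k = 0 then (powerSumPoly a).eval α else 0)
  else resolventKernel a ((n : ℝ) ^ 2 * y ^ 2) (α + k)

theorem twistedExpansion_latticeTerm (a : ℕ) (n : ℤ) {y : ℝ} (hy : 0 < y) :
    TwistedExpansion n (latticeTerm a n y) (dualTerm a n y) := by
  by_cases hn : n = 0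
  · subst hn
    have h₁ : latticeTerm a 0 y = fun (m : ℤ) _ => (((m : ℝ) ^ 2)⁻¹) ^ (a + 1) := by
      ext m τ; simp [latticeTerm]
    have h₂ : dualTerm a 0 y = fun k α => if k = 0 then (powerSumPoly a).eval α else 0 := by
      ext k α; simp [dualTerm]
    rw [h₁, h₂]
    exact twistedExpansion_powerSumPoly a
  · have h₂ : dualTerm a n y = fun (k : ℤ) α => resolventKernel a ((n : ℝ) ^ 2 * y ^ 2) (α + k) := by
      ext k α; simp [dualTerm, hn]
    rw [h₂]
    exact twistedExpansion_resolventKernel a hn hy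

/-- A summand of the dual sum. -/
noncomputable def dualSummand (a b c : ℕ) (n₁ n₂ n₃ : ℤ) (y : ℝ) (k : ℤ × ℤ × ℤ) : ℝ :=
  if n₁ * k.1 + n₂ * k.2.1 + n₃ * k.2.2 = 0 then
    ∫ α in (0 : ℝ)..1, dualTerm a n₁ y k.1 α * (dualTerm b n₂ y k.2.1 α * dualTerm c n₃ y k.2.2 α)
  else 0

/-- The contribution of a triple `(n₁, n₂, n₃)` to the constant mode, up to normalization. -/
noncomputable def modeSum (a b c : ℕ) (n₁ n₂ n₃ : ℤ) (y : ℝ) : ℝ :=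
  ∑' k, dualSummand a b c n₁ n₂ n₃ y k

theorem hasSum_latticeTerm (a b c : ℕ) {n₁ n₂ n₃ : ℤ} (hn : n₁ + n₂ + n₃ = 0) {y : ℝ}
    (hy : 0 < y) :
    HasSum (fun m : ℤ × ℤ => ∫ τ in (0 : ℝ)..1, latticeTerm a n₁ y m.1 τ * latticeTerm b n₂ y m.2 τ
      * latticeTerm c n₃ y (-m.1 - m.2) τ) (modeSum a b c n₁ n₂ n₃ y) ∧
    HasSum (dualSummand a b c n₁ n₂ n₃ y) (modeSum a b c n₁ n₂ n₃ y) := by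
  obtain ⟨S, h₁, h₂⟩ := TwistedExpansion.exists_hasSum_constraint hn
    (twistedExpansion_latticeTerm a n₁ hy) (twistedExpansion_latticeTerm b n₂ hy)
    (twistedExpansion_latticeTerm c n₃ hy)
  have h₃ : HasSum (dualSummand a b c n₁ n₂ n₃ y) S := h₂
  have e : modeSum a b c n₁ n₂ n₃ y = S := h₃.tsum_eq
  rw [e]
  exact ⟨h₁, h₃⟩

/-- With the swaps, only triples whose vanishing entry is the third need to be analysed. -/
theorem modeSum_swap₂₃ (a b c : ℕ) (n₁ n₂ n₃ : ℤ) (y : ℝ) :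
    modeSum a b c n₁ n₂ n₃ y = modeSum a c b n₁ n₃ n₂ y := by
  unfold modeSum
  rw [← ((Equiv.refl ℤ).prodCongr (Equiv.prodComm ℤ ℤ)).tsum_eq]
  refine tsum_congr fun k => ?_
  simp only [dualSummand, Equiv.prodCongr_apply, Equiv.coe_refl, Prod.map_fst, Prod.map_snd, id,
    Equiv.coe_prodComm, Prod.fst_swap, Prod.snd_swap]
  rw [show n₁ * k.1 + n₂ * k.2.2 + n₃ * k.2.1 = n₁ * k.1 + n₃ * k.2.1 + n₂ * k.2.2 by ring]
  simp only [mul_comm (dualTerm b n₂ y k.2.2 _)]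

theorem modeSum_swap₁₃ (a b c : ℕ) (n₁ n₂ n₃ : ℤ) (y : ℝ) :
    modeSum a b c n₁ n₂ n₃ y = modeSum c b a n₃ n₂ n₁ y := by
  unfold modeSum
  let e : ℤ × ℤ × ℤ ≃ ℤ × ℤ × ℤ :=
    ⟨fun k => (k.2.2, k.2.1, k.1), fun k => (k.2.2, k.2.1, k.1), fun _ => rfl, fun _ => rfl⟩
  rw [← e.tsum_eq]
  refine tsum_congr fun k => ?_
  simp only [dualSummand, e, Equiv.coe_fn_mk]
  rw [show n₁ * k.2.2 + n₂ * k.2.1 + n₃ * k.1 = n₃ * k.1 + n₂ * k.2.1 + n₁ * k.2.2 by ring]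
  congr 1
  refine intervalIntegral.integral_congr fun α _ => ?_
  ring

/-- All three factors are Bernoulli polynomials, independent of y, so the contribution sits at y⁰
and misses the power N. -/
theorem uniformLaurent_modeSum_zero (a b c N : ℕ) (hN : 0 < N) :
    UniformLaurent N (fun _ : Unit => modeSum a b c 0 0 0) 0 := by
  refine ⟨fun j _ => if j = 0 then modeSum a b c 0 0 0 0 else 0, 0, 1, one_pos,
    fun j => (hasSum_fintype _).summable, summable_zero, funext fun _ => if_neg hN.ne',
    fun y _ _ => ?_⟩
  have e : modeSum a b c 0 0 0 y = modeSum a b c 0 0 0 0 := by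
    simp [modeSum, dualSummand, dualTerm]
  simp [e, ite_mul]


/-! ### Triples (n, -n, 0). -/

theorem integrable_resolventKernel_mul_mul_abs_pow (a b : ℕ) {x₁ x₂ : ℝ} (h₁ : 0 < x₁)
    (h₂ : 0 < x₂) (i : ℕ) :
    Integrable fun s => resolventKernel a x₁ s * (resolventKernel b x₂ s * |s| ^ i) := by
  obtain ⟨K, hK⟩ := exists_abs_kernelZ_mul_pow_le b h₂ i
  simp only [kernelZ_natCast] at hK
  have := integrable_resolventKernel_smul a h₁
    (w := fun s => resolventKernel b x₂ s * |s| ^ i)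
    (((continuous_resolventKernel b x₂).mul (by fun_prop))) hK
  simpa using this

theorem integral_resolventKernel_mul_mul_abs_pow_scale (a b : ℕ) (x₁ x₂ : ℝ) (i : ℕ) {Y : ℝ}
    (hY : 0 < Y) :
    ∫ s, resolventKernel a (x₁ * Y ^ 2) s * (resolventKernel b (x₂ * Y ^ 2) s * |s| ^ i) =
      Y⁻¹ ^ (2 * a + 2 * b + 3 + i) *
        ∫ s, resolventKernel a x₁ s * (resolventKernel b x₂ s * |s| ^ i) := by
  have e : ∀ s, resolventKernel a (x₁ * Y ^ 2) s * (resolventKernel b (x₂ * Y ^ 2) s * |s| ^ i)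
      = Y⁻¹ ^ (2 * a + 2 * b + 2 + i) * (resolventKernel a x₁ (Y * s) *
        (resolventKernel b x₂ (Y * s) * |Y * s| ^ i)) := by
    intro s
    rw [resolventKernel_scale a hY, resolventKernel_scale b hY, abs_mul, abs_of_pos hY, mul_pow]
    have : Y⁻¹ ^ (2 * a + 2 * b + 2 + i) * Y ^ i = Y⁻¹ ^ (2 * a + 1) * Y⁻¹ ^ (2 * b + 1) := by
      rw [pow_add _ _ i, mul_assoc, ← mul_pow, inv_mul_cancel₀ hY.ne', one_pow]; ring
    linear_combination (- (resolventKernel a x₁ (Y * s) * resolventKernel b x₂ (Y * s) * |s| ^ i))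
      * this
  simp only [e]
  rw [integral_const_mul, Measure.integral_comp_mul_left
    (fun s => resolventKernel a x₁ s * (resolventKernel b x₂ s * |s| ^ i)), abs_of_pos
    (inv_pos.mpr hY), smul_eq_mul]
  ring

/-- The resonance condition reduces to k₁ = k₂, and the Bernoulli factor lives at k₃ = 0. -/
theorem dualSummand_opposite (a b c : ℕ) {n : ℤ} (hn : n ≠ 0) (y : ℝ) (k : ℤ × ℤ × ℤ) :
    dualSummand a b c n (-n) 0 y k = if k.1 = k.2.1 ∧ k.2.2 = 0 then
      ∫ α in (0 : ℝ)..1, resolventKernel a ((n : ℝ) ^ 2 * y ^ 2) (α + k.1) *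
        (resolventKernel b ((n : ℝ) ^ 2 * y ^ 2) (α + k.1) * (powerSumPoly c).eval α) else 0 := by
  have h1 : n * k.1 + -n * k.2.1 + 0 * k.2.2 = 0 ↔ k.1 = k.2.1 := by
    rw [show n * k.1 + -n * k.2.1 + 0 * k.2.2 = n * (k.1 - k.2.1) by ring, mul_eq_zero, sub_eq_zero]
    tauto
  simp only [dualSummand, dualTerm, h1, hn, neg_eq_zero, if_false, if_true]
  by_cases h : k.1 = k.2.1 <;> by_cases h' : k.2.2 = 0 <;> simp [h, h']

theorem exists_abs_eval_powerSumPoly_sub_le (c : ℕ) : ∃ C : ℝ, 0 < C ∧ ∀ α ∈ Set.Icc (0 : ℝ) 1,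
    ∀ s : ℝ, 1 ≤ |s| → |(powerSumPoly c).eval α - (powerSumPoly c).eval (|s|)| ≤ C * Real.exp |s| := by
  obtain ⟨C, hC, h⟩ := (powerSumPoly c).exists_abs_eval_le_exp
  refine ⟨2 * C, by positivity, fun α hα s hs => ?_⟩
  have h1 := h α hα.1
  have h2 := h |s| (abs_nonneg s)
  have h3 : Real.exp α ≤ Real.exp |s| := Real.exp_le_exp.mpr (hα.2.trans hs)
  have h4 := abs_sub (((powerSumPoly c).eval α)) ((powerSumPoly c).eval |s|)
  nlinarith

theorem one_le_abs_add_intCast {α : ℝ} (hα : α ∈ Set.Icc (0 : ℝ) 1) {k : ℤ} (h0 : k ≠ 0)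
    (h1 : k ≠ -1) : 1 ≤ |α + k| := by
  rcases lt_or_gt_of_ne h0 with h | h
  · have : (k : ℝ) ≤ -2 := by exact_mod_cast (by omega : k ≤ -2)
    rw [abs_of_nonpos (by linarith [hα.2])]
    linarith [hα.2]
  · have : (1 : ℝ) ≤ k := by exact_mod_cast h
    rw [abs_of_nonneg (by linarith [hα.1])]
    linarith [hα.1]

/-- Replacing P(α) by P(|α + k|) is exact for k = 0, and also for k = -1 by the symmetry of P under
α ↦ 1 - α. For any other k, |α + k| ≥ 1 and the kernels decay at a rate proportional to |n| y. -/
theorem exists_abs_degenerate_error_le (a b c : ℕ) : ∃ C : ℝ, 0 < C ∧ ∀ (n : ℤ), n ≠ 0 →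
    ∀ y : ℝ, 1 ≤ y → ∀ k : ℤ,
    |∫ α in (0 : ℝ)..1, resolventKernel a ((n : ℝ) ^ 2 * y ^ 2) (α + k) *
        (resolventKernel b ((n : ℝ) ^ 2 * y ^ 2) (α + k) *
          ((powerSumPoly c).eval α - (powerSumPoly c).eval |α + k|))| ≤
      C * Real.exp (-(1 * |(n : ℝ)|)) * Real.exp (-(1 * |(k : ℝ)|)) * Real.exp (-(1 * y)) := by
  obtain ⟨Ca, hCa, ha⟩ := exists_abs_resolventKernel_le a
  obtain ⟨Cb, hCb, hb⟩ := exists_abs_resolventKernel_le b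
  obtain ⟨Cc, hCc, hc⟩ := exists_abs_eval_powerSumPoly_sub_le c
  refine ⟨Ca * (Cb * Cc) * Real.exp 2, by positivity, fun n hn y hy k => ?_⟩
  have hn1 : (1 : ℝ) ≤ |(n : ℝ)| := by
    rw [← Int.cast_abs]; exact_mod_cast Int.one_le_abs hn
  have hx : (n : ℝ) ^ 2 * y ^ 2 = (|(n : ℝ)| * y) ^ 2 := by rw [mul_pow, sq_abs]
  set Y := |(n : ℝ)| * y with hY
  have hY1 : 1 ≤ Y := by nlinarith
  -- Both factors of Y are at least 1, so decay in Y splits into decay in n and decay in y.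
  have hYn : |(n : ℝ)| + y ≤ 2 * Y := by nlinarith
  have hk : ∀ α ∈ Set.Icc (0 : ℝ) 1, |resolventKernel a ((n : ℝ) ^ 2 * y ^ 2) (α + k) *
        (resolventKernel b ((n : ℝ) ^ 2 * y ^ 2) (α + k) *
          ((powerSumPoly c).eval α - (powerSumPoly c).eval |α + k|))| ≤
      Ca * (Cb * Cc) * Real.exp 2 *
        Real.exp (-(1 * |(n : ℝ)|)) * Real.exp (-(1 * |(k : ℝ)|)) * Real.exp (-(1 * y)) := by
    intro α hα
    have hzero : (k = 0 ∨ k = -1) →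
        (powerSumPoly c).eval α - (powerSumPoly c).eval |α + k| = 0 := by
      rintro (rfl | rfl)
      · simp [abs_of_nonneg hα.1]
      · have : |α + ((-1 : ℤ) : ℝ)| = 1 - α := by
          push_cast
          rw [abs_of_nonpos (by linarith [hα.2])]; ring
        rw [this, eval_powerSumPoly_one_sub, sub_self]
    by_cases h01 : k = 0 ∨ k = -1
    · rw [hzero h01, mul_zero, mul_zero, abs_zero]
      positivity
    · have hs1 : 1 ≤ |α + k| := one_le_abs_add_intCast hα (by tauto) (by tauto)
      have hsk := abs_intCast_sub_one_le hα k
      set s := α + (k : ℝ) with hs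
      have hsq : √(Y ^ 2) = Y := Real.sqrt_sq (by positivity)
      have hu : ∀ (d : ℕ) (D : ℝ), 0 < D → (∀ x s : ℝ, 0 < x → |resolventKernel d x s| ≤
          D / √x ^ (2 * d + 1) * Real.exp (-(Real.pi * (√x * |s|)))) →
          |resolventKernel d (Y ^ 2) s| ≤ D * Real.exp (-(3 * (Y * |s|))) := by
        intro d D hD hd
        refine (hd (Y ^ 2) s (by positivity)).trans ?_
        rw [hsq]
        have hYs : 0 ≤ Y * |s| := by positivity
        gcongr
        · exact div_le_self hD.le (one_le_pow₀ hY1)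
        · exact Real.pi_gt_three.le
      rw [hx, abs_mul, abs_mul]
      have e : Ca * (Cb * Cc) * Real.exp 2 * Real.exp (-(1 * |(n : ℝ)|)) *
          Real.exp (-(1 * |(k : ℝ)|)) * Real.exp (-(1 * y)) =
          Ca * (Cb * Cc) * Real.exp (2 - |(n : ℝ)| - |(k : ℝ)| - y) := by
        rw [show (2 - |(n : ℝ)| - |(k : ℝ)| - y) = 2 + -(1 * |(n : ℝ)|) + -(1 * |(k : ℝ)|)
          + -(1 * y) by ring, Real.exp_add, Real.exp_add, Real.exp_add]
        ring
      rw [e]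
      calc _ ≤ Ca * Real.exp (-(3 * (Y * |s|))) * (Cb * Real.exp (-(3 * (Y * |s|))) *
            (Cc * Real.exp |s|)) := by
            gcongr
            · exact hu a Ca hCa ha
            · exact hu b Cb hCb hb
            · exact hc α hα s hs1
        _ = Ca * (Cb * Cc) * Real.exp (-(3 * (Y * |s|)) + -(3 * (Y * |s|)) + |s|) := by
            rw [Real.exp_add, Real.exp_add]; ring
        _ ≤ _ := by
            gcongr
            nlinarith [mul_le_mul hY1 hs1 zero_le_one (by positivity),
              mul_nonneg (sub_nonneg.mpr hY1) (sub_nonneg.mpr hs1)]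
  have h := intervalIntegral.norm_integral_le_of_norm_le_const (a := (0 : ℝ)) (b := 1)
    (f := fun α => resolventKernel a ((n : ℝ) ^ 2 * y ^ 2) (α + k) *
        (resolventKernel b ((n : ℝ) ^ 2 * y ^ 2) (α + k) *
          ((powerSumPoly c).eval α - (powerSumPoly c).eval |α + k|))) fun α hα => by
      rw [Set.uIoc_of_le zero_le_one] at hα
      exact hk α (Set.Ioc_subset_Icc_self hα)
  simpa using h

theorem hasSum_dualSummand_opposite (a b c : ℕ) {n : ℤ} (hn : n ≠ 0) {y : ℝ} (hy : 0 < y) :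
    HasSum (fun k : ℤ => ∫ α in (0 : ℝ)..1, resolventKernel a ((n : ℝ) ^ 2 * y ^ 2) (α + k) *
      (resolventKernel b ((n : ℝ) ^ 2 * y ^ 2) (α + k) * (powerSumPoly c).eval α))
      (modeSum a b c n (-n) 0 y) := by
  have h := (hasSum_latticeTerm a b c (n₁ := n) (n₂ := -n) (n₃ := 0) (by ring) hy).2
  let g : ℤ → ℤ × ℤ × ℤ := fun k => (k, k, 0)
  have hg : Function.Injective g := fun x y hxy => congrArg Prod.fst hxy
  refine ((hg.hasSum_iff fun k hk => ?_).mpr h).congr_fun fun k => ?_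
  · rw [dualSummand_opposite a b c hn, if_neg]
    rintro ⟨h1, h2⟩
    exact hk ⟨k.1, Prod.ext rfl (Prod.ext h1 h2.symm)⟩
  · simp [g, dualSummand_opposite a b c hn]

/-- The integrals which give the Laurent polynomial of the degenerate contributions. -/
noncomputable def kernelMoment (a b i : ℕ) : ℝ :=
  ∫ s, resolventKernel a 1 s * (resolventKernel b 1 s * |s| ^ i)

theorem degenerateIntegral_eq_kernelMoment (a b c : ℕ) {n : ℤ} (hn : n ≠ 0) :
    degenerateIntegral ((n : ℝ) ^ 2) (((-n : ℤ) : ℝ) ^ 2) a b c =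
      (powerSumPoly c).coeff (2 * c + 1) * kernelMoment a b (2 * c + 1) *
        |(n : ℝ)|⁻¹ ^ (2 * a + 2 * b + 3 + (2 * c + 1)) := by
  have hn1 : 0 < |(n : ℝ)| := abs_pos.mpr (by exact_mod_cast hn)
  have h := integral_resolventKernel_mul_mul_abs_pow_scale a b 1 1 (2 * c + 1) hn1
  rw [one_mul, sq_abs] at h
  rw [kernelMoment, mul_assoc, mul_comm (∫ s, _), ← h, ← integral_const_mul, degenerateIntegral,
    kernelIntegral]
  congr 1
  ext s
  rw [kernelZ_natCast, kernelZ_natCast, powerKernelZ, intExt_natCast, ← coeff_powerSumPoly]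
  push_cast
  rw [neg_sq]
  ring

theorem integral_resolventKernel_mul_mul_eval (a b : ℕ) (P : Polynomial ℝ) {d : ℕ}
    (hd : P.natDegree < d) {Y : ℝ} (hY : 0 < Y) :
    Integrable (fun s => resolventKernel a (Y ^ 2) s *
      (resolventKernel b (Y ^ 2) s * P.eval |s|)) ∧
    ∫ s, resolventKernel a (Y ^ 2) s * (resolventKernel b (Y ^ 2) s * P.eval |s|) =
      ∑ i ∈ Finset.range d, P.coeff i * kernelMoment a b i * Y⁻¹ ^ (2 * a + 2 * b + 3 + i) := by
  have hx : 0 < Y ^ 2 := by positivity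
  have e : ∀ s : ℝ, resolventKernel a (Y ^ 2) s * (resolventKernel b (Y ^ 2) s * P.eval |s|) =
      ∑ i ∈ Finset.range d, P.coeff i *
        (resolventKernel a (Y ^ 2) s * (resolventKernel b (Y ^ 2) s * |s| ^ i)) := by
    intro s
    rw [Polynomial.eval_eq_sum_range' hd, Finset.mul_sum, Finset.mul_sum]
    exact Finset.sum_congr rfl fun i _ => by ring
  simp only [e]
  have hi := fun i (_ : i ∈ Finset.range d) =>
    (integrable_resolventKernel_mul_mul_abs_pow a b hx hx i).const_mul (P.coeff i)
  refine ⟨integrable_finsetSum _ hi, ?_⟩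
  rw [integral_finsetSum _ hi]
  refine Finset.sum_congr rfl fun i _ => ?_
  have h := integral_resolventKernel_mul_mul_abs_pow_scale a b 1 1 i hY
  rw [one_mul] at h
  rw [integral_const_mul, h, kernelMoment]
  ring

/-- With P(|α + k|) in place of P(α), the sum over k unfolds to an integral over ℝ, which by scaling
is a polynomial in (|n| y)⁻¹. Its exponents are D + i for a power |s|^i, and i = 2c + 1 gives the
coefficient sought. -/
theorem uniformLaurent_modeSum_opposite (a b c : ℕ) :
    UniformLaurent (2 * (a + b + c) + 4) (fun (n : ℤ) y => if n = 0 then 0 else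
        modeSum a b c n (-n) 0 y)
      (fun n => if n = 0 then 0 else
        degenerateIntegral ((n : ℝ) ^ 2) (((-n : ℤ) : ℝ) ^ 2) a b c) := by
  obtain ⟨C, hC, herr⟩ := exists_abs_degenerate_error_le a b c
  set D := 2 * a + 2 * b + 3 with hD
  set p : ℕ → ℝ := fun i => (powerSumPoly c).coeff i * kernelMoment a b i with hp
  have hsk := summable_exp_neg_mul_abs_intCast one_pos
  -- At n = 0 these coefficients vanish automatically, as j ≥ D ≥ 3 and the inverse of 0 is 0.
  refine ⟨fun j n => if D ≤ j then p (j - D) * |(n : ℝ)|⁻¹ ^ j else 0,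
    fun n => ∑' k : ℤ, C * Real.exp (-(1 * |(n : ℝ)|)) * Real.exp (-(1 * |(k : ℝ)|)),
    1, one_pos, fun j => ?_, ?_, ?_, fun y hy n => ?_⟩
  · by_cases hj : D ≤ j
    · simp only [if_pos hj]
      refine Summable.mul_left _ ?_
      have := (Real.summable_one_div_int_pow (p := j).mpr (by omega)).abs
      refine this.congr fun n => ?_
      rw [abs_div, abs_pow, abs_one, one_div, inv_pow]
    · simp only [if_neg hj]
      exact summable_zero
  · simp only [tsum_mul_left]
    exact (hsk.mul_left C).mul_right _
  · ext n
    beta_reduce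
    rw [if_pos (by omega)]
    by_cases hn : n = 0
    · simp [hn]
    · rw [if_neg hn, degenerateIntegral_eq_kernelMoment a b c hn]
      have e1 : 2 * (a + b + c) + 4 - D = 2 * c + 1 := by omega
      have e2 : 2 * (a + b + c) + 4 = D + (2 * c + 1) := by omega
      rw [e1, e2]
  · have hsum : ∑ j ∈ Finset.range (2 * (a + b + c) + 4 + 2),
        (if D ≤ j then p (j - D) * |(n : ℝ)|⁻¹ ^ j else 0) * y⁻¹ ^ j =
        ∑ i ∈ Finset.range (2 * c + 3), p i * (|(n : ℝ)| * y)⁻¹ ^ (D + i) := by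
      -- The Bernoulli polynomial has degree at most 2c + 2, hence the one power beyond N that the
      -- expansion must allow.
      rw [show 2 * (a + b + c) + 4 + 2 = D + (2 * c + 3) by omega, Finset.sum_range_add,
        Finset.sum_eq_zero (s := Finset.range D), zero_add]
      · refine Finset.sum_congr rfl fun i _ => ?_
        rw [if_pos (by omega), Nat.add_sub_cancel_left, mul_inv, mul_pow, mul_assoc]
      · intro j hj
        rw [if_neg (by simpa using hj), zero_mul]
    rw [hsum]
    by_cases hn : n = 0
    · have : ∀ i, (0 : ℝ) ^ (D + i) = 0 := fun i => zero_pow (by omega)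
      simp only [hn, if_true, Int.cast_zero, abs_zero, zero_mul, inv_zero, this, mul_zero,
        Finset.sum_const_zero, sub_zero]
      have : 0 ≤ ∑' k : ℤ, C * Real.exp (-(1 * 0)) * Real.exp (-(1 * |(k : ℝ)|)) :=
        tsum_nonneg fun k => by positivity
      positivity
    · have hn1 : 0 < |(n : ℝ)| := abs_pos.mpr (by exact_mod_cast hn)
      have hy0 : 0 < y := by linarith
      have hY : 0 < |(n : ℝ)| * y := by positivity
      have hx : (n : ℝ) ^ 2 * y ^ 2 = (|(n : ℝ)| * y) ^ 2 := by rw [mul_pow, sq_abs]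
      have hdeg : (powerSumPoly c).natDegree < 2 * c + 3 :=
        (natDegree_powerSumPoly_le c).trans_lt (by omega)
      obtain ⟨hint, hval⟩ := integral_resolventKernel_mul_mul_eval a b (powerSumPoly c) hdeg hY
      beta_reduce
      rw [if_neg hn]
      change |_ - ∑ i ∈ Finset.range (2 * c + 3), (powerSumPoly c).coeff i * kernelMoment a b i *
        (|(n : ℝ)| * y)⁻¹ ^ (2 * a + 2 * b + 3 + i)| ≤ _
      rw [← hval, ← hx]
      rw [← hx] at hint
      have hdiff := (hasSum_dualSummand_opposite a b c hn hy0).sub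
        hint.hasSum_intervalIntegral_comp_add_int
      rw [← hdiff.tsum_eq]
      have hR := ((hsk.mul_left (C * Real.exp (-(1 * |(n : ℝ)|)))).hasSum.mul_right
        (Real.exp (-(1 * y))))
      refine (Real.norm_eq_abs _).symm.trans_le (tsum_of_norm_bounded hR fun k => ?_)
      refine le_of_eq_of_le ?_ (herr n hn y hy k)
      have ca := continuous_resolventKernel a ((n : ℝ) ^ 2 * y ^ 2)
      have cb := continuous_resolventKernel b ((n : ℝ) ^ 2 * y ^ 2)
      have cP := (powerSumPoly c).continuous
      rw [Real.norm_eq_abs, ← intervalIntegral.integral_sub]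
      · congr 1
        refine intervalIntegral.integral_congr fun α _ => ?_
        ring
      · exact Continuous.intervalIntegrable (by fun_prop) _ _
      · refine Continuous.intervalIntegrable ?_ _ _
        exact (ca.comp (by fun_prop)).mul ((cb.comp (by fun_prop)).mul (cP.comp (by fun_prop)))


/-! ### Triples without zero entries. -/

theorem dualSummand_of_ne_zero (a b c : ℕ) {n₁ n₂ n₃ : ℤ} (h₁ : n₁ ≠ 0) (h₂ : n₂ ≠ 0)
    (h₃ : n₃ ≠ 0) (y : ℝ) (k : ℤ × ℤ × ℤ) :
    dualSummand a b c n₁ n₂ n₃ y k = if n₁ * k.1 + n₂ * k.2.1 + n₃ * k.2.2 = 0 then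
      ∫ α in (0 : ℝ)..1, resolventKernel a ((n₁ : ℝ) ^ 2 * y ^ 2) (α + k.1) *
        (resolventKernel b ((n₂ : ℝ) ^ 2 * y ^ 2) (α + k.2.1) *
          resolventKernel c ((n₃ : ℝ) ^ 2 * y ^ 2) (α + k.2.2)) else 0 := by
  simp [dualSummand, dualTerm, h₁, h₂, h₃]

theorem one_le_abs_intCast {n : ℤ} (hn : n ≠ 0) : (1 : ℝ) ≤ |(n : ℝ)| := by
  rw [← Int.cast_abs]; exact_mod_cast Int.one_le_abs hn

theorem one_le_abs_add_abs_of_ne (α : ℝ) {k l : ℤ} (h : k ≠ l) : 1 ≤ |α + k| + |α + l| := by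
  have h1 := one_le_abs_intCast (sub_ne_zero.mpr h)
  have h2 := abs_sub (α + k) (α + l)
  push_cast at h1
  rw [add_sub_add_left_eq_sub] at h2
  linarith

/-- Lower bounds for the exponent of an off-diagonal term. -/
theorem exponent_lower_bounds {n₁ n₂ n₃ : ℤ} (h₁ : n₁ ≠ 0) (h₂ : n₂ ≠ 0) (h₃ : n₃ ≠ 0)
    (hn : n₁ + n₂ + n₃ = 0) {k₁ k₂ k₃ : ℤ} (h₁₂ : k₁ ≠ k₂) (h₁₃ : k₁ ≠ k₃) (h₂₃ : k₂ ≠ k₃)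
    {α : ℝ} (hα : α ∈ Set.Icc (0 : ℝ) 1) :
    1 ≤ |(n₁ : ℝ)| * |α + k₁| + |(n₂ : ℝ)| * |α + k₂| + |(n₃ : ℝ)| * |α + k₃| ∧
    |(k₁ : ℝ)| + |(k₂ : ℝ)| + |(k₃ : ℝ)| - 3 ≤
      |(n₁ : ℝ)| * |α + k₁| + |(n₂ : ℝ)| * |α + k₂| + |(n₃ : ℝ)| * |α + k₃| ∧
    (|(n₁ : ℝ)| + |(n₂ : ℝ)|) / 4 ≤
      |(n₁ : ℝ)| * |α + k₁| + |(n₂ : ℝ)| * |α + k₂| + |(n₃ : ℝ)| * |α + k₃| := by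
  have m₁ := one_le_abs_intCast h₁
  have m₂ := one_le_abs_intCast h₂
  have m₃ := one_le_abs_intCast h₃
  have d₁₂ := one_le_abs_add_abs_of_ne α h₁₂
  have d₁₃ := one_le_abs_add_abs_of_ne α h₁₃
  have d₂₃ := one_le_abs_add_abs_of_ne α h₂₃
  have e₁ := abs_intCast_sub_one_le hα k₁
  have e₂ := abs_intCast_sub_one_le hα k₂
  have e₃ := abs_intCast_sub_one_le hα k₃
  have hn' : (n₁ : ℝ) + n₂ + n₃ = 0 := by exact_mod_cast hn
  have t₁ : |(n₁ : ℝ)| ≤ |(n₂ : ℝ)| + |(n₃ : ℝ)| := by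
    rw [show (n₁ : ℝ) = -(n₂ + n₃) by linarith, abs_neg]; exact abs_add_le _ _
  have t₂ : |(n₂ : ℝ)| ≤ |(n₁ : ℝ)| + |(n₃ : ℝ)| := by
    rw [show (n₂ : ℝ) = -(n₁ + n₃) by linarith, abs_neg]; exact abs_add_le _ _
  generalize |(n₁ : ℝ)| = N₁ at *
  generalize |(n₂ : ℝ)| = N₂ at *
  generalize |(n₃ : ℝ)| = N₃ at *
  have p₁ := abs_nonneg (α + k₁)
  have p₂ := abs_nonneg (α + k₂)
  have p₃ := abs_nonneg (α + k₃)
  generalize |α + k₁| = s₁ at *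
  generalize |α + k₂| = s₂ at *
  generalize |α + k₃| = s₃ at *
  have q₁ : s₁ ≤ N₁ * s₁ := le_mul_of_one_le_left p₁ m₁
  have q₂ : s₂ ≤ N₂ * s₂ := le_mul_of_one_le_left p₂ m₂
  have q₃ : s₃ ≤ N₃ * s₃ := le_mul_of_one_le_left p₃ m₃
  refine ⟨by linarith, by linarith, ?_⟩
  -- At least two of the s_i can be taken to be ≥ 1/2. When the third is one of s₁, s₂, the triangle
  -- inequality bounds its weight by the other two weights.
  rcases le_total (1 / 2) s₁ with c₁ | c₁
  · rcases le_total (1 / 2) s₂ with c₂ | c₂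
    · nlinarith
    · nlinarith
  · nlinarith

theorem abs_resolventKernel_sq_mul_sq_le {d : ℕ} {D : ℝ} (hD : 0 < D)
    (hd : ∀ x s : ℝ, 0 < x → |resolventKernel d x s| ≤
      D / √x ^ (2 * d + 1) * Real.exp (-(Real.pi * (√x * |s|)))) {n : ℤ} (hn : n ≠ 0) {y : ℝ}
    (hy : 1 ≤ y) (s : ℝ) :
    |resolventKernel d ((n : ℝ) ^ 2 * y ^ 2) s| ≤
      D / |(n : ℝ)| * Real.exp (-(3 * y * (|(n : ℝ)| * |s|))) := by
  have hn1 := one_le_abs_intCast hn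
  have hx : (n : ℝ) ^ 2 * y ^ 2 = (|(n : ℝ)| * y) ^ 2 := by rw [mul_pow, sq_abs]
  have hY1 : 1 ≤ |(n : ℝ)| * y := by nlinarith
  rw [hx]
  refine (hd _ s (by positivity)).trans ?_
  rw [Real.sqrt_sq (by positivity),
    show 3 * y * (|(n : ℝ)| * |s|) = 3 * (|(n : ℝ)| * y * |s|) by ring]
  have hYs : 0 ≤ |(n : ℝ)| * y * |s| := by positivity
  gcongr
  · exact (le_mul_of_one_le_right (by positivity) hy).trans (le_self_pow₀ hY1 (by omega))
  · exact Real.pi_gt_three.le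

/-- Off the diagonal the resonance condition forces k₁, k₂, k₃ to be pairwise distinct, so at most
one of the α + k_i can be near 0 and the product of kernels is exponentially small in y, in the n's
and in the k's. -/
theorem exists_abs_offDiagonal_le (a b c : ℕ) : ∃ C : ℝ, 0 < C ∧ ∀ n₁ n₂ n₃ : ℤ, n₁ ≠ 0 →
    n₂ ≠ 0 → n₃ ≠ 0 → n₁ + n₂ + n₃ = 0 → ∀ y : ℝ, 1 ≤ y → ∀ k : ℤ × ℤ × ℤ,
    ¬(k.1 = k.2.1 ∧ k.2.1 = k.2.2) →
    |dualSummand a b c n₁ n₂ n₃ y k| ≤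
      C * (Real.exp (-(1 / 4 * |(n₁ : ℝ)|)) * Real.exp (-(1 / 4 * |(n₂ : ℝ)|))) *
        (|Real.exp (-(1 * |(k.1 : ℝ)|))| *
          (|Real.exp (-(1 * |(k.2.1 : ℝ)|))| * |Real.exp (-(1 * |(k.2.2 : ℝ)|))|)) *
        Real.exp (-(1 * y)) := by
  obtain ⟨Ca, hCa, ha⟩ := exists_abs_resolventKernel_le a
  obtain ⟨Cb, hCb, hb⟩ := exists_abs_resolventKernel_le b
  obtain ⟨Cc, hCc, hc⟩ := exists_abs_resolventKernel_le c
  refine ⟨Ca * (Cb * Cc) * Real.exp 3, by positivity,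
    fun n₁ n₂ n₃ h₁ h₂ h₃ hn y hy ⟨k₁, k₂, k₃⟩ hk => ?_⟩
  rw [dualSummand_of_ne_zero a b c h₁ h₂ h₃]
  simp only [Real.abs_exp]
  dsimp only at hk ⊢
  split_ifs with hc0
  swap
  · rw [abs_zero]; positivity
  have hn₃ : n₃ = -n₁ - n₂ := by omega
  subst hn₃
  -- If two of the k's agree, the condition becomes n_i(k_i - k_j) = 0 for the remaining index i,
  -- and n_i ≠ 0 puts k on the diagonal.
  have c₁₂ : k₁ ≠ k₂ := by
    rintro rfl
    have : (-n₁ - n₂) * (k₃ - k₁) = 0 := by linear_combination hc0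
    rcases mul_eq_zero.mp this with h | h
    · exact h₃ h
    · exact hk ⟨rfl, by omega⟩
  have c₁₃ : k₁ ≠ k₃ := by
    rintro rfl
    have : n₂ * (k₂ - k₁) = 0 := by linear_combination hc0
    rcases mul_eq_zero.mp this with h | h
    · exact h₂ h
    · exact hk ⟨by omega, by omega⟩
  have c₂₃ : k₂ ≠ k₃ := by
    rintro rfl
    have : n₁ * (k₁ - k₂) = 0 := by linear_combination hc0
    rcases mul_eq_zero.mp this with h | h
    · exact h₁ h
    · exact hk ⟨by omega, rfl⟩
  have hpt : ∀ α ∈ Set.Icc (0 : ℝ) 1,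
      |resolventKernel a ((n₁ : ℝ) ^ 2 * y ^ 2) (α + k₁) *
        (resolventKernel b ((n₂ : ℝ) ^ 2 * y ^ 2) (α + k₂) *
          resolventKernel c (((-n₁ - n₂ : ℤ) : ℝ) ^ 2 * y ^ 2) (α + k₃))| ≤
      Ca * (Cb * Cc) * Real.exp 3 *
        (Real.exp (-(1 / 4 * |(n₁ : ℝ)|)) * Real.exp (-(1 / 4 * |(n₂ : ℝ)|))) *
        (Real.exp (-(1 * |(k₁ : ℝ)|)) *
          (Real.exp (-(1 * |(k₂ : ℝ)|)) * Real.exp (-(1 * |(k₃ : ℝ)|)))) *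
        Real.exp (-(1 * y)) := by
    intro α hα
    obtain ⟨X1, X2, X3⟩ := exponent_lower_bounds h₁ h₂ h₃ hn c₁₂ c₁₃ c₂₃ hα
    set X := |(n₁ : ℝ)| * |α + k₁| + |(n₂ : ℝ)| * |α + k₂| +
      |((-n₁ - n₂ : ℤ) : ℝ)| * |α + k₃| with hX
    have hu : ∀ {d : ℕ} {D : ℝ}, 0 < D → (∀ x s : ℝ, 0 < x → |resolventKernel d x s| ≤
        D / √x ^ (2 * d + 1) * Real.exp (-(Real.pi * (√x * |s|)))) → ∀ {n : ℤ}, n ≠ 0 → ∀ s : ℝ,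
        |resolventKernel d ((n : ℝ) ^ 2 * y ^ 2) s| ≤
          D * Real.exp (-(3 * y * (|(n : ℝ)| * |s|))) := fun hD hd n hn s =>
      (abs_resolventKernel_sq_mul_sq_le hD hd hn hy s).trans (mul_le_mul_of_nonneg_right
        (div_le_self hD.le (one_le_abs_intCast hn)) (Real.exp_nonneg _))
    rw [abs_mul, abs_mul]
    calc _ ≤ Ca * Real.exp (-(3 * y * (|(n₁ : ℝ)| * |α + k₁|))) *
          (Cb * Real.exp (-(3 * y * (|(n₂ : ℝ)| * |α + k₂|))) *
          (Cc * Real.exp (-(3 * y * (|((-n₁ - n₂ : ℤ) : ℝ)| * |α + k₃|))))) := by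
          gcongr
          · exact hu hCa ha h₁ _
          · exact hu hCb hb h₂ _
          · exact hu hCc hc h₃ _
      _ = Ca * (Cb * Cc) * Real.exp (-(3 * y * X)) := by
          rw [show -(3 * y * X) = -(3 * y * (|(n₁ : ℝ)| * |α + k₁|)) +
            (-(3 * y * (|(n₂ : ℝ)| * |α + k₂|)) +
              -(3 * y * (|((-n₁ - n₂ : ℤ) : ℝ)| * |α + k₃|))) by rw [hX]; ring,
            Real.exp_add, Real.exp_add]
          ring
      -- The sum of the three lower bounds for X controls 3X, and the surplus 3(y - 1)X controls y;
      -- the constant e³ absorbs the -3 in the second bound.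
      _ ≤ Ca * (Cb * Cc) * Real.exp (3 + (-(1 / 4 * |(n₁ : ℝ)|) + -(1 / 4 * |(n₂ : ℝ)|)) +
          (-(1 * |(k₁ : ℝ)|) + (-(1 * |(k₂ : ℝ)|) + -(1 * |(k₃ : ℝ)|))) + -(1 * y)) := by
          gcongr
          nlinarith [mul_nonneg (sub_nonneg.mpr hy) (sub_nonneg.mpr X1)]
      _ = _ := by simp only [Real.exp_add]; ring
  have h := intervalIntegral.norm_integral_le_of_norm_le_const (a := (0 : ℝ)) (b := 1)
    (f := fun α => resolventKernel a ((n₁ : ℝ) ^ 2 * y ^ 2) (α + k₁) *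
        (resolventKernel b ((n₂ : ℝ) ^ 2 * y ^ 2) (α + k₂) *
          resolventKernel c (((-n₁ - n₂ : ℤ) : ℝ) ^ 2 * y ^ 2) (α + k₃))) fun α hα => by
      rw [Set.uIoc_of_le zero_le_one] at hα
      exact hpt α (Set.Ioc_subset_Icc_self hα)
  simpa using h

theorem integrable_resolventKernel_triple (a b c : ℕ) {x₁ x₂ x₃ : ℝ} (h₁ : 0 < x₁)
    (h₂ : 0 < x₂) (h₃ : 0 < x₃) :
    Integrable fun s => resolventKernel a x₁ s * (resolventKernel b x₂ s * resolventKernel c x₃ s) := by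
  obtain ⟨hc, hb⟩ := isWeight_kernelZ h₃ c
  obtain ⟨K, hK⟩ := hb b x₂ h₂
  simp only [kernelZ_natCast] at hK
  have := integrable_resolventKernel_smul a h₁
    (w := fun s => resolventKernel b x₂ s * resolventKernel c x₃ s)
    ((continuous_resolventKernel b x₂).mul (continuous_resolventKernel c x₃)) hK
  simpa using this

theorem tripleIntegral_natCast (a b c : ℕ) (x₁ x₂ x₃ : ℝ) : tripleIntegral x₁ x₂ x₃ a b c =
    ∫ s, resolventKernel a x₁ s * (resolventKernel b x₂ s * resolventKernel c x₃ s) := by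
  simp only [tripleIntegral, kernelIntegral, kernelZ_natCast]

theorem integral_resolventKernel_triple_scale (a b c : ℕ) (x₁ x₂ x₃ : ℝ) {y : ℝ} (hy : 0 < y) :
    ∫ s, resolventKernel a (x₁ * y ^ 2) s *
        (resolventKernel b (x₂ * y ^ 2) s * resolventKernel c (x₃ * y ^ 2) s) =
      tripleIntegral x₁ x₂ x₃ a b c * y⁻¹ ^ (2 * (a + b + c) + 4) := by
  simp only [resolventKernel_scale _ hy]
  have e : ∀ s, y⁻¹ ^ (2 * a + 1) * resolventKernel a x₁ (y * s) *
      (y⁻¹ ^ (2 * b + 1) * resolventKernel b x₂ (y * s) *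
        (y⁻¹ ^ (2 * c + 1) * resolventKernel c x₃ (y * s))) =
      y⁻¹ ^ (2 * (a + b + c) + 3) * (resolventKernel a x₁ (y * s) *
        (resolventKernel b x₂ (y * s) * resolventKernel c x₃ (y * s))) := fun s => by ring
  simp only [e]
  rw [integral_const_mul, Measure.integral_comp_mul_left
    (fun s => resolventKernel a x₁ s * (resolventKernel b x₂ s * resolventKernel c x₃ s)), abs_of_pos
    (inv_pos.mpr hy), smul_eq_mul, tripleIntegral_natCast]
  ring


/-- The kernel bounds give 1/(N₁N₂N₃(N₁+N₂+N₃)) with N_i = |n_i|. The last two factors dominate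
√(N₁N₂), which yields exponents 3/2 > 1 and so summability over the lattice. -/
theorem exists_abs_tripleIntegral_le (a b c : ℕ) : ∃ C : ℝ, 0 < C ∧ ∀ n₁ n₂ n₃ : ℤ, n₁ ≠ 0 →
    n₂ ≠ 0 → n₃ ≠ 0 → |tripleIntegral ((n₁ : ℝ) ^ 2) ((n₂ : ℝ) ^ 2) ((n₃ : ℝ) ^ 2) a b c| ≤
      C * (1 / |(n₁ : ℝ)| ^ (3 / 2 : ℝ) * (1 / |(n₂ : ℝ)| ^ (3 / 2 : ℝ))) := by
  obtain ⟨Ca, hCa, ha⟩ := exists_abs_resolventKernel_le a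
  obtain ⟨Cb, hCb, hb⟩ := exists_abs_resolventKernel_le b
  obtain ⟨Cc, hCc, hc⟩ := exists_abs_resolventKernel_le c
  refine ⟨Ca * (Cb * Cc) * (2 / 3), by positivity, fun n₁ n₂ n₃ h₁ h₂ h₃ => ?_⟩
  have m₁ := one_le_abs_intCast h₁
  have m₂ := one_le_abs_intCast h₂
  have m₃ := one_le_abs_intCast h₃
  have hu : ∀ {d : ℕ} {D : ℝ}, 0 < D → (∀ x s : ℝ, 0 < x → |resolventKernel d x s| ≤
      D / √x ^ (2 * d + 1) * Real.exp (-(Real.pi * (√x * |s|)))) → ∀ {n : ℤ}, n ≠ 0 → ∀ s : ℝ,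
      |resolventKernel d ((n : ℝ) ^ 2) s| ≤
        D / |(n : ℝ)| * Real.exp (-(3 * (|(n : ℝ)| * |s|))) := by
    intro d D hD hd n hn s
    simpa using abs_resolventKernel_sq_mul_sq_le hD hd hn le_rfl s
  have b₁ := hu hCa ha h₁
  have b₂ := hu hCb hb h₂
  have b₃ := hu hCc hc h₃
  set N₁ := |(n₁ : ℝ)|
  set N₂ := |(n₂ : ℝ)|
  set N₃ := |(n₃ : ℝ)|
  rw [tripleIntegral_natCast]
  have hpos : 0 < 3 * (N₁ + N₂ + N₃) := by positivity
  have hint := (integrable_abs_pow_mul_exp 0 hpos).const_mul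
    (Ca / N₁ * (Cb / N₂ * (Cc / N₃)))
  have hle := norm_integral_le_of_norm_le hint (f := fun s => resolventKernel a ((n₁ : ℝ) ^ 2) s *
    (resolventKernel b ((n₂ : ℝ) ^ 2) s * resolventKernel c ((n₃ : ℝ) ^ 2) s))
    (Eventually.of_forall fun s => by
      rw [Real.norm_eq_abs, abs_mul, abs_mul]
      calc _ ≤ Ca / N₁ * Real.exp (-(3 * (N₁ * |s|))) * (Cb / N₂ * Real.exp (-(3 * (N₂ * |s|))) *
            (Cc / N₃ * Real.exp (-(3 * (N₃ * |s|))))) := by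
            gcongr
            · exact b₁ s
            · exact b₂ s
            · exact b₃ s
        _ = _ := by
            rw [show -(3 * (N₁ + N₂ + N₃) * |s|) = -(3 * (N₁ * |s|)) + (-(3 * (N₂ * |s|)) +
              -(3 * (N₃ * |s|))) by ring, Real.exp_add, Real.exp_add]
            ring)
  rw [integral_const_mul, integral_abs_pow_mul_exp 0 hpos, Real.norm_eq_abs] at hle
  refine hle.trans ?_
  have hr : ∀ {x : ℝ}, 0 < x → x ^ (3 / 2 : ℝ) = x * √x := by
    intro x hx
    rw [Real.sqrt_eq_rpow, show (3 / 2 : ℝ) = 1 + 1 / 2 by norm_num, Real.rpow_add hx,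
      Real.rpow_one]
  have p₁ : 0 < N₁ := by linarith
  have p₂ : 0 < N₂ := by linarith
  have p₃ : 0 < N₃ := by linarith
  rw [hr p₁, hr p₂]
  have hs₁ := Real.sqrt_pos.mpr p₁
  have hs₂ := Real.sqrt_pos.mpr p₂
  have hq : √N₁ * √N₂ ≤ N₃ * (N₁ + N₂ + N₃) := by
    nlinarith [Real.sq_sqrt p₁.le, Real.sq_sqrt p₂.le, sq_nonneg (√N₁ - √N₂)]
  calc Ca / N₁ * (Cb / N₂ * (Cc / N₃)) * (2 * (Nat.factorial 0 : ℝ) /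
        (3 * (N₁ + N₂ + N₃)) ^ (0 + 1))
      = Ca * (Cb * Cc) * (2 / 3) * (1 / (N₁ * N₂) * (1 / (N₃ * (N₁ + N₂ + N₃)))) := by
        simp only [Nat.factorial_zero, Nat.cast_one, zero_add, pow_one]
        field_simp
    _ ≤ Ca * (Cb * Cc) * (2 / 3) * (1 / (N₁ * N₂) * (1 / (√N₁ * √N₂))) := by gcongr
    _ = _ := by field_simp

/-- The diagonal k₁ = k₂ = k₃ always meets the resonance condition; translating [0, 1] by k unfolds
it to the integral over ℝ, a pure power of y. Everything else is off-diagonal error. -/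
theorem abs_modeSum_sub_le (a b c : ℕ) : ∃ K : ℝ, ∀ n₁ n₂ n₃ : ℤ, n₁ ≠ 0 →
    n₂ ≠ 0 → n₃ ≠ 0 → n₁ + n₂ + n₃ = 0 → ∀ y : ℝ, 1 ≤ y →
    |modeSum a b c n₁ n₂ n₃ y - tripleIntegral ((n₁ : ℝ) ^ 2) ((n₂ : ℝ) ^ 2) ((n₃ : ℝ) ^ 2) a b c *
        y⁻¹ ^ (2 * (a + b + c) + 4)| ≤
      K * (Real.exp (-(1 / 4 * |(n₁ : ℝ)|)) * Real.exp (-(1 / 4 * |(n₂ : ℝ)|))) *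
        Real.exp (-(1 * y)) := by
  obtain ⟨C, hC, herr⟩ := exists_abs_offDiagonal_le a b c
  have hsk := summable_exp_neg_mul_abs_intCast one_pos
  have hs3 := (summable_triple hsk hsk hsk).hasSum
  set T := ∑' k : ℤ × ℤ × ℤ, |Real.exp (-(1 * |(k.1 : ℝ)|))| *
    (|Real.exp (-(1 * |(k.2.1 : ℝ)|))| * |Real.exp (-(1 * |(k.2.2 : ℝ)|))|)
  refine ⟨C * T, fun n₁ n₂ n₃ h₁ h₂ h₃ hn y hy => ?_⟩
  have hy0 : 0 < y := by linarith
  have hx : ∀ {n : ℤ}, n ≠ 0 → 0 < (n : ℝ) ^ 2 * y ^ 2 := by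
    intro n hn
    have : (n : ℝ) ≠ 0 := by exact_mod_cast hn
    positivity
  have hD := (integrable_resolventKernel_triple a b c (hx h₁) (hx h₂)
    (hx h₃)).hasSum_intervalIntegral_comp_add_int
  rw [integral_resolventKernel_triple_scale a b c _ _ _ hy0] at hD
  let g : ℤ → ℤ × ℤ × ℤ := fun k => (k, k, k)
  have hg : Function.Injective g := fun x y hxy => congrArg Prod.fst hxy
  have hD' : HasSum (fun k : ℤ × ℤ × ℤ => if k.1 = k.2.1 ∧ k.2.1 = k.2.2 then
      dualSummand a b c n₁ n₂ n₃ y k else 0)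
      (tripleIntegral ((n₁ : ℝ) ^ 2) ((n₂ : ℝ) ^ 2) ((n₃ : ℝ) ^ 2) a b c *
        y⁻¹ ^ (2 * (a + b + c) + 4)) := by
    refine (hg.hasSum_iff fun k hk => if_neg ?_).mp (hD.congr_fun fun k => ?_)
    · rintro ⟨e₁, e₂⟩
      exact hk ⟨k.1, Prod.ext rfl (Prod.ext e₁ (e₁.trans e₂))⟩
    · simp only [Function.comp, g, and_self, if_true]
      rw [dualSummand_of_ne_zero a b c h₁ h₂ h₃, if_pos]
      dsimp only
      linear_combination k * hn
  have hsub := (hasSum_latticeTerm a b c hn hy0).2.sub hD'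
  rw [← hsub.tsum_eq]
  have hR := ((hs3.mul_left (C * (Real.exp (-(1 / 4 * |(n₁ : ℝ)|)) *
    Real.exp (-(1 / 4 * |(n₂ : ℝ)|))))).mul_right (Real.exp (-(1 * y))))
  have hfin := tsum_of_norm_bounded hR (f := fun k => dualSummand a b c n₁ n₂ n₃ y k -
    if k.1 = k.2.1 ∧ k.2.1 = k.2.2 then dualSummand a b c n₁ n₂ n₃ y k else 0) fun k => ?_
  · refine (Real.norm_eq_abs _).symm.trans_le (hfin.trans_eq ?_)
    ring
  · by_cases hk : k.1 = k.2.1 ∧ k.2.1 = k.2.2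
    · rw [if_pos hk, sub_self, norm_zero]; positivity
    · rw [if_neg hk, sub_zero]
      exact herr n₁ n₂ n₃ h₁ h₂ h₃ hn y hy k hk

theorem uniformLaurent_modeSum_nondegenerate (a b c : ℕ) :
    UniformLaurent (2 * (a + b + c) + 4)
      (fun (n : ℤ × ℤ) y => if n.1 = 0 ∨ n.2 = 0 ∨ -n.1 - n.2 = 0 then 0 else
        modeSum a b c n.1 n.2 (-n.1 - n.2) y)
      (fun n => if n.1 = 0 ∨ n.2 = 0 ∨ -n.1 - n.2 = 0 then 0 else
        tripleIntegral ((n.1 : ℝ) ^ 2) ((n.2 : ℝ) ^ 2) (((-n.1 - n.2 : ℤ) : ℝ) ^ 2) a b c) := by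
  obtain ⟨C, hC, hL⟩ := exists_abs_tripleIntegral_le a b c
  obtain ⟨K, hK⟩ := abs_modeSum_sub_le a b c
  set L : ℤ × ℤ → ℝ := fun n => if n.1 = 0 ∨ n.2 = 0 ∨ -n.1 - n.2 = 0 then 0 else
    tripleIntegral ((n.1 : ℝ) ^ 2) ((n.2 : ℝ) ^ 2) (((-n.1 - n.2 : ℤ) : ℝ) ^ 2) a b c with hLdef
  refine ⟨fun j n => if j = 2 * (a + b + c) + 4 then L n else 0,
    fun n => |K * (Real.exp (-(1 / 4 * |(n.1 : ℝ)|)) * Real.exp (-(1 / 4 * |(n.2 : ℝ)|)))|, 1,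
    one_pos, fun j => ?_, ?_, ?_, fun y hy n => ?_⟩
  · by_cases hj : j = 2 * (a + b + c) + 4
    · simp only [if_pos hj]
      have h1 : Summable fun n : ℤ => 1 / |(n : ℝ)| ^ (3 / 2 : ℝ) := by
        simpa using (Real.summable_one_div_int_add_rpow 0 (3 / 2)).mpr (by norm_num)
      have h2 : Summable fun n : ℤ × ℤ => 1 / |(n.1 : ℝ)| ^ (3 / 2 : ℝ) *
          (1 / |(n.2 : ℝ)| ^ (3 / 2 : ℝ)) :=
        summable_mul_of_summable_norm (f := fun n : ℤ => 1 / |(n : ℝ)| ^ (3 / 2 : ℝ))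
          (g := fun n : ℤ => 1 / |(n : ℝ)| ^ (3 / 2 : ℝ)) h1.norm h1.norm
      refine Summable.of_norm_bounded (h2.mul_left C) fun n => ?_
      rw [hLdef, Real.norm_eq_abs]
      beta_reduce
      split_ifs with h
      · rw [abs_zero]; positivity
      · push Not at h
        exact hL _ _ _ h.1 h.2.1 h.2.2
    · simp only [if_neg hj]
      exact summable_zero
  · have h1 := summable_exp_neg_mul_abs_intCast (c := 1 / 4) (by norm_num)
    have h2 : Summable fun n : ℤ × ℤ => Real.exp (-(1 / 4 * |(n.1 : ℝ)|)) *
        Real.exp (-(1 / 4 * |(n.2 : ℝ)|)) :=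
      summable_mul_of_summable_norm (f := fun n : ℤ => Real.exp (-(1 / 4 * |(n : ℝ)|)))
        (g := fun n : ℤ => Real.exp (-(1 / 4 * |(n : ℝ)|))) h1.norm h1.norm
    exact (h2.mul_left K).abs
  · ext n; simp
  · have e : ∑ j ∈ Finset.range (2 * (a + b + c) + 4 + 2),
        (if j = 2 * (a + b + c) + 4 then L n else 0) * y⁻¹ ^ j =
        L n * y⁻¹ ^ (2 * (a + b + c) + 4) := by
      simp only [ite_mul, zero_mul]
      rw [Finset.sum_ite_eq', if_pos (by simp)]
    rw [e, hLdef]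
    beta_reduce
    split_ifs with h
    · rw [zero_mul, sub_zero, abs_zero]; positivity
    · push Not at h
      refine (hK _ _ _ h.1 h.2.1 h.2.2 (by ring) y hy).trans ?_
      gcongr
      exact le_abs_self _

/-- The lattice splits into the origin, the three lines where one entry vanishes (without the
origin), and the rest; the expansions of the five pieces add up. -/
theorem uniformLaurent_modeSum (a b c : ℕ) :
    UniformLaurent (2 * (a + b + c) + 4)
      (fun (n : ℤ × ℤ) y => modeSum a b c n.1 n.2 (-n.1 - n.2) y)
      (fun n => latticeCoeff n.1 n.2 (-n.1 - n.2) a b c) := by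
  have u₀ : UniformLaurent (2 * (a + b + c) + 4)
      (fun (n : ℤ × ℤ) y => if n = 0 then modeSum a b c 0 0 0 y else 0) (fun _ => 0) := by
    refine (uniformLaurent_modeSum_zero a b c _ (by omega)).of_injective (g := fun _ => (0 : ℤ × ℤ))
      (fun _ _ _ => rfl) (fun _ y _ => if_pos rfl) (fun k hk y _ => if_neg ?_) (fun _ => rfl)
      fun _ _ => rfl
    rintro rfl
    exact hk ⟨(), rfl⟩
  have u₃ : UniformLaurent (2 * (a + b + c) + 4)
      (fun (n : ℤ × ℤ) y => if n.2 = -n.1 ∧ n.1 ≠ 0 then modeSum a b c n.1 (-n.1) 0 y else 0)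
      (fun n => if n.2 = -n.1 ∧ n.1 ≠ 0 then
        degenerateIntegral ((n.1 : ℝ) ^ 2) (((-n.1 : ℤ) : ℝ) ^ 2) a b c else 0) := by
    refine (uniformLaurent_modeSum_opposite a b c).of_injective (g := fun n => (n, -n))
      (fun x y h => congrArg Prod.fst h) (fun n y _ => ?_) (fun k hk y _ => if_neg ?_)
      (fun n => ?_) fun k hk => if_neg ?_
    · by_cases h : n = 0 <;> simp [h]
    · exact fun h => hk ⟨k.1, Prod.ext rfl h.1.symm⟩
    · by_cases h : n = 0 <;> simp [h]
    · exact fun h => hk ⟨k.1, Prod.ext rfl h.1.symm⟩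
  have u₂ : UniformLaurent (2 * (a + b + c) + 4)
      (fun (n : ℤ × ℤ) y => if n.2 = 0 ∧ n.1 ≠ 0 then modeSum a c b n.1 (-n.1) 0 y else 0)
      (fun n => if n.2 = 0 ∧ n.1 ≠ 0 then
        degenerateIntegral ((n.1 : ℝ) ^ 2) (((-n.1 : ℤ) : ℝ) ^ 2) a c b else 0) := by
    have h := uniformLaurent_modeSum_opposite a c b
    rw [show a + c + b = a + b + c by ring] at h
    refine h.of_injective (g := fun n => (n, 0))
      (fun x y h => congrArg Prod.fst h) (fun n y _ => ?_) (fun k hk y _ => if_neg ?_)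
      (fun n => ?_) fun k hk => if_neg ?_
    · by_cases h : n = 0 <;> simp [h]
    · exact fun h => hk ⟨k.1, Prod.ext rfl h.1.symm⟩
    · by_cases h : n = 0 <;> simp [h]
    · exact fun h => hk ⟨k.1, Prod.ext rfl h.1.symm⟩
  have u₁ : UniformLaurent (2 * (a + b + c) + 4)
      (fun (n : ℤ × ℤ) y => if n.1 = 0 ∧ n.2 ≠ 0 then modeSum c b a (-n.2) n.2 0 y else 0)
      (fun n => if n.1 = 0 ∧ n.2 ≠ 0 then
        degenerateIntegral (((-n.2 : ℤ) : ℝ) ^ 2) ((n.2 : ℝ) ^ 2) c b a else 0) := by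
    have h := uniformLaurent_modeSum_opposite c b a
    rw [show c + b + a = a + b + c by ring] at h
    refine h.of_injective (g := fun n => (0, -n))
      (fun x y h => neg_injective (congrArg Prod.snd h)) (fun n y _ => ?_)
      (fun k hk y _ => if_neg ?_) (fun n => ?_) fun k hk => if_neg ?_
    · by_cases h : n = 0 <;> simp [h]
    · exact fun h => hk ⟨-k.2, Prod.ext h.1.symm (neg_neg _)⟩
    · by_cases h : n = 0 <;> simp [h]
    · exact fun h => hk ⟨-k.2, Prod.ext h.1.symm (neg_neg _)⟩
  have u := (((u₀.add u₁).add u₂).add u₃).add (uniformLaurent_modeSum_nondegenerate a b c)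
  convert u using 1
  · ext ⟨p, q⟩ y
    dsimp only
    by_cases hp : p = 0
    · by_cases hq : q = 0
      · simp [hp, hq]
      · simp [hp, hq, modeSum_swap₁₃ a b c 0]
    · by_cases hq : q = 0
      · simp [hp, hq, modeSum_swap₂₃ a b c p 0]
      · by_cases hr : q = -p
        · simp [hp, hr]
        · have : ¬ (-p - q = 0) := by omega
          simp [hp, hq, hr, this]
  · ext ⟨p, q⟩
    dsimp only
    unfold latticeCoeff
    by_cases hp : p = 0
    · by_cases hq : q = 0
      · simp [hp, hq]
      · simp [hp, hq]
    · by_cases hq : q = 0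
      · simp [hp, hq]
      · by_cases hr : q = -p
        · simp [hp, hr]
        · have : ¬ (-p - q = 0) := by omega
          simp [hp, hq, hr, this]


/-! ### The constant mode of the modular graph function. -/

theorem sq_norm_add_mul (m n : ℤ) (t y : ℝ) :
    ‖(m : ℂ) + n * ((t : ℂ) + y * Complex.I)‖ ^ 2 = (n : ℝ) ^ 2 * y ^ 2 + (m + n * t) ^ 2 := by
  rw [Complex.sq_norm, Complex.normSq_apply]
  simp
  ring

theorem div_pow_eq_mul_latticeTerm (a : ℕ) (m n : ℤ) (t y : ℝ) :
    (y / (Real.pi * ‖(m : ℂ) + n * ((t : ℂ) + y * Complex.I)‖ ^ 2)) ^ (a + 1) =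
      (y / Real.pi) ^ (a + 1) * latticeTerm a n y m t := by
  rw [sq_norm_add_mul, latticeTerm, div_mul_eq_div_div, div_eq_mul_inv (y / Real.pi), mul_pow]

/-- The full lattice sum as a sum over two independent pairs. -/
noncomputable def graphSummand (a b c : ℕ) (y : ℝ) (q : (ℤ × ℤ) × (ℤ × ℤ)) (t : ℝ) : ℝ :=
  latticeTerm a q.1.1 y q.2.1 t * latticeTerm b q.1.2 y q.2.2 t *
    latticeTerm c (-q.1.1 - q.1.2) y (-q.2.1 - q.2.2) t

theorem latticeTerm_zero_zero (a : ℕ) (y t : ℝ) : latticeTerm a 0 y 0 t = 0 := by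
  simp [latticeTerm]

/-- The third pair is determined by the first two, and a term with a zero pair vanishes by the
convention for inverses, so the exclusion of (0, 0) can be dropped. -/
theorem modularGraphC_eq_tsum (a b c : ℕ) (t y : ℝ) :
    modularGraphC ![a + 1, b + 1, c + 1] (t + y * Complex.I) =
      (y / Real.pi) ^ (a + b + c + 3) * ∑' q, graphSummand a b c y q t := by
  let g : {p : Fin 3 → ℤ × ℤ // (∀ r, p r ≠ 0) ∧ ∑ r, p r = 0} → (ℤ × ℤ) × (ℤ × ℤ) :=
    fun p => (((p.1 0).2, (p.1 1).2), ((p.1 0).1, (p.1 1).1))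
  have hthird : ∀ p : {p : Fin 3 → ℤ × ℤ // (∀ r, p r ≠ 0) ∧ ∑ r, p r = 0},
      p.1 2 = (-(p.1 0).1 - (p.1 1).1, -(p.1 0).2 - (p.1 1).2) := by
    intro p
    have h := p.2.2
    rw [Fin.sum_univ_three] at h
    have h1 := congrArg Prod.fst h
    have h2 := congrArg Prod.snd h
    simp only [Prod.fst_add, Prod.snd_add, Prod.fst_zero, Prod.snd_zero] at h1 h2
    exact Prod.ext (by dsimp only; omega) (by dsimp only; omega)
  have hg : Function.Injective g := by
    intro p p' h
    simp only [g, Prod.mk.injEq] at h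
    have e0 : p.1 0 = p'.1 0 := Prod.ext h.2.1 h.1.1
    have e1 : p.1 1 = p'.1 1 := Prod.ext h.2.2 h.1.2
    refine Subtype.ext (funext fun r => ?_)
    fin_cases r
    · exact e0
    · exact e1
    · change p.1 2 = p'.1 2
      rw [hthird, hthird, e0, e1]
  have hsupp : Function.support (fun q => graphSummand a b c y q t) ⊆ Set.range g := by
    intro q hq
    rw [Function.mem_support, graphSummand] at hq
    let p : Fin 3 → ℤ × ℤ :=
      ![(q.2.1, q.1.1), (q.2.2, q.1.2), (-q.2.1 - q.2.2, -q.1.1 - q.1.2)]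
    refine ⟨⟨p, fun r => ?_, ?_⟩, rfl⟩
    · intro h
      apply hq
      fin_cases r
      · have h1 : q.2.1 = 0 := congrArg Prod.fst h
        have h2 : q.1.1 = 0 := congrArg Prod.snd h
        rw [h1, h2, latticeTerm_zero_zero, zero_mul, zero_mul]
      · have h1 : q.2.2 = 0 := congrArg Prod.fst h
        have h2 : q.1.2 = 0 := congrArg Prod.snd h
        rw [h1, h2, latticeTerm_zero_zero, mul_zero, zero_mul]
      · have h1 : -q.2.1 - q.2.2 = 0 := congrArg Prod.fst h
        have h2 : -q.1.1 - q.1.2 = 0 := congrArg Prod.snd h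
        rw [h1, h2, latticeTerm_zero_zero, mul_zero]
    · rw [Fin.sum_univ_three]
      refine Prod.ext ?_ ?_
      · change q.2.1 + q.2.2 + (-q.2.1 - q.2.2) = 0
        ring
      · change q.1.1 + q.1.2 + (-q.1.1 - q.1.2) = 0
        ring
  rw [← hg.tsum_eq hsupp, ← tsum_mul_left]
  unfold modularGraphC
  refine tsum_congr fun p => ?_
  have him : ((t : ℂ) + y * Complex.I).im = y := by simp
  have e3 := hthird p
  rw [Fin.prod_univ_three, him]
  change (_ : ℝ) ^ (a + 1) * (_ : ℝ) ^ (b + 1) * (_ : ℝ) ^ (c + 1) = _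
  rw [div_pow_eq_mul_latticeTerm, div_pow_eq_mul_latticeTerm, div_pow_eq_mul_latticeTerm, e3]
  simp only [graphSummand, g]
  ring

/-- All terms are nonnegative, so summability of the mode sums gives summability of the whole family
of integrals, and the sum may be integrated termwise and regrouped by n. -/
theorem constantMode_modularGraphC (a b c : ℕ) {y : ℝ} (hy : 0 < y)
    (hs : Summable fun n : ℤ × ℤ => modeSum a b c n.1 n.2 (-n.1 - n.2) y) :
    constantMode (modularGraphC ![a + 1, b + 1, c + 1]) y =
      (y / Real.pi) ^ (a + b + c + 3) * ∑' n : ℤ × ℤ, modeSum a b c n.1 n.2 (-n.1 - n.2) y := by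
  have hcont : ∀ q, Continuous (graphSummand a b c y q) := fun q =>
    (((twistedExpansion_latticeTerm a _ hy).continuous_coeff _).mul
      ((twistedExpansion_latticeTerm b _ hy).continuous_coeff _)).mul
      ((twistedExpansion_latticeTerm c _ hy).continuous_coeff _)
  have hnn : ∀ q t, 0 ≤ graphSummand a b c y q t := fun q t =>
    mul_nonneg (mul_nonneg ((twistedExpansion_latticeTerm a _ hy).coeff_nonneg _ _)
      ((twistedExpansion_latticeTerm b _ hy).coeff_nonneg _ _))
      ((twistedExpansion_latticeTerm c _ hy).coeff_nonneg _ _)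
  have hfib : ∀ n : ℤ × ℤ, HasSum (fun m : ℤ × ℤ => ∫ t in (0 : ℝ)..1, graphSummand a b c y (n, m) t)
      (modeSum a b c n.1 n.2 (-n.1 - n.2) y) := fun n =>
    (hasSum_latticeTerm a b c (n₁ := n.1) (n₂ := n.2) (n₃ := -n.1 - n.2) (by ring) hy).1
  have hsum : Summable fun q => ∫ t in (0 : ℝ)..1, graphSummand a b c y q t := by
    refine (summable_prod_of_nonneg fun q =>
      intervalIntegral.integral_nonneg zero_le_one fun t _ => hnn q t).mpr
      ⟨fun n => (hfib n).summable, hs.congr fun n => (hfib n).tsum_eq.symm⟩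
  have h2 := hasSum_integral_of_summable_integral_norm
    (μ := volume.restrict (Set.Ioc (0 : ℝ) 1)) (F := graphSummand a b c y)
    (fun q => (intervalIntegrable_iff_integrableOn_Ioc_of_le zero_le_one).mp
      ((hcont q).intervalIntegrable _ _))
    (by
      refine hsum.congr fun q => ?_
      rw [intervalIntegral.integral_of_le zero_le_one]
      simp only [Real.norm_of_nonneg (hnn q _)])
  have h3 : ∫ t in (0 : ℝ)..1, ∑' q, graphSummand a b c y q t =
      ∑' q, ∫ t in (0 : ℝ)..1, graphSummand a b c y q t := by
    simp only [intervalIntegral.integral_of_le zero_le_one (μ := volume)]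
    exact h2.tsum_eq.symm
  unfold constantMode
  simp only [modularGraphC_eq_tsum]
  rw [intervalIntegral.integral_const_mul, h3, hsum.tsum_prod]
  congr 1
  exact tsum_congr fun n => (hfib n).tsum_eq

/-! ### Uniqueness of the Laurent part and identification of the coefficient. -/

/-- Dividing by y^J for the top exponent J leaves the leading coefficient as a limit, which
exponential decay forces to be 0. -/
theorem Finsupp.eq_zero_of_sum_isBigO_exp (d : ℤ →₀ ℝ) {δ : ℝ} (hδ : 0 < δ)
    (h : (fun y : ℝ => d.sum fun j x => x * (4 * Real.pi * y) ^ j) =O[atTop]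
      fun y : ℝ => Real.exp (-δ * y)) : d = 0 := by
  by_contra hd
  have hne : d.support.Nonempty := Finsupp.support_nonempty_iff.mpr hd
  set J := d.support.max' hne with hJ
  have hJmem : J ∈ d.support := d.support.max'_mem hne
  have hlo := h.trans_isLittleO (isLittleO_exp_neg_mul_rpow_atTop hδ J)
  have hlim := hlo.tendsto_div_nhds_zero
  have hlim2 : Tendsto (fun y : ℝ => ∑ j ∈ d.support, d j * (4 * Real.pi) ^ j * y ^ (j - J)) atTop
      (𝓝 (∑ j ∈ d.support, if j = J then d j * (4 * Real.pi) ^ j else 0)) := by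
    refine tendsto_finsetSum _ fun j hj => ?_
    by_cases hjJ : j = J
    · rw [if_pos hjJ, hjJ]
      simp
    · rw [if_neg hjJ]
      have hlt : j - J < 0 := by
        have := d.support.le_max' j hj
        omega
      simpa using (tendsto_zpow_atTop_zero hlt).const_mul (d j * (4 * Real.pi) ^ j)
  have heq : (fun y : ℝ => (d.sum fun j x => x * (4 * Real.pi * y) ^ j) / y ^ (J : ℝ)) =ᶠ[atTop]
      fun y : ℝ => ∑ j ∈ d.support, d j * (4 * Real.pi) ^ j * y ^ (j - J) := by
    filter_upwards [eventually_gt_atTop 0] with y hy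
    rw [Finsupp.sum, Finset.sum_div, Real.rpow_intCast]
    refine Finset.sum_congr rfl fun j _ => ?_
    rw [mul_zpow, zpow_sub₀ hy.ne']
    ring
  have h0 := tendsto_nhds_unique (hlim.congr' heq) hlim2
  rw [Finset.sum_ite_eq', if_pos hJmem] at h0
  have hpi : (4 * Real.pi) ^ J ≠ 0 := zpow_ne_zero _ (by positivity)
  exact (Finsupp.mem_support_iff.mp hJmem) ((mul_eq_zero.mp h0.symm).resolve_right hpi)

theorem IsLaurentPart.unique {F : ℝ → ℝ} {c c' : ℤ →₀ ℝ} (h : IsLaurentPart F c)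
    (h' : IsLaurentPart F c') : c = c' := by
  obtain ⟨δ, hδ, hO⟩ := h
  obtain ⟨δ', hδ', hO'⟩ := h'
  have hmono : ∀ d, min δ δ' ≤ d → (fun y : ℝ => Real.exp (-d * y)) =O[atTop]
      fun y : ℝ => Real.exp (-(min δ δ') * y) := by
    intro d hd
    refine Asymptotics.IsBigO.of_bound 1 ?_
    filter_upwards [eventually_ge_atTop 0] with y hy
    rw [one_mul, Real.norm_eq_abs, Real.norm_eq_abs, Real.abs_exp, Real.abs_exp]
    gcongr
  have hsub := (hO'.trans (hmono _ (min_le_right _ _))).sub (hO.trans (hmono _ (min_le_left _ _)))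
  refine sub_eq_zero.mp (Finsupp.eq_zero_of_sum_isBigO_exp _ (lt_min hδ hδ') (hsub.congr_left ?_))
  intro y
  rw [Finsupp.sum_sub_index fun j x x' => sub_mul _ _ _]
  ring

theorem exists_isLaurentPart (a b c : ℕ) : ∃ C : ℤ →₀ ℝ,
    IsLaurentPart (constantMode (modularGraphC ![a + 1, b + 1, c + 1])) C ∧
    C (2 - ((a + b + c + 3 : ℕ) : ℤ)) = 4 ^ (a + b + c + 1) * ((Real.pi ^ 2)⁻¹ * totalCoeff a b c) := by
  obtain ⟨β, K, δ, hδ, hβ, hy⟩ := (uniformLaurent_modeSum a b c).exists_tsum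
  set w := a + b + c + 3 with hw
  set N := 2 * (a + b + c) + 4 with hN
  -- The prefactor (y/π)^w turns y^(-j) into exponent w - j of 4πy. For j = N = 2w - 2 the exponent
  -- is 2 - w and the constant is π^(-w)(4π)^(w-2) = 4^(w-2)/π²; this π⁻² cancels the π² of the
  -- source.
  set coef : ℕ → ℝ := fun j => β j * Real.pi⁻¹ ^ w * (4 * Real.pi) ^ ((j : ℤ) - w) with hcoef
  refine ⟨∑ j ∈ Finset.range (N + 2), Finsupp.single ((w : ℤ) - j) (coef j), ⟨δ / 2, by positivity,
    ?_⟩, ?_⟩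
  · have hexp : ∀ y : ℝ, 0 < y → ((∑ j ∈ Finset.range (N + 2),
        Finsupp.single ((w : ℤ) - j) (coef j)).sum fun j x => x * (4 * Real.pi * y) ^ j) =
        (y / Real.pi) ^ w * ∑ j ∈ Finset.range (N + 2), β j * y⁻¹ ^ j := by
      intro y hy0
      rw [← Finsupp.sum_finsetSum_index (fun j => zero_mul _) (fun j x x' => add_mul _ _ _),
        Finset.mul_sum]
      refine Finset.sum_congr rfl fun j _ => ?_
      rw [Finsupp.sum_single_index (zero_mul _), hcoef]
      beta_reduce
      have hp : (4 * Real.pi) ≠ 0 := by positivity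
      have hpi := Real.pi_ne_zero
      rw [mul_zpow (4 * Real.pi) y, zpow_sub₀ hp, zpow_sub₀ hp, zpow_sub₀ hy0.ne']
      simp only [zpow_natCast, inv_pow, div_pow]
      field_simp
    refine Asymptotics.IsBigO.trans (g := fun y : ℝ => y ^ w * Real.exp (-(δ * y))) ?_ ?_
    · refine Asymptotics.IsBigO.of_bound ((1 / Real.pi) ^ w * |K|) ?_
      filter_upwards [eventually_ge_atTop 1] with y hy1
      have hy0 : 0 < y := by linarith
      obtain ⟨hs, hb⟩ := hy y hy1
      rw [constantMode_modularGraphC a b c hy0 hs, hexp y hy0, ← mul_sub, norm_mul, norm_mul,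
        Real.norm_of_nonneg (by positivity : 0 ≤ (y / Real.pi) ^ w),
        Real.norm_of_nonneg (by positivity : 0 ≤ y ^ w), Real.norm_eq_abs, Real.norm_eq_abs,
        Real.abs_exp]
      calc _ ≤ (y / Real.pi) ^ w * (|K| * Real.exp (-(δ * y))) := by
            gcongr
            exact hb.trans (mul_le_mul_of_nonneg_right (le_abs_self _) (Real.exp_nonneg _))
        _ = _ := by rw [div_eq_mul_one_div, mul_pow]; ring
    -- Half of the decay rate absorbs the factor y^w.
    · have h := (isLittleO_exp_neg_mul_rpow_atTop (half_pos hδ) (-(w : ℝ))).isBigO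
      have h2 := (Asymptotics.isBigO_refl (fun y : ℝ => y ^ w * Real.exp (-(δ / 2) * y)) atTop).mul h
      refine (h2.congr' (Eventually.of_forall fun y => ?_) ?_)
      · beta_reduce
        rw [mul_assoc, ← Real.exp_add]
        ring_nf
      · filter_upwards [eventually_gt_atTop 0] with y hy0
        rw [Real.rpow_neg hy0.le, Real.rpow_natCast]
        have : y ^ w ≠ 0 := by positivity
        field_simp
  · rw [Finsupp.finsetSum_apply]
    simp only [Finsupp.single_apply]
    have hiff : ∀ j : ℕ, ((w : ℤ) - j = 2 - (w : ℤ)) ↔ j = N := by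
      intro j; omega
    simp only [hiff]
    rw [Finset.sum_ite_eq', if_pos (by simp), hcoef]
    beta_reduce
    rw [hβ, show ((N : ℤ) - w) = ((a + b + c + 1 : ℕ) : ℤ) by omega, zpow_natCast, mul_pow,
      show w = (a + b + c + 1) + 2 by omega, pow_add, inv_pow, inv_pow]
    have := Real.pi_ne_zero
    rw [totalCoeff]
    field_simp

theorem exists_of_mem_oddZetaSpan {w : ℕ} {x : ℝ} (hx : x ∈ oddZetaSpan w) :
    ∃ f : ℕ → ℚ, x = ∑ k ∈ Finset.Icc 1 (w - 3),
      (f k : ℝ) * (zetaReal (2 * k + 1) * zetaReal (2 * w - 2 * k - 3)) := by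
  obtain ⟨f, rfl⟩ := Submodule.mem_span_image_finset_iff_exists_fun' ℚ |>.mp hx
  exact ⟨f, Finset.sum_congr rfl fun k _ => Rat.smul_def _ _⟩

theorem ofReal_zetaReal {k : ℕ} (hk : 1 < k) : ((zetaReal k : ℝ) : ℂ) = riemannZeta k := by
  rw [zeta_nat_eq_tsum_of_gt_one hk, zetaReal, Complex.ofReal_tsum]
  push_cast
  rfl

theorem theorem2 (a₁ a₂ a₃ w : ℕ) (h₁ : 1 ≤ a₁) (h₂ : 1 ≤ a₂) (h₃ : 1 ≤ a₃)
    (hw : w = a₁ + a₂ + a₃) :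
    (∃! c : ℤ →₀ ℝ, IsLaurentPart (constantMode (modularGraphC ![a₁, a₂, a₃])) c) ∧
    ∀ c : ℤ →₀ ℝ, IsLaurentPart (constantMode (modularGraphC ![a₁, a₂, a₃])) c →
      ∃ γ : ℕ → ℚ,
        ((c (2 - (w : ℤ)) : ℝ) : ℂ) =
          ∑ k ∈ Finset.Icc 1 (w - 3),
            (γ k : ℂ) / 2 * riemannZeta (2 * (k : ℂ) + 1) *
              riemannZeta (2 * (w : ℂ) - 2 * (k : ℂ) - 3) := by
  obtain ⟨a, rfl⟩ := Nat.exists_eq_add_of_le' h₁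
  obtain ⟨b, rfl⟩ := Nat.exists_eq_add_of_le' h₂
  obtain ⟨d, rfl⟩ := Nat.exists_eq_add_of_le' h₃
  have hw' : w = a + b + d + 3 := by omega
  obtain ⟨C, hC, hval⟩ := exists_isLaurentPart a b d
  refine ⟨⟨C, hC, fun c hc => hc.unique hC⟩, fun c hc => ?_⟩
  rw [hc.unique hC, hw', hval]
  have hmem := totalCoeff_mem (fun a b c => (uniformLaurent_modeSum a b c).summable_coeff) a b d
  obtain ⟨f, hf⟩ := exists_of_mem_oddZetaSpan hmem
  -- The 2 offsets the 1/2 in the statement, and 4^(w-2) is the normalization of the coefficient.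
  refine ⟨fun k => 2 * 4 ^ (a + b + d + 1) * f k, ?_⟩
  rw [hf, Finset.mul_sum, Complex.ofReal_sum]
  refine Finset.sum_congr rfl fun k hk => ?_
  rw [Finset.mem_Icc] at hk
  have e₁ : (2 * (k : ℂ) + 1) = ((2 * k + 1 : ℕ) : ℂ) := by push_cast; ring
  have e₂ : (2 * ((a + b + d + 3 : ℕ) : ℂ) - 2 * (k : ℂ) - 3) =
      ((2 * (a + b + d + 3) - 2 * k - 3 : ℕ) : ℂ) := by
    rw [Nat.cast_sub (by omega), Nat.cast_sub (by omega)]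
    push_cast
    ring
  rw [e₁, e₂, ← ofReal_zetaReal (by omega), ← ofReal_zetaReal (by omega)]
  push_cast
  ring
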